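/- Let $n\ge 1$ be odd and let $\mathfrak g=\mathfrak{so}_{n+4}(\mathbb C)$ be the complex simple Lie algebra of type $\mathsf B_{(n+3)/2}$, with adjoint group $G=\mathrm{SO}_{n+4}(\mathbb C)$. Let $\gamma$ be the highest root, $\gamma^\vee$ its coroot, and let $$\mathfrak g=\mathfrak g_{-2}\oplus\mathfrak g_{-1}\oplus\mathfrak g_0\oplus\mathfrak g_1\oplus\mathfrak g_2,\qquad \mathfrak g_i=\{x\in\mathfrak g : [\gamma^\vee,x]=i\,x\},$$ be the contact grading, so that $\dim\mathfrak g_{-2}=1$, $\dim\mathfrak g_{-1}=2n$, and the Lie bracket $\omega:\Lambda^2\mathfrak g_{-1}\to\mathfrak g_{-2}$ is a twisted symplectic form. Let $G_0\subset G$ be the subgroup of elements whose adjoint action preserves every $\mathfrak g_i$ (the Levi factor of the stabiliser of the line $\mathfrak g_\gamma=\mathfrak g_2\in\mathbb P\mathfrak g$), and let $G_0^{\mathrm{ss}}=[G_0,G_0]$. Let $\Lambda^n_0\mathfrak g_{-1}$ (the Plücker space) be the kernel of the contraction $\Lambda^n\mathfrak g_{-1}\to\Lambda^{n-2}\mathfrak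 g_{-1}\otimes\mathfrak g_{-2}$ with $\omega$ (for $n=1$ this map is zero). Let $I_2\subset S^2(\Lambda^n_0\mathfrak g_{-1})^*$ be the space of quadratic polynomials vanishing on every line $\det L=\Lambda^nL\subset\Lambda^n_0\mathfrak g_{-1}$ with $L\subset\mathfrak g_{-1}$ Lagrangian, i.e. the degree $2$ part of the homogeneous ideal of the Plücker-embedded Lagrangian Grassmannian, and let $$R_2=\bigl(S^2(\Lambda^n_0\mathfrak g_{-1})^*/I_2\bigr)^{G_0^{\mathrm{ss}}}.$$ Then there is no nonzero $G_0^{\mathrm{ss}}$-invariant element of $S^2(\Lambda^n_0\mathfrak g_{-1})^*$, and $\mathbb P R_2=\emptyset$. -/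

import Mathlib

open scoped Matrix LinearAlgebra.Projectivization

noncomputable section

namespace TypeB

attribute [local instance 100] LieRing.ofAssociativeRing

/-! ### Multilinear preliminaries: contraction with a bilinear form -/

section Contraction

variable {V : Type*} [AddCommGroup V] [Module ℂ V]

/-- Contraction of elements of `Λ V` with an element of `V* ⊗ V*`; on a pure tensor `α ⊗ β` it is
the interior product with `α` followed by the interior product with `β`. -/
def contractTensor :
    TensorProduct ℂ (Module.Dual ℂ V) (Module.Dual ℂ V) →ₗ[ℂ]
      (ExteriorAlgebra ℂ V →ₗ[ℂ] ExteriorAlgebra ℂ V) :=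
  TensorProduct.lift
    ((LinearMap.llcomp ℂ (ExteriorAlgebra ℂ V) (ExteriorAlgebra ℂ V)
        (ExteriorAlgebra ℂ V)).flip.compl₁₂
      (CliffordAlgebra.contractLeft (Q := (0 : QuadraticForm ℂ V)))
      (CliffordAlgebra.contractLeft (Q := (0 : QuadraticForm ℂ V))))

/-- Contraction `Λⁱ V → Λⁱ⁻² V` with a bilinear form `B` on a finite-dimensional space `V`, where
`B` is regarded as an element of `V* ⊗ V*`. (It vanishes on `Λ⁰` and `Λ¹`.) -/
def contract [FiniteDimensional ℂ V] (B : V →ₗ[ℂ] V →ₗ[ℂ] ℂ) :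
    ExteriorAlgebra ℂ V →ₗ[ℂ] ExteriorAlgebra ℂ V :=
  contractTensor ((dualTensorHomEquiv ℂ V (Module.Dual ℂ V)).symm B)

theorem contractTensor_tmul (a b : Module.Dual ℂ V) (x : ExteriorAlgebra ℂ V) :
    contractTensor (TensorProduct.tmul ℂ a b) x =
      CliffordAlgebra.contractLeft (Q := (0 : QuadraticForm ℂ V)) b
        (CliffordAlgebra.contractLeft (Q := (0 : QuadraticForm ℂ V)) a x) := rfl

theorem contractLeft_map (f : V →ₗ[ℂ] V) (d : Module.Dual ℂ V) (x : ExteriorAlgebra ℂ V) :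
    CliffordAlgebra.contractLeft (Q := (0 : QuadraticForm ℂ V)) d (ExteriorAlgebra.map f x) =
      ExteriorAlgebra.map f
        (CliffordAlgebra.contractLeft (Q := (0 : QuadraticForm ℂ V)) (d ∘ₗ f) x) := by
  induction x using CliffordAlgebra.left_induction with
  | algebraMap r =>
    have h : (ExteriorAlgebra.map f) ((algebraMap ℂ (CliffordAlgebra (0 : QuadraticForm ℂ V))) r)
        = algebraMap ℂ (CliffordAlgebra (0 : QuadraticForm ℂ V)) r :=
      (ExteriorAlgebra.map f).commutes r
    rw [h, CliffordAlgebra.contractLeft_algebraMap, CliffordAlgebra.contractLeft_algebraMap,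
      map_zero]
  | add x y hx hy => simp only [map_add, hx, hy]
  | ι_mul x v hx =>
    have h : (ExteriorAlgebra.map f) (CliffordAlgebra.ι (0 : QuadraticForm ℂ V) v * x)
        = CliffordAlgebra.ι (0 : QuadraticForm ℂ V) (f v) * ExteriorAlgebra.map f x := by
      rw [map_mul]; congr 1; exact ExteriorAlgebra.map_apply_ι f v
    rw [h, CliffordAlgebra.contractLeft_ι_mul, CliffordAlgebra.contractLeft_ι_mul, hx, map_sub,
      map_smul, map_mul]
    congr 2
    exact (ExteriorAlgebra.map_apply_ι f v).symm

theorem contract_map [FiniteDimensional ℂ V] (B : V →ₗ[ℂ] V →ₗ[ℂ] ℂ) (f : V →ₗ[ℂ] V)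
    (x : ExteriorAlgebra ℂ V) :
    contract B (ExteriorAlgebra.map f x) = ExteriorAlgebra.map f (contract (B.compl₁₂ f f) x) := by
  have key : ∀ t : TensorProduct ℂ (Module.Dual ℂ V) (Module.Dual ℂ V),
      contractTensor t (ExteriorAlgebra.map f x) = ExteriorAlgebra.map f
        (contractTensor (TensorProduct.map f.dualMap f.dualMap t) x) ∧
      dualTensorHom ℂ V (Module.Dual ℂ V) (TensorProduct.map f.dualMap f.dualMap t) =
        (dualTensorHom ℂ V (Module.Dual ℂ V) t).compl₁₂ f f := by
    intro t
    induction t using TensorProduct.induction_on with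
    | zero => exact ⟨by simp, by ext v w; simp⟩
    | add s t hs ht =>
      refine ⟨?_, ?_⟩
      · simp only [map_add, LinearMap.add_apply, hs.1, ht.1]
      · simp only [map_add, hs.2, ht.2]
        rfl
    | tmul a b =>
      refine ⟨?_, ?_⟩
      · rw [TensorProduct.map_tmul, contractTensor_tmul, contractTensor_tmul, contractLeft_map,
          contractLeft_map]
        rfl
      · ext v w
        simp
  obtain ⟨h1, h2⟩ := key ((dualTensorHomEquiv ℂ V (Module.Dual ℂ V)).symm B)
  have h3 : dualTensorHom ℂ V (Module.Dual ℂ V)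
      ((dualTensorHomEquiv ℂ V (Module.Dual ℂ V)).symm B) = B :=
    (dualTensorHomEquiv ℂ V (Module.Dual ℂ V)).apply_symm_apply B
  rw [h3] at h2
  unfold contract
  rw [h1, ← h2]
  congr 3
  exact ((dualTensorHomEquiv ℂ V (Module.Dual ℂ V)).symm_apply_apply _).symm

end Contraction

/-! ### Lagrangian subspaces and the Plücker space of a twisted symplectic space -/

section TwistedSymplectic

variable {V U : Type*} [AddCommGroup V] [Module ℂ V] [AddCommGroup U] [Module ℂ U]

theorem coe_exteriorPower_map (n : ℕ) (f : V →ₗ[ℂ] V) (x : ⋀[ℂ]^n V) :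
    (exteriorPower.map n f x : ExteriorAlgebra ℂ V) = ExteriorAlgebra.map f x := by
  have h : (Submodule.subtype _) ∘ₗ exteriorPower.map n f =
      (ExteriorAlgebra.map f).toLinearMap ∘ₗ Submodule.subtype (⋀[ℂ]^n V) := by
    apply exteriorPower.linearMap_ext
    ext v
    simp [ExteriorAlgebra.map_apply_ιMulti]
  exact LinearMap.congr_fun h x

variable [FiniteDimensional ℂ V]

/-- For a `U`-valued bilinear form `ω` on `V`, the space `Λⁿ_0 V ⊆ Λⁿ V`: the kernel of the
contraction `Λⁿ V → Λⁿ⁻² V ⊗ U` with `ω`. An element lies in this kernel iff it is annihilated by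
the contraction with `ℓ ∘ ω` for every linear functional `ℓ` on `U`. -/
def primitive (n : ℕ) (ω : V →ₗ[ℂ] V →ₗ[ℂ] U) : Submodule ℂ (⋀[ℂ]^n V) where
  carrier := {x | ∀ ℓ : Module.Dual ℂ U,
    contract (ω.compr₂ ℓ) (x : ExteriorAlgebra ℂ V) = 0}
  zero_mem' := fun ℓ => by simp
  add_mem' := fun {x y} hx hy ℓ => by simp [hx ℓ, hy ℓ]
  smul_mem' := fun c x hx ℓ => by simp [hx ℓ]

theorem map_mem_primitive (n : ℕ) (ω : V →ₗ[ℂ] V →ₗ[ℂ] U) (f : V →ₗ[ℂ] V) (k : U →ₗ[ℂ] U)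
    (hf : ∀ x y, ω (f x) (f y) = k (ω x y)) {x : ⋀[ℂ]^n V} (hx : x ∈ primitive n ω) :
    exteriorPower.map n f x ∈ primitive n ω := by
  intro ℓ
  rw [coe_exteriorPower_map, contract_map]
  have h : (ω.compr₂ ℓ).compl₁₂ f f = ω.compr₂ (ℓ ∘ₗ k) := by
    ext x y
    simp [hf]
  rw [h, hx (ℓ ∘ₗ k), map_zero]

/-- The space `Λⁿ_0 V` as a vector space in its own right. -/
def Primitive (n : ℕ) (ω : V →ₗ[ℂ] V →ₗ[ℂ] U) : Type _ := primitive n ω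

instance (n : ℕ) (ω : V →ₗ[ℂ] V →ₗ[ℂ] U) : AddCommGroup (Primitive n ω) :=
  inferInstanceAs (AddCommGroup (primitive n ω))

instance (n : ℕ) (ω : V →ₗ[ℂ] V →ₗ[ℂ] U) : Module ℂ (Primitive n ω) :=
  inferInstanceAs (Module ℂ (primitive n ω))

/-- The inclusion `Λⁿ_0 V ⊆ Λⁿ V`. -/
def Primitive.incl (n : ℕ) (ω : V →ₗ[ℂ] V →ₗ[ℂ] U) : Primitive n ω →ₗ[ℂ] ⋀[ℂ]^n V :=
  (primitive n ω).subtype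

/-- The map on `Λⁿ_0 V` induced by a conformal endomorphism `f` of `(V, ω)`. -/
def mapPrimitive (n : ℕ) (ω : V →ₗ[ℂ] V →ₗ[ℂ] U) (f : V →ₗ[ℂ] V) (k : U →ₗ[ℂ] U)
    (hf : ∀ x y, ω (f x) (f y) = k (ω x y)) : Primitive n ω →ₗ[ℂ] Primitive n ω :=
  (exteriorPower.map n f).restrict fun _ hx => map_mem_primitive n ω f k hf hx

/-- Pull-back of quadratic polynomials by a linear map. -/
def quadPull {W : Type*} [AddCommMonoid W] [Module ℂ W] (f : W →ₗ[ℂ] W) :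
    QuadraticForm ℂ W →ₗ[ℂ] QuadraticForm ℂ W where
  toFun Q := Q.comp f
  map_add' _ _ := rfl
  map_smul' _ _ := rfl

/-- A subspace of `V` (with `dim V = 2n`) is Lagrangian if it is `n`-dimensional and isotropic. -/
def IsLagrangian (n : ℕ) (ω : V →ₗ[ℂ] V →ₗ[ℂ] U) (L : Submodule ℂ V) : Prop :=
  Module.finrank ℂ L = n ∧ ∀ x ∈ L, ∀ y ∈ L, ω x y = 0

/-- The line `det L = Λⁿ L ⊆ Λⁿ V`, which is the image of `L` under the Plücker embedding. -/
def detLine (n : ℕ) (L : Submodule ℂ V) : Submodule ℂ (⋀[ℂ]^n V) :=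
  LinearMap.range (exteriorPower.map n L.subtype)

/-- The degree two part of the homogeneous ideal of the Plücker-embedded Lagrangian Grassmannian in
`ℙ (Λⁿ_0 V)`: the quadratic polynomials vanishing on its affine cone. -/
def quadIdeal (n : ℕ) (ω : V →ₗ[ℂ] V →ₗ[ℂ] U) :
    Submodule ℂ (QuadraticForm ℂ (Primitive n ω)) where
  carrier := {Q | ∀ L : Submodule ℂ V, IsLagrangian n ω L →
    ∀ w : Primitive n ω, Primitive.incl n ω w ∈ detLine n L → Q w = 0}
  zero_mem' := fun _ _ _ _ => rfl
  add_mem' := fun {P Q} hP hQ L hL w hw => by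
    simp [hP L hL w hw, hQ L hL w hw]
  smul_mem' := fun c Q hQ L hL w hw => by
    simp [hQ L hL w hw]

theorem quadIdeal_le_comap (n : ℕ) (ω : V →ₗ[ℂ] V →ₗ[ℂ] U) (f : V →ₗ[ℂ] V) (k : U →ₗ[ℂ] U)
    (hf : ∀ x y, ω (f x) (f y) = k (ω x y)) (hinj : Function.Injective f) :
    quadIdeal n ω ≤ (quadIdeal n ω).comap (quadPull (mapPrimitive n ω f k hf)) := by
  intro Q hQ L hL w hw
  have hL' : IsLagrangian n ω (L.map f) := by
    refine ⟨?_, ?_⟩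
    · rw [← hL.1]
      exact (LinearEquiv.finrank_eq (Submodule.equivMapOfInjective f hinj L)).symm
    · rintro _ ⟨x, hx, rfl⟩ _ ⟨y, hy, rfl⟩
      rw [hf, hL.2 x hx y hy, map_zero]
  refine hQ _ hL' (mapPrimitive n ω f k hf w) ?_
  obtain ⟨u, hu⟩ := hw
  refine ⟨exteriorPower.map n (f.submoduleMap L) u, ?_⟩
  change _ = exteriorPower.map n f (Primitive.incl n ω w)
  rw [← hu, ← LinearMap.comp_apply, ← LinearMap.comp_apply, ← exteriorPower.map_comp,
    ← exteriorPower.map_comp]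
  rfl

/-- The degree two part `S² (Λⁿ_0 V)* / I₂` of the homogeneous coordinate ring of the
Plücker-embedded Lagrangian Grassmannian. -/
abbrev QuadCoord (n : ℕ) (ω : V →ₗ[ℂ] V →ₗ[ℂ] U) : Type _ :=
  QuadraticForm ℂ (Primitive n ω) ⧸ quadIdeal n ω

/-- Pull-back by an injective conformal endomorphism on the degree two part of the homogeneous
coordinate ring. -/
def quadCoordPull (n : ℕ) (ω : V →ₗ[ℂ] V →ₗ[ℂ] U) (f : V →ₗ[ℂ] V) (k : U →ₗ[ℂ] U)
    (hf : ∀ x y, ω (f x) (f y) = k (ω x y)) (hinj : Function.Injective f) :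
    QuadCoord n ω →ₗ[ℂ] QuadCoord n ω :=
  (quadIdeal n ω).mapQ (quadIdeal n ω) (quadPull (mapPrimitive n ω f k hf))
    (quadIdeal_le_comap n ω f k hf hinj)

end TwistedSymplectic

/-! ### The Lie algebra of type `B` and its adjoint group -/

/-- Index type of the standard representation, of dimension `2m + 5 = n + 4` with `n = 2m + 1`. -/
abbrev Idx (m : ℕ) : Type := Unit ⊕ Fin (m + 2) ⊕ Fin (m + 2)

/-- The Gram matrix of the (split) symmetric bilinear form defining type `B`. -/
abbrev form (m : ℕ) : Matrix (Idx m) (Idx m) ℂ := LieAlgebra.Orthogonal.JB (Fin (m + 2)) ℂ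

/-- The complex simple Lie algebra of type `B` and rank `m + 2`, i.e. `so(n + 4)`, `n = 2m + 1`. -/
abbrev 𝔤 (m : ℕ) : LieSubalgebra ℂ (Matrix (Idx m) (Idx m) ℂ) :=
  LieAlgebra.Orthogonal.typeB (Fin (m + 2)) ℂ

theorem mem_𝔤 {m : ℕ} {A : Matrix (Idx m) (Idx m) ℂ} :
    A ∈ 𝔤 m ↔ Aᵀ * form m = form m * (-A) := by
  unfold 𝔤 LieAlgebra.Orthogonal.typeB
  rw [mem_skewAdjointMatricesLieSubalgebra, mem_skewAdjointMatricesSubmodule]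
  rfl

/-- The connected adjoint group of type `B`: the special orthogonal group `SO(n + 4)`, which acts on
its Lie algebra faithfully by conjugation and is thus the identity component of `Aut 𝔤`. -/
def SO (m : ℕ) : Subgroup (Matrix.SpecialLinearGroup (Idx m) ℂ) where
  carrier := {g | (g : Matrix (Idx m) (Idx m) ℂ)ᵀ * form m * (g : Matrix (Idx m) (Idx m) ℂ) = form m}
  one_mem' := by simp
  mul_mem' := by
    intro a b ha hb
    simp only [Set.mem_ofPred_eq, Matrix.SpecialLinearGroup.coe_mul, Matrix.transpose_mul] at *
    calc _ = (b : Matrix (Idx m) (Idx m) ℂ)ᵀ * ((a : Matrix (Idx m) (Idx m) ℂ)ᵀ * form m *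
          (a : Matrix (Idx m) (Idx m) ℂ)) * (b : Matrix (Idx m) (Idx m) ℂ) := by
            simp only [Matrix.mul_assoc]
      _ = _ := by rw [ha, hb]
  inv_mem' := by
    intro a ha
    simp only [Set.mem_ofPred_eq] at *
    have h : (a : Matrix (Idx m) (Idx m) ℂ) * ((a⁻¹ : Matrix.SpecialLinearGroup (Idx m) ℂ) :
        Matrix (Idx m) (Idx m) ℂ) = 1 := by
      rw [← Matrix.SpecialLinearGroup.coe_mul, mul_inv_cancel, Matrix.SpecialLinearGroup.coe_one]
    have h' : ((a⁻¹ : Matrix.SpecialLinearGroup (Idx m) ℂ) : Matrix (Idx m) (Idx m) ℂ)ᵀ *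
        (a : Matrix (Idx m) (Idx m) ℂ)ᵀ = 1 := by
      rw [← Matrix.transpose_mul, h, Matrix.transpose_one]
    generalize ((a⁻¹ : Matrix.SpecialLinearGroup (Idx m) ℂ) : Matrix (Idx m) (Idx m) ℂ) = b at *
    calc bᵀ * form m * b
        = bᵀ * ((a : Matrix (Idx m) (Idx m) ℂ)ᵀ * form m * (a : Matrix (Idx m) (Idx m) ℂ)) * b := by
          rw [ha]
      _ = (bᵀ * (a : Matrix (Idx m) (Idx m) ℂ)ᵀ) * form m * ((a : Matrix (Idx m) (Idx m) ℂ) * b) := by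
          simp only [Matrix.mul_assoc]
      _ = form m := by rw [h, h', Matrix.one_mul, Matrix.mul_one]

/-- The matrix of an element of the group. -/
abbrev mat {m : ℕ} (g : SO m) : Matrix (Idx m) (Idx m) ℂ :=
  (g : Matrix.SpecialLinearGroup (Idx m) ℂ)

theorem mat_mul_inv {m : ℕ} (g : SO m) : mat g * mat g⁻¹ = 1 := by
  change ((g : Matrix.SpecialLinearGroup (Idx m) ℂ) : Matrix (Idx m) (Idx m) ℂ) *
    (((g : Matrix.SpecialLinearGroup (Idx m) ℂ)⁻¹ : Matrix.SpecialLinearGroup (Idx m) ℂ) :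
      Matrix (Idx m) (Idx m) ℂ) = 1
  rw [← Matrix.SpecialLinearGroup.coe_mul, mul_inv_cancel, Matrix.SpecialLinearGroup.coe_one]

theorem mat_inv_mul {m : ℕ} (g : SO m) : mat g⁻¹ * mat g = 1 := by
  simpa using mat_mul_inv g⁻¹

theorem conj_mem {m : ℕ} (g : SO m) (A : 𝔤 m) :
    mat g * (A : Matrix (Idx m) (Idx m) ℂ) * mat g⁻¹ ∈ 𝔤 m := by
  rw [mem_𝔤]
  have hA := mem_𝔤.1 A.2
  have hg : (mat g)ᵀ * form m * mat g = form m := g.2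
  have hi : (mat g⁻¹)ᵀ * form m * mat g⁻¹ = form m := (g⁻¹).2
  have h1 : (mat g)ᵀ * form m = form m * mat g⁻¹ := by
    calc _ = (mat g)ᵀ * form m * (mat g * mat g⁻¹) := by rw [mat_mul_inv, Matrix.mul_one]
      _ = ((mat g)ᵀ * form m * mat g) * mat g⁻¹ := by simp only [Matrix.mul_assoc]
      _ = _ := by rw [hg]
  have h2 : (mat g⁻¹)ᵀ * form m = form m * mat g := by
    calc _ = (mat g⁻¹)ᵀ * form m * (mat g⁻¹ * mat g) := by rw [mat_inv_mul, Matrix.mul_one]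
      _ = ((mat g⁻¹)ᵀ * form m * mat g⁻¹) * mat g := by simp only [Matrix.mul_assoc]
      _ = _ := by rw [hi]
  calc (mat g * (A : Matrix (Idx m) (Idx m) ℂ) * mat g⁻¹)ᵀ * form m
      = (mat g⁻¹)ᵀ * ((A : Matrix (Idx m) (Idx m) ℂ)ᵀ * ((mat g)ᵀ * form m)) := by
        simp only [Matrix.transpose_mul, Matrix.mul_assoc]
    _ = (mat g⁻¹)ᵀ * (((A : Matrix (Idx m) (Idx m) ℂ)ᵀ * form m) * mat g⁻¹) := by
        rw [h1, Matrix.mul_assoc]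
    _ = ((mat g⁻¹)ᵀ * form m) * (-(A : Matrix (Idx m) (Idx m) ℂ)) * mat g⁻¹ := by
        rw [hA]; simp only [Matrix.mul_assoc]
    _ = _ := by
        rw [h2]; simp only [Matrix.mul_assoc, Matrix.neg_mul, Matrix.mul_neg]

/-- The adjoint representation, `Ad g A = g A g⁻¹`. -/
def Ad (m : ℕ) : Representation ℂ (SO m) (𝔤 m) where
  toFun g :=
    { toFun := fun A => ⟨mat g * (A : Matrix (Idx m) (Idx m) ℂ) * mat g⁻¹, conj_mem g A⟩
      map_add' := fun A B => Subtype.ext (by simp [Matrix.mul_add, Matrix.add_mul])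
      map_smul' := fun c A => Subtype.ext (by simp) }
  map_one' := by
    ext A : 2
    simp [mat]
  map_mul' g h := by
    ext A : 2
    simp [mat, Matrix.mul_assoc]

theorem Ad_lie {m : ℕ} (g : SO m) (A B : 𝔤 m) : Ad m g ⁅A, B⁆ = ⁅Ad m g A, Ad m g B⁆ := by
  apply Subtype.ext
  have h := mat_inv_mul g
  change mat g * ⁅(A : Matrix (Idx m) (Idx m) ℂ), (B : Matrix (Idx m) (Idx m) ℂ)⁆ * mat g⁻¹ =
    ⁅mat g * (A : Matrix (Idx m) (Idx m) ℂ) * mat g⁻¹,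
      mat g * (B : Matrix (Idx m) (Idx m) ℂ) * mat g⁻¹⁆
  have key : ∀ X Y : Matrix (Idx m) (Idx m) ℂ,
      (mat g * X * mat g⁻¹) * (mat g * Y * mat g⁻¹) = mat g * (X * Y) * mat g⁻¹ := by
    intro X Y
    calc _ = mat g * X * (mat g⁻¹ * mat g) * Y * mat g⁻¹ := by simp only [Matrix.mul_assoc]
      _ = _ := by rw [h]; simp only [Matrix.mul_one, Matrix.mul_assoc]
  rw [Ring.lie_def, Ring.lie_def, key, key, Matrix.mul_sub, Matrix.sub_mul]

/-! ### The contact grading -/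

/-- Diagonal entries of the coroot of the highest root `ε₁ + ε₂`. -/
def gradingDiag (m : ℕ) : Idx m → ℂ :=
  Sum.elim (fun _ => 0)
    (Sum.elim (fun i => if (i : ℕ) < 2 then 1 else 0) (fun i => if (i : ℕ) < 2 then -1 else 0))

theorem gradingDiag_mem (m : ℕ) : Matrix.diagonal (gradingDiag m) ∈ 𝔤 m := by
  rw [mem_𝔤]
  ext i j
  rw [Matrix.diagonal_transpose, Matrix.diagonal_mul, Matrix.mul_neg, Matrix.neg_apply,
    Matrix.mul_diagonal]
  rcases i with i | i | i <;> rcases j with j | j | j <;>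
    simp [form, LieAlgebra.Orthogonal.JB, LieAlgebra.Orthogonal.JD, gradingDiag,
      Matrix.one_apply] <;>
    (by_cases h : i = j <;> simp [h]; split_ifs <;> simp)

/-- The grading element of the contact grading: the coroot `γ^∨` of the highest root `γ`. -/
def gradingElt (m : ℕ) : 𝔤 m := ⟨Matrix.diagonal (gradingDiag m), gradingDiag_mem m⟩

/-- The graded piece `𝔤_i = {x | [γ^∨, x] = i x}` of the contact grading
`𝔤 = 𝔤_{-2} ⊕ 𝔤_{-1} ⊕ 𝔤_0 ⊕ 𝔤_1 ⊕ 𝔤_2`. -/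
def gr (m : ℕ) (i : ℤ) : Submodule ℂ (𝔤 m) :=
  Module.End.eigenspace (LieAlgebra.ad ℂ (𝔤 m) (gradingElt m)) (i : ℂ)

theorem mem_gr {m : ℕ} {i : ℤ} {x : 𝔤 m} : x ∈ gr m i ↔ ⁅gradingElt m, x⁆ = (i : ℂ) • x := by
  simp [gr]

theorem lie_mem_gr {m : ℕ} {i j : ℤ} {x y : 𝔤 m} (hx : x ∈ gr m i) (hy : y ∈ gr m j) :
    ⁅x, y⁆ ∈ gr m (i + j) := by
  rw [mem_gr] at *
  rw [leibniz_lie, hx, hy, smul_lie, lie_smul, ← add_smul]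
  push_cast
  rfl

theorem lie_mem_gr_neg_two {m : ℕ} (x y : gr m (-1)) : ⁅(x : 𝔤 m), (y : 𝔤 m)⁆ ∈ gr m (-2) := by
  have h := lie_mem_gr x.2 y.2
  rwa [show (-1 : ℤ) + -1 = -2 by norm_num] at h

/-- The contact space `𝔤_{-1}`. -/
abbrev V (m : ℕ) : Type := gr m (-1)

/-- The twisted symplectic form `ω : 𝔤_{-1} × 𝔤_{-1} → 𝔤_{-2}` given by the Lie bracket. -/
def omega (m : ℕ) : V m →ₗ[ℂ] V m →ₗ[ℂ] gr m (-2) :=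
  LinearMap.mk₂ ℂ (fun x y => ⟨⁅(x : 𝔤 m), (y : 𝔤 m)⁆, lie_mem_gr_neg_two x y⟩)
    (fun x y z => Subtype.ext (by simp))
    (fun c x y => Subtype.ext (by simp))
    (fun x y z => Subtype.ext (by simp))
    (fun c x y => Subtype.ext (by simp))

/-! ### The groups `G₀` and `G₀^ss` -/

/-- The Levi subgroup `G₀` of the stabiliser `P` of the highest root line `𝔤_2 ∈ ℙ 𝔤`: the elements
of the group whose adjoint action preserves every piece of the contact grading. -/
def G₀ (m : ℕ) : Subgroup (SO m) where
  carrier := {g | ∀ i : ℤ, (gr m i).map (Ad m g) = gr m i}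
  one_mem' := by
    intro i
    rw [map_one]
    exact Submodule.map_id _
  mul_mem' := by
    intro a b ha hb i
    rw [map_mul]
    change Submodule.map (Ad m a ∘ₗ Ad m b) _ = _
    rw [Submodule.map_comp, hb i, ha i]
  inv_mem' := by
    intro a ha i
    conv_lhs => rw [← ha i]
    rw [← Submodule.map_comp]
    change Submodule.map (Ad m a⁻¹ * Ad m a) _ = _
    rw [← map_mul, inv_mul_cancel, map_one]
    exact Submodule.map_id _

/-- The semisimple part `G₀^ss = [G₀, G₀]`. -/
def G₀ss (m : ℕ) : Subgroup (G₀ m) := commutator (G₀ m)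

theorem Ad_mem_gr {m : ℕ} (g : G₀ m) (i : ℤ) {x : 𝔤 m} (hx : x ∈ gr m i) :
    Ad m (g : SO m) x ∈ gr m i := by
  have h := g.2 i
  rw [← h]
  exact Submodule.mem_map_of_mem hx

/-- The action of an element of `G₀` on `𝔤_i`. -/
def actGr {m : ℕ} (i : ℤ) (g : G₀ m) : gr m i →ₗ[ℂ] gr m i :=
  (Ad m (g : SO m)).restrict fun _ hx => Ad_mem_gr g i hx

theorem actGr_inv_comp {m : ℕ} (i : ℤ) (g : G₀ m) : actGr i g⁻¹ ∘ₗ actGr i g = LinearMap.id := by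
  ext x : 2
  change Ad m (g : SO m)⁻¹ (Ad m (g : SO m) (x : 𝔤 m)) = x
  rw [← Module.End.mul_apply, ← map_mul, inv_mul_cancel, map_one]
  rfl

theorem actGr_injective {m : ℕ} (i : ℤ) (g : G₀ m) : Function.Injective (actGr i g) :=
  Function.LeftInverse.injective (g := actGr i g⁻¹)
    fun x => LinearMap.congr_fun (actGr_inv_comp i g) x

theorem omega_act {m : ℕ} (g : G₀ m) (x y : V m) :
    omega m (actGr (-1) g x) (actGr (-1) g y) = actGr (-2) g (omega m x y) :=
  Subtype.ext (Ad_lie (g : SO m) (x : 𝔤 m) (y : 𝔤 m)).symm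

/-! ### The main objects -/

/-- The number `n` with `dim 𝔤_{-1} = 2n`; the Lie algebra is `so(n + 4)`. -/
abbrev halfDim (m : ℕ) : ℕ := 2 * m + 1

/-- The (Lagrangian) Plücker space `Λⁿ_0 𝔤_{-1}`. -/
abbrev Plucker (m : ℕ) : Type :=
  Primitive (halfDim m) (omega m)

/-- The action of an element of `G₀` on the Plücker space, induced by its action on `𝔤_{-1}`. -/
def actPlucker {m : ℕ} (g : G₀ m) : Plucker m →ₗ[ℂ] Plucker m :=
  mapPrimitive (halfDim m) (omega m) (actGr (-1) g) (actGr (-2) g) (omega_act g)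

/-- Quadratic polynomials on the Plücker space, i.e. elements of `S² (Λⁿ_0 𝔤_{-1})*`. -/
abbrev Quadric (m : ℕ) : Type := QuadraticForm ℂ (Plucker m)

/-- Pull-back `g^* Q = Q ∘ g` of quadratic polynomials by an element of `G₀`. -/
def pullQuadric {m : ℕ} (g : G₀ m) : Quadric m →ₗ[ℂ] Quadric m := quadPull (actPlucker g)

/-- The degree two component `S² (Λⁿ_0 𝔤_{-1})* / I₂` of the homogeneous coordinate ring of the
Lagrangian Grassmannian. -/
abbrev CoordRing₂ (m : ℕ) : Type := QuadCoord (halfDim m) (omega m)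

/-- Pull-back by an element of `G₀` on the degree two part of the homogeneous coordinate ring. -/
def pullCoord {m : ℕ} (g : G₀ m) : CoordRing₂ m →ₗ[ℂ] CoordRing₂ m :=
  quadCoordPull (halfDim m) (omega m) (actGr (-1) g) (actGr (-2) g) (omega_act g)
    (actGr_injective (-1) g)

/-- The degree two component `R₂ = (S² (Λⁿ_0 𝔤_{-1})* / I₂)^{G₀^ss}` of the ring of
`G₀^ss`-invariants in the homogeneous coordinate ring of the Lagrangian Grassmannian. -/
def R₂ (m : ℕ) : Submodule ℂ (CoordRing₂ m) where
  carrier := {q | ∀ g ∈ G₀ss m, pullCoord g q = q}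
  zero_mem' := fun g _ => map_zero _
  add_mem' := fun {p q} hp hq g hg => by rw [map_add, hp g hg, hq g hg]
  smul_mem' := fun c q hq g hg => by rw [map_smul, hq g hg]

end TypeB

end

/-! The space `𝔤_{-1}` is `ℂ² ⊗ ℂⁿ`, with `ω` the tensor product of the symplectic form on `ℂ²` and
the symmetric form on `ℂⁿ`. Up to signs, which quadratic forms do not see, `G₀ss` contains the Weyl
element `J` and the torus of `SL₂` and all real orthogonal matrices (`IsFrameOp.exists_mem_G₀ss`).
Invariance under these operators alone forces both vanishing statements. In each case the
contradiction in sign is `(-1)ⁿ = -1`, coming from `J² = -1` or from the sign in the action of `J`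
on monomials.

Quadrics on the Plücker space. Primitive `n`-vectors are spanned by products of vectors `f_{c i} ⊗ u
i` with `u` a real orthonormal basis (`primitive_mem_span`), so it suffices that the polar form of
an invariant quadric vanishes on two such products `x`, `y` (`polar_ortho_eq_zero`). If their torus
weights are not opposite, this is clear. Otherwise the span of the `u i` with `c i = 1` and that of
the `u' j` with `c' j = 0` have equal dimension, and some isometric involution `g` of `ℝⁿ`
interchanges them (`exists_swap`). Then `J ⊗ g` exchanges the lines of `x` and `y`, while its square
acts on `n`-vectors by `(-1)ⁿ = -1`. Hence the polar value equals its own negative.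

Degree two of the coordinate ring. Lifting an invariant class to an invariant quadric would need
complete reducibility; instead, any lift is invariant on the cone over the Lagrangian Grassmannian,
and this is shown to force it to vanish there (`ConeInvariant.eq_zero`). On decomposable vectors `⋀
(vᵢ ⊗ eᵢ)` the quadric is a polynomial of degree two in each binary variable `vᵢ`, invariant under
permutations, `J` and the torus. The torus leaves monomials of total weight `n`, and on these `J`
acts, up to a permutation of the variables, by `(-1)ⁿ` (`sum_mono_eq_zero`). The spectral theorem
carries the vanishing to graphs of real symmetric matrices; polynomial identities carry it to
complex symmetric matrices and then to all Lagrangian subspaces. -/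

noncomputable section

namespace TypeB

attribute [local instance 100] LieRing.ofAssociativeRing

/-! ### Contraction with a symplectic form -/

section Interior

variable {W : Type*} [AddCommGroup W] [Module ℂ W]

/-- The interior product on the exterior algebra. -/
abbrev interior (d : Module.Dual ℂ W) : ExteriorAlgebra ℂ W →ₗ[ℂ] ExteriorAlgebra ℂ W :=
  CliffordAlgebra.contractLeft (Q := (0 : QuadraticForm ℂ W)) d

theorem interior_ι_mul (d : Module.Dual ℂ W) (v : W) (x : ExteriorAlgebra ℂ W) :
    interior d (ExteriorAlgebra.ι ℂ v * x) = d v • x - ExteriorAlgebra.ι ℂ v * interior d x :=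
  CliffordAlgebra.contractLeft_ι_mul (Q := (0 : QuadraticForm ℂ W)) (d := d) v x

theorem interior_smul (c : ℂ) (d : Module.Dual ℂ W) (x : ExteriorAlgebra ℂ W) :
    interior (c • d) x = c • interior d x :=
  LinearMap.congr_fun
    (map_smul (CliffordAlgebra.contractLeft (Q := (0 : QuadraticForm ℂ W))) c d) x

theorem interior_neg (d : Module.Dual ℂ W) (x : ExteriorAlgebra ℂ W) :
    interior (-d) x = -interior d x :=
  LinearMap.congr_fun (map_neg (CliffordAlgebra.contractLeft (Q := (0 : QuadraticForm ℂ W))) d) x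

theorem interior_one (d : Module.Dual ℂ W) : interior d (1 : ExteriorAlgebra ℂ W) = 0 :=
  CliffordAlgebra.contractLeft_one (Q := (0 : QuadraticForm ℂ W)) d

theorem interior_list_prod_eq_zero (d : Module.Dual ℂ W) (l : List W) (h : ∀ v ∈ l, d v = 0) :
    interior d (l.map (ExteriorAlgebra.ι ℂ)).prod = 0 := by
  induction l with
  | nil => exact interior_one d
  | cons v l ih =>
    rw [List.map_cons, List.prod_cons, interior_ι_mul, h v (by simp), zero_smul,
      ih fun w hw => h w (by simp [hw]), mul_zero, sub_zero]

theorem ι_mul_ι_swap (v w : W) :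
    ExteriorAlgebra.ι ℂ v * ExteriorAlgebra.ι ℂ w =
      -(ExteriorAlgebra.ι ℂ w * ExteriorAlgebra.ι ℂ v) :=
  eq_neg_of_add_eq_zero_left (ExteriorAlgebra.ι_add_mul_swap v w)

variable [FiniteDimensional ℂ W]

/-- The vector `v` can be absorbed by either slot of `B`; the second slot acts after the first has
passed `v`, hence the sign. For skew `B` the two terms agree, which is the factor 2 in
`lower_ι_mul`. -/
theorem contract_ι_mul (B : W →ₗ[ℂ] W →ₗ[ℂ] ℂ) (v : W) (x : ExteriorAlgebra ℂ W) :
    contract B (ExteriorAlgebra.ι ℂ v * x) =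
      interior (B v) x - interior (B.flip v) x + ExteriorAlgebra.ι ℂ v * contract B x := by
  have key : ∀ t : TensorProduct ℂ (Module.Dual ℂ W) (Module.Dual ℂ W),
      contractTensor t (ExteriorAlgebra.ι ℂ v * x) =
        interior (dualTensorHom ℂ W (Module.Dual ℂ W) t v) x -
          interior ((dualTensorHom ℂ W (Module.Dual ℂ W) t).flip v) x +
            ExteriorAlgebra.ι ℂ v * contractTensor t x := by
    intro t
    induction t using TensorProduct.induction_on with
    | zero =>
      have h : (LinearMap.flip (0 : W →ₗ[ℂ] Module.Dual ℂ W)) v =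
          (0 : ℂ) • (0 : Module.Dual ℂ W) := by
        ext; simp
      have h' : (0 : W →ₗ[ℂ] Module.Dual ℂ W) v = (0 : ℂ) • (0 : Module.Dual ℂ W) := by simp
      rw [map_zero, map_zero, h, h', interior_smul]
      simp
    | add s t hs ht =>
      have h : (dualTensorHom ℂ W (Module.Dual ℂ W) s +
          dualTensorHom ℂ W (Module.Dual ℂ W) t).flip v =
          (dualTensorHom ℂ W (Module.Dual ℂ W) s).flip v +
          (dualTensorHom ℂ W (Module.Dual ℂ W) t).flip v := by ext; rfl
      simp only [map_add, LinearMap.add_apply, hs, ht, h, mul_add]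
      abel
    | tmul a b =>
      have h1 : dualTensorHom ℂ W (Module.Dual ℂ W) (TensorProduct.tmul ℂ a b) v = a v • b := by
        simp
      have h2 : (dualTensorHom ℂ W (Module.Dual ℂ W) (TensorProduct.tmul ℂ a b)).flip v
          = b v • a := by
        ext w; simp [mul_comm]
      rw [contractTensor_tmul, contractTensor_tmul, h1, h2]
      change interior b (interior a _) = _
      rw [interior_ι_mul, map_sub, map_smul, interior_ι_mul, interior_smul, interior_smul]
      abel
  have h := key ((dualTensorHomEquiv ℂ W (Module.Dual ℂ W)).symm B)
  have h3 : dualTensorHom ℂ W (Module.Dual ℂ W)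
      ((dualTensorHomEquiv ℂ W (Module.Dual ℂ W)).symm B) = B :=
    (dualTensorHomEquiv ℂ W (Module.Dual ℂ W)).apply_symm_apply B
  rw [h3] at h
  exact h

theorem contract_one (B : W →ₗ[ℂ] W →ₗ[ℂ] ℂ) : contract B (1 : ExteriorAlgebra ℂ W) = 0 := by
  have key : ∀ t : TensorProduct ℂ (Module.Dual ℂ W) (Module.Dual ℂ W),
      contractTensor t (1 : ExteriorAlgebra ℂ W) = 0 := by
    intro t
    induction t using TensorProduct.induction_on with
    | zero => simp
    | add s t hs ht => rw [map_add, LinearMap.add_apply, hs, ht, add_zero]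
    | tmul a b =>
      rw [contractTensor_tmul]
      change interior b (interior a _) = _
      rw [interior_one, map_zero]
  exact key _

theorem contract_smul (c : ℂ) (B : W →ₗ[ℂ] W →ₗ[ℂ] ℂ) (x : ExteriorAlgebra ℂ W) :
    contract (c • B) x = c • contract B x := by
  unfold contract
  rw [map_smul, map_smul, LinearMap.smul_apply]

theorem contract_list_prod_eq_zero (B : W →ₗ[ℂ] W →ₗ[ℂ] ℂ) (l : List W)
    (h : ∀ v ∈ l, ∀ w ∈ l, B v w = 0) :
    contract B (l.map (ExteriorAlgebra.ι ℂ)).prod = 0 := by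
  induction l with
  | nil => exact contract_one B
  | cons v l ih =>
    rw [List.map_cons, List.prod_cons, contract_ι_mul,
      interior_list_prod_eq_zero _ _ fun w hw => h v (by simp) w (by simp [hw]),
      interior_list_prod_eq_zero _ _ fun w hw => h w (by simp [hw]) v (by simp),
      ih fun w hw u hu => h w (by simp [hw]) u (by simp [hu])]
    simp

end Interior

/-! ### Darboux frames -/

section Frame

variable {n : ℕ} {W : Type*} [AddCommGroup W] [Module ℂ W]
  (e : (Fin 2 → Fin n → ℂ) ≃ₗ[ℂ] W)

/-- The vector `f_c ⊗ a` of a space identified with `ℂ² ⊗ ℂⁿ`. -/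
def tens (c : Fin 2) : (Fin n → ℂ) →ₗ[ℂ] W :=
  e.toLinearMap ∘ₗ LinearMap.single ℂ (fun _ : Fin 2 => Fin n → ℂ) c

/-- The tensor product of the standard symplectic form on `ℂ²` and the standard symmetric form
on `ℂⁿ`. -/
def sform : W →ₗ[ℂ] W →ₗ[ℂ] ℂ :=
  LinearMap.mk₂ ℂ (fun x y => e.symm x 0 ⬝ᵥ e.symm y 1 - e.symm x 1 ⬝ᵥ e.symm y 0)
    (fun x y z => by simp [add_dotProduct]; ring)
    (fun c x y => by simp [smul_dotProduct]; ring)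
    (fun x y z => by simp [dotProduct_add]; ring)
    (fun c x y => by simp [dotProduct_smul]; ring)

theorem sform_apply (x y : W) :
    sform e x y = e.symm x 0 ⬝ᵥ e.symm y 1 - e.symm x 1 ⬝ᵥ e.symm y 0 := rfl

theorem sform_swap (x y : W) : sform e x y = -sform e y x := by
  rw [sform_apply, sform_apply, dotProduct_comm, dotProduct_comm (e.symm x 1)]
  ring

theorem sform_tens_zero_one (a b : Fin n → ℂ) : sform e (tens e 0 a) (tens e 1 b) = a ⬝ᵥ b := by
  simp [sform_apply, tens]

theorem sform_tens_one_zero (a b : Fin n → ℂ) :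
    sform e (tens e 1 a) (tens e 0 b) = -(a ⬝ᵥ b) := by
  simp [sform_apply, tens]

theorem sform_tens_self (c : Fin 2) (a b : Fin n → ℂ) :
    sform e (tens e c a) (tens e c b) = 0 := by
  fin_cases c <;> simp [sform_apply, tens]

theorem eq_tens_add_tens (v : W) : v = tens e 0 (e.symm v 0) + tens e 1 (e.symm v 1) := by
  apply e.symm.injective
  ext c i
  fin_cases c <;> simp [tens]

variable [FiniteDimensional ℂ W]

/-- Contraction with the symplectic form `sform`. -/
abbrev lower : ExteriorAlgebra ℂ W →ₗ[ℂ] ExteriorAlgebra ℂ W := contract (sform e)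

theorem lower_ι_mul (v : W) (x : ExteriorAlgebra ℂ W) :
    lower e (ExteriorAlgebra.ι ℂ v * x) =
      (2 : ℂ) • interior (sform e v) x + ExteriorAlgebra.ι ℂ v * lower e x := by
  have h : (sform e).flip v = -sform e v := by
    ext w; exact sform_swap e w v
  rw [lower, contract_ι_mul, h, interior_neg, two_smul, sub_neg_eq_add]

end Frame

/-! ### Lefschetz property and generators of the primitive subspace -/

section Lefschetz

open ExteriorAlgebra (ι)

variable {n : ℕ} {W : Type*} [AddCommGroup W] [Module ℂ W]
  (e : (Fin 2 → Fin n → ℂ) ≃ₗ[ℂ] W)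

/-- The `k`-th coordinate vector (zero if `k ≥ n`). -/
def coordVec (n k : ℕ) : Fin n → ℂ := fun i => if i.val = k then 1 else 0

theorem coordVec_dotProduct_self {k : ℕ} (hk : k < n) : coordVec n k ⬝ᵥ coordVec n k = 1 := by
  simp only [dotProduct, coordVec]
  rw [Finset.sum_eq_single ⟨k, hk⟩] <;> simp +contextual [Fin.ext_iff]

/-- The element `f_c ⊗ e_k` of the exterior algebra. -/
abbrev gen (c : Fin 2) (k : ℕ) : ExteriorAlgebra ℂ W := ι ℂ (tens e c (coordVec n k))

/-- The elements of degree `d` of the exterior algebra involving only the first `k` pairs of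
coordinates. -/
def poly : ℕ → ℤ → Submodule ℂ (ExteriorAlgebra ℂ W)
  | 0, d => if d = 0 then Submodule.span ℂ {1} else ⊥
  | k + 1, d => poly k d ⊔ (poly k (d - 1)).map (LinearMap.mulLeft ℂ (gen e 0 k)) ⊔
      (poly k (d - 1)).map (LinearMap.mulLeft ℂ (gen e 1 k)) ⊔
      (poly k (d - 2)).map (LinearMap.mulLeft ℂ (gen e 0 k) ∘ₗ LinearMap.mulLeft ℂ (gen e 1 k))

theorem mem_poly_succ {k : ℕ} {d : ℤ} {x : ExteriorAlgebra ℂ W} :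
    x ∈ poly e (k + 1) d ↔ ∃ x0 ∈ poly e k d, ∃ x1 ∈ poly e k (d - 1), ∃ x2 ∈ poly e k (d - 1),
      ∃ x3 ∈ poly e k (d - 2),
        x = x0 + gen e 0 k * x1 + gen e 1 k * x2 + gen e 0 k * (gen e 1 k * x3) := by
  rw [poly]
  simp only [Submodule.mem_sup, Submodule.mem_map]
  constructor
  · rintro ⟨_, ⟨_, ⟨x0, h0, _, ⟨x1, h1, rfl⟩, rfl⟩, _, ⟨x2, h2, rfl⟩, rfl⟩, _, ⟨x3, h3, rfl⟩, rfl⟩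
    exact ⟨x0, h0, x1, h1, x2, h2, x3, h3, rfl⟩
  · rintro ⟨x0, h0, x1, h1, x2, h2, x3, h3, rfl⟩
    exact ⟨_, ⟨_, ⟨x0, h0, _, ⟨x1, h1, rfl⟩, rfl⟩, _, ⟨x2, h2, rfl⟩, rfl⟩, _, ⟨x3, h3, rfl⟩, rfl⟩

theorem poly_zero_of_ne {d : ℤ} (hd : d ≠ 0) {x : ExteriorAlgebra ℂ W} (hx : x ∈ poly e 0 d) :
    x = 0 := by
  rw [poly, if_neg hd] at hx
  simpa using hx

theorem one_mem_poly (k : ℕ) : (1 : ExteriorAlgebra ℂ W) ∈ poly e k 0 := by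
  induction k with
  | zero => rw [poly, if_pos rfl]; exact Submodule.mem_span_singleton_self 1
  | succ k ih =>
    rw [mem_poly_succ]
    exact ⟨1, ih, 0, zero_mem _, 0, zero_mem _, 0, zero_mem _, by simp⟩

/-- Split `v` into a part on the first `k` pairs of coordinates and multiples of the two new
generators, then reorder using anticommutation. Consequently `poly e n d` contains the whole
exterior power. -/
theorem ι_mul_mem_poly (k : ℕ) : ∀ (d : ℤ) (v : W) (x : ExteriorAlgebra ℂ W),
    (∀ c (i : Fin n), k ≤ i.val → e.symm v c i = 0) → x ∈ poly e k d →
    ι ℂ v * x ∈ poly e k (d + 1) := by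
  induction k with
  | zero =>
    intro d v x hv hx
    have : v = 0 := by
      apply e.symm.injective
      ext c i
      simpa using hv c i (Nat.zero_le _)
    rw [this, map_zero, zero_mul]
    exact zero_mem _
  | succ k ih =>
    intro d v x hv hx
    obtain ⟨x0, h0, x1, h1, x2, h2, x3, h3, rfl⟩ := (mem_poly_succ e).1 hx
    obtain ⟨v', a, b, hv', rfl⟩ : ∃ (v' : W) (a b : ℂ),
        (∀ c (i : Fin n), k ≤ i.val → e.symm v' c i = 0) ∧
        v = v' + a • tens e 0 (coordVec n k) + b • tens e 1 (coordVec n k) := by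
      by_cases hk : k < n
      · refine ⟨v - (e.symm v 0 ⟨k, hk⟩ • tens e 0 (coordVec n k) +
          e.symm v 1 ⟨k, hk⟩ • tens e 1 (coordVec n k)), e.symm v 0 ⟨k, hk⟩, e.symm v 1 ⟨k, hk⟩,
          ?_, by abel⟩
        intro c i hi
        rcases hi.eq_or_lt with hi | hi
        · subst hi
          fin_cases c <;> simp [tens, coordVec]
        · have := hv c i hi
          fin_cases c <;> simp_all [tens, coordVec, hi.ne']
      · exact ⟨v, 0, 0, fun c i hi => absurd (hi.trans_lt i.2) hk, by simp⟩
    have hd : d + 1 - 1 = d := by ring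
    have hd' : d + 1 - 2 = d - 1 := by ring
    rw [mem_poly_succ, hd, hd']
    have k1 := ih _ v' x1 hv' h1
    have k2 := ih _ v' x2 hv' h2
    have k3 := ih _ v' x3 hv' h3
    rw [sub_add_cancel] at k1 k2
    rw [show d - 2 + 1 = d - 1 by ring] at k3
    refine ⟨ι ℂ v' * x0, ih _ v' x0 hv' h0, a • x0 - ι ℂ v' * x1,
      sub_mem (Submodule.smul_mem _ _ h0) k1, b • x0 - ι ℂ v' * x2,
      sub_mem (Submodule.smul_mem _ _ h0) k2, a • x2 - b • x1 + ι ℂ v' * x3,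
      add_mem (sub_mem (Submodule.smul_mem _ _ h2) (Submodule.smul_mem _ _ h1)) k3, ?_⟩
    have s0 : ι ℂ v' * gen e 0 k = -(gen e 0 k * ι ℂ v') := ι_mul_ι_swap _ _
    have s1 : ι ℂ v' * gen e 1 k = -(gen e 1 k * ι ℂ v') := ι_mul_ι_swap _ _
    have s2 : gen e 1 k * gen e 0 k = -(gen e 0 k * gen e 1 k) := ι_mul_ι_swap _ _
    have q0 : gen e 0 k * gen e 0 k = 0 := ExteriorAlgebra.ι_sq_zero _
    have q1 : gen e 1 k * gen e 1 k = 0 := ExteriorAlgebra.ι_sq_zero _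
    rw [map_add, map_add, map_smul, map_smul]
    change (ι ℂ v' + a • gen e 0 k + b • gen e 1 k) * _ = _
    simp only [add_mul, mul_add, mul_sub, smul_mul_assoc, mul_smul_comm]
    simp only [← mul_assoc, s0, s1, q0, q1, s2, neg_mul, zero_mul, smul_zero]
    simp only [mul_assoc, s1, neg_mul, mul_neg, neg_neg, smul_neg, q1, zero_mul, mul_zero, neg_zero,
      smul_zero]
    abel

theorem ιMulti_mem_poly (d : ℕ) (w : Fin d → W) :
    ExteriorAlgebra.ιMulti ℂ d w ∈ poly e n d := by
  induction d with
  | zero => rw [ExteriorAlgebra.ιMulti_zero_apply]; exact one_mem_poly e n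
  | succ d ih =>
    rw [ExteriorAlgebra.ιMulti_succ_apply]
    push_cast
    exact ι_mul_mem_poly e n _ _ _ (fun c i hi => absurd i.2 (not_lt.2 hi)) (ih _)

theorem exteriorPower_le_poly (d : ℕ) : ⋀[ℂ]^d W ≤ poly e n d := by
  rw [← ExteriorAlgebra.ιMulti_span_fixedDegree, Submodule.span_le]
  rintro _ ⟨w, rfl⟩
  exact ιMulti_mem_poly e d w

theorem interior_poly (k : ℕ) : ∀ (d : ℤ) (v : W) (x : ExteriorAlgebra ℂ W),
    (∀ c (i : Fin n), i.val < k → e.symm v c i = 0) → x ∈ poly e k d →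
    interior (sform e v) x = 0 := by
  induction k with
  | zero =>
    intro d v x _ hx
    rw [poly] at hx
    split_ifs at hx
    · obtain ⟨c, rfl⟩ := Submodule.mem_span_singleton.1 hx
      rw [map_smul, interior_one, smul_zero]
    · rw [Submodule.mem_bot] at hx
      rw [hx, map_zero]
  | succ k ih =>
    intro d v x hv hx
    obtain ⟨x0, h0, x1, h1, x2, h2, x3, h3, rfl⟩ := (mem_poly_succ e).1 hx
    have hv' : ∀ c (i : Fin n), i.val < k → e.symm v c i = 0 := fun c i hi => hv c i (by omega)
    have hs : ∀ c, sform e v (tens e c (coordVec n k)) = 0 := by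
      intro c
      rw [sform_apply]
      have hz' : ∀ c₁ c₂, e.symm v c₁ ⬝ᵥ e.symm (tens e c (coordVec n k)) c₂ = 0 := by
        intro c₁ c₂
        refine Finset.sum_eq_zero fun i _ => ?_
        rcases eq_or_ne i.val k with h | h
        · rw [hv c₁ i (by omega), zero_mul]
        · fin_cases c <;> fin_cases c₂ <;> simp [tens, coordVec, h]
      rw [hz', hz', sub_zero]
    rw [map_add, map_add, map_add, interior_ι_mul, interior_ι_mul, interior_ι_mul, interior_ι_mul,
      hs, hs, ih _ v _ hv' h0, ih _ v _ hv' h1, ih _ v _ hv' h2, ih _ v _ hv' h3]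
    simp

theorem interior_gen_poly {k : ℕ} (c : Fin 2) {d : ℤ} {x : ExteriorAlgebra ℂ W}
    (hx : x ∈ poly e k d) : interior (sform e (tens e c (coordVec n k))) x = 0 := by
  refine interior_poly e k d _ x (fun c' i hi => ?_) hx
  fin_cases c <;> fin_cases c' <;> simp [tens, coordVec, hi.ne]

/-- The sum defining `poly e (k + 1)` is direct. Contractions with the two new generators annihilate
everything built from the first `k` pairs, so they strip the generators off: both together isolate
`x3`, and then each one isolates `x2` or `x1`. -/
theorem poly_components_eq_zero {k : ℕ} (hk : k < n) {d0 d1 d2 d3 : ℤ}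
    {x0 x1 x2 x3 : ExteriorAlgebra ℂ W}
    (h0 : x0 ∈ poly e k d0) (h1 : x1 ∈ poly e k d1) (h2 : x2 ∈ poly e k d2)
    (h3 : x3 ∈ poly e k d3)
    (h : x0 + gen e 0 k * x1 + gen e 1 k * x2 + gen e 0 k * (gen e 1 k * x3) = 0) :
    x0 = 0 ∧ x1 = 0 ∧ x2 = 0 ∧ x3 = 0 := by
  have e01 : sform e (tens e 0 (coordVec n k)) (tens e 1 (coordVec n k)) = 1 := by
    rw [sform_tens_zero_one, coordVec_dotProduct_self hk]
  have e10 : sform e (tens e 1 (coordVec n k)) (tens e 0 (coordVec n k)) = -1 := by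
    rw [sform_tens_one_zero, coordVec_dotProduct_self hk]
  have hP := congrArg (interior (sform e (tens e 0 (coordVec n k)))) h
  have hQ := congrArg (interior (sform e (tens e 1 (coordVec n k)))) h
  simp only [map_add, map_zero, interior_ι_mul, e01, e10, sform_tens_self, interior_gen_poly e _ h0,
    interior_gen_poly e _ h1, interior_gen_poly e _ h2, interior_gen_poly e _ h3, mul_zero,
    zero_smul, sub_zero, zero_add, one_smul, zero_sub, neg_smul, add_zero] at hP hQ
  have hR := congrArg (interior (sform e (tens e 1 (coordVec n k)))) hP
  simp only [map_add, map_neg, map_zero, interior_ι_mul, e10, interior_gen_poly e _ h2,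
    interior_gen_poly e _ h3, mul_zero, sub_zero, neg_smul, one_smul, neg_neg, zero_add] at hR
  subst hR
  simp only [mul_zero, neg_zero, add_zero] at hP hQ h
  rw [neg_eq_zero] at hQ
  subst hP hQ
  simpa using h

variable [FiniteDimensional ℂ W]

/-- The new generators pair only with each other, so the sole cross term is the one turning `gen e 0
k * (gen e 1 k * x3)` into `2 • x3`. -/
theorem lower_decomp {k : ℕ} (hk : k < n) {d1 d2 d3 : ℤ}
    {x0 x1 x2 x3 : ExteriorAlgebra ℂ W}
    (h1 : x1 ∈ poly e k d1) (h2 : x2 ∈ poly e k d2) (h3 : x3 ∈ poly e k d3) :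
    lower e (x0 + gen e 0 k * x1 + gen e 1 k * x2 + gen e 0 k * (gen e 1 k * x3)) =
      (lower e x0 + (2 : ℂ) • x3) + gen e 0 k * lower e x1 + gen e 1 k * lower e x2 +
        gen e 0 k * (gen e 1 k * lower e x3) := by
  have e01 : sform e (tens e 0 (coordVec n k)) (tens e 1 (coordVec n k)) = 1 := by
    rw [sform_tens_zero_one, coordVec_dotProduct_self hk]
  simp only [map_add, lower_ι_mul, interior_ι_mul, e01, interior_gen_poly e _ h1,
    interior_gen_poly e _ h2, interior_gen_poly e _ h3, one_smul, mul_zero, sub_zero, smul_zero,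
    zero_add]
  abel

theorem lower_mem_poly (k : ℕ) (hk : k ≤ n) : ∀ (d : ℤ) (x : ExteriorAlgebra ℂ W),
    x ∈ poly e k d → lower e x ∈ poly e k (d - 2) := by
  induction k with
  | zero =>
    intro d x hx
    rw [poly] at hx
    split_ifs at hx
    · obtain ⟨c, rfl⟩ := Submodule.mem_span_singleton.1 hx
      rw [map_smul, lower, contract_one, smul_zero]
      exact zero_mem _
    · rw [Submodule.mem_bot] at hx
      rw [hx, map_zero]
      exact zero_mem _
  | succ k ih =>
    intro d x hx
    obtain ⟨x0, h0, x1, h1, x2, h2, x3, h3, rfl⟩ := (mem_poly_succ e).1 hx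
    rw [lower_decomp e hk h1 h2 h3, mem_poly_succ]
    have ih := ih (by omega)
    refine ⟨_, add_mem (ih _ _ h0) (Submodule.smul_mem _ _ h3), _, ?_, _, ?_, _, ih _ _ h3, rfl⟩
    · have := ih _ _ h1
      rwa [sub_right_comm] at this
    · have := ih _ _ h2
      rwa [sub_right_comm] at this

theorem lower_iterate_mem_poly {k : ℕ} (hk : k ≤ n) (j : ℕ) {d : ℤ} {x : ExteriorAlgebra ℂ W}
    (hx : x ∈ poly e k d) : ((lower e) ^ j) x ∈ poly e k (d - 2 * j) := by
  induction j with
  | zero => simpa using hx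
  | succ j ih =>
    rw [pow_succ', Module.End.mul_apply]
    have := lower_mem_poly e k hk _ _ ih
    rwa [show d - 2 * ((j + 1 : ℕ) : ℤ) = d - 2 * j - 2 by push_cast; ring]

theorem lower_iterate_decomp {k : ℕ} (hk : k < n) (j : ℕ) {d1 d2 d3 : ℤ}
    {x0 x1 x2 x3 : ExteriorAlgebra ℂ W}
    (h1 : x1 ∈ poly e k d1) (h2 : x2 ∈ poly e k d2) (h3 : x3 ∈ poly e k d3) :
    ((lower e) ^ (j + 1)) (x0 + gen e 0 k * x1 + gen e 1 k * x2 + gen e 0 k * (gen e 1 k * x3)) =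
      (((lower e) ^ (j + 1)) x0 + (2 * (j + 1) : ℂ) • ((lower e) ^ j) x3) +
        gen e 0 k * ((lower e) ^ (j + 1)) x1 + gen e 1 k * ((lower e) ^ (j + 1)) x2 +
        gen e 0 k * (gen e 1 k * ((lower e) ^ (j + 1)) x3) := by
  induction j with
  | zero => simpa using lower_decomp e hk h1 h2 h3
  | succ j ih =>
    rw [pow_succ', Module.End.mul_apply, ih]
    rw [lower_decomp e hk (lower_iterate_mem_poly e hk.le (j + 1) h1)
      (lower_iterate_mem_poly e hk.le (j + 1) h2)
      (lower_iterate_mem_poly e hk.le (j + 1) h3)]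
    have hp : ∀ x, lower e (((lower e) ^ (j + 1)) x) = ((lower e) * (lower e) ^ (j + 1)) x :=
      fun x => rfl
    have hq : ∀ x, lower e (((lower e) ^ j) x) = ((lower e) ^ (j + 1)) x := fun x => by
      rw [pow_succ', Module.End.mul_apply]
    simp only [map_add, map_smul, hp, hq]
    congr 3
    rw [add_assoc, ← add_smul]
    push_cast
    congr 2
    ring

/-- Lefschetz injectivity above the middle degree `k` of the exterior algebra on `2k` generators.
Only `j = 1` is used later, but the induction on `k` raises the exponent, so `j` stays general. -/
theorem lower_iterate_injective (k : ℕ) (hk : k ≤ n) : ∀ (j : ℕ) (d : ℤ) (x : ExteriorAlgebra ℂ W),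
    x ∈ poly e k d → (k + j : ℤ) ≤ d → ((lower e) ^ j) x = 0 → x = 0 := by
  induction k with
  | zero =>
    intro j d x hx hd h
    rcases j with _ | j
    · simpa using h
    · exact poly_zero_of_ne e (by push_cast at hd; omega) hx
  | succ k ih =>
    intro j d x hx hd h
    rcases j with _ | j
    · simpa using h
    have ih := ih (by omega)
    obtain ⟨x0, h0, x1, h1, x2, h2, x3, h3, rfl⟩ := (mem_poly_succ e).1 hx
    rw [lower_iterate_decomp e hk j h1 h2 h3] at h
    have h0' := lower_iterate_mem_poly e (by omega : k ≤ n) (j + 1) h0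
    have h3' := lower_iterate_mem_poly e (by omega : k ≤ n) j h3
    rw [show d - 2 - 2 * (j : ℤ) = d - 2 * ((j + 1 : ℕ) : ℤ) by push_cast; ring] at h3'
    obtain ⟨z0, z1, z2, z3⟩ := poly_components_eq_zero e hk
      (add_mem h0' (Submodule.smul_mem _ _ h3'))
      (lower_iterate_mem_poly e (by omega : k ≤ n) (j + 1) h1)
      (lower_iterate_mem_poly e (by omega : k ≤ n) (j + 1) h2)
      (lower_iterate_mem_poly e (by omega : k ≤ n) (j + 1) h3) h
    push_cast at hd
    have y1 := ih _ _ _ h1 (by push_cast; omega) z1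
    have y2 := ih _ _ _ h2 (by push_cast; omega) z2
    -- One further application of `lower` kills the `x3` term in `z0`. The degree of `x0` is still
    -- `d` while `k` has dropped by one, which leaves room for the exponent `j + 2`.
    have y0 : x0 = 0 := by
      refine ih (j + 1 + 1) _ _ h0 (by push_cast; omega) ?_
      have := congrArg (lower e) z0
      rw [map_add, map_smul, map_zero] at this
      change ((lower e) * (lower e) ^ (j + 1)) x0 + _ • ((lower e) * (lower e) ^ j) x3 = 0 at this
      rw [← pow_succ', ← pow_succ', z3, smul_zero, add_zero] at this
      exact this
    have y3 : x3 = 0 := by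
      refine ih j _ _ h3 (by omega) ?_
      rw [y0, map_zero, zero_add, smul_eq_zero] at z0
      refine z0.resolve_left ?_
      norm_cast
    simp [y0, y1, y2, y3]

end Lefschetz

/-! ### Real orthonormal generators -/

section Orthonormal

open ExteriorAlgebra (ι)

/-- The complexification of a real vector. -/
def cx {n : ℕ} (u : EuclideanSpace ℝ (Fin n)) : Fin n → ℂ := fun i => (u i : ℂ)

theorem cx_add {n : ℕ} (u v : EuclideanSpace ℝ (Fin n)) : cx (u + v) = cx u + cx v := by
  ext i; simp [cx]

theorem cx_smul {n : ℕ} (c : ℝ) (u : EuclideanSpace ℝ (Fin n)) : cx (c • u) = (c : ℂ) • cx u := by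
  ext i; simp [cx]

theorem cx_dotProduct {n : ℕ} (u v : EuclideanSpace ℝ (Fin n)) :
    cx u ⬝ᵥ cx v = ((inner ℝ u v : ℝ) : ℂ) := by
  simp [cx, dotProduct, PiLp.inner_apply, mul_comm]

theorem cx_single {n k : ℕ} (hk : k < n) :
    cx (EuclideanSpace.single (⟨k, hk⟩ : Fin n) (1 : ℝ)) = coordVec n k := by
  ext i
  by_cases h : (i : ℕ) = k <;> simp [cx, coordVec, Fin.ext_iff, h]

/-- A list of pairs of an index and a vector such that the vectors are orthonormal and vanish
outside of the first `k` coordinates. -/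
structure IsOrthoList {n : ℕ} (k : ℕ) (l : List (Fin 2 × EuclideanSpace ℝ (Fin n))) : Prop where
  unit : ∀ a ∈ l, inner ℝ a.2 a.2 = (1 : ℝ)
  supp : ∀ a ∈ l, ∀ i : Fin n, k ≤ i.val → a.2 i = 0
  orth : l.Pairwise fun a b => inner ℝ a.2 b.2 = (0 : ℝ)

theorem IsOrthoList.cons {n k : ℕ} {l : List (Fin 2 × EuclideanSpace ℝ (Fin n))}
    (hl : IsOrthoList k l) (c : Fin 2) {u : EuclideanSpace ℝ (Fin n)} (hu : inner ℝ u u = (1 : ℝ))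
    (hs : ∀ i : Fin n, k ≤ i.val → u i = 0) (ho : ∀ a ∈ l, inner ℝ u a.2 = (0 : ℝ)) :
    IsOrthoList k ((c, u) :: l) where
  unit := List.forall_mem_cons.2 ⟨hu, hl.unit⟩
  supp := List.forall_mem_cons.2 ⟨hs, hl.supp⟩
  orth := List.pairwise_cons.2 ⟨ho, hl.orth⟩

theorem IsOrthoList.mono {n k : ℕ} {l : List (Fin 2 × EuclideanSpace ℝ (Fin n))}
    (hl : IsOrthoList k l) : IsOrthoList (k + 1) l where
  unit := hl.unit
  supp := fun a ha i hi => hl.supp a ha i (by omega)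
  orth := hl.orth

theorem inner_single_eq_zero {n k : ℕ} (hk : k < n) {u : EuclideanSpace ℝ (Fin n)}
    (hu : ∀ i : Fin n, k ≤ i.val → u i = 0) :
    inner ℝ (EuclideanSpace.single (⟨k, hk⟩ : Fin n) (1 : ℝ)) u = (0 : ℝ) := by
  simp [EuclideanSpace.inner_single_left, hu ⟨k, hk⟩ le_rfl]

/-- Fewer than `k` linear conditions on `ℝᵏ` have a nonzero common solution, which is then
normalised. -/
theorem IsOrthoList.exists_orthogonal {n k : ℕ} (hk : k < n)
    {l : List (Fin 2 × EuclideanSpace ℝ (Fin n))} (hlen : l.length < k) :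
    ∃ f : EuclideanSpace ℝ (Fin n), inner ℝ f f = (1 : ℝ) ∧ (∀ i : Fin n, k ≤ i.val → f i = 0) ∧
      ∀ a ∈ l, inner ℝ f a.2 = (0 : ℝ) := by
  let ext : (Fin k → ℝ) →ₗ[ℝ] EuclideanSpace ℝ (Fin n) :=
    { toFun := fun x => WithLp.toLp 2 fun i => if h : i.val < k then x ⟨i.val, h⟩ else 0
      map_add' := fun x y => by ext i; by_cases h : i.val < k <;> simp [h]
      map_smul' := fun c x => by ext i; by_cases h : i.val < k <;> simp [h] }
  let T : (Fin k → ℝ) →ₗ[ℝ] (Fin l.length → ℝ) :=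
    LinearMap.pi fun j => (innerₗ (EuclideanSpace ℝ (Fin n)) (l.get j).2) ∘ₗ ext
  obtain ⟨x, hx, hx0⟩ : ∃ x ∈ LinearMap.ker T, x ≠ 0 := by
    apply (Submodule.ne_bot_iff _).1
    exact LinearMap.ker_ne_bot_of_finrank_lt (by simpa using hlen)
  have hf0 : ext x ≠ 0 := by
    intro h
    apply hx0
    ext i
    have := congrArg (fun y => y.ofLp ⟨i.val, i.2.trans hk⟩) h
    simpa [ext] using this
  have horth : ∀ a ∈ l, inner ℝ (ext x) a.2 = (0 : ℝ) := by
    intro a ha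
    obtain ⟨j, rfl⟩ := List.get_of_mem ha
    rw [real_inner_comm]
    exact congrFun (LinearMap.mem_ker.1 hx) j
  refine ⟨(‖ext x‖)⁻¹ • ext x, ?_, ?_, ?_⟩
  · rw [real_inner_smul_left, real_inner_smul_right, real_inner_self_eq_norm_sq]
    have : ‖ext x‖ ≠ 0 := norm_ne_zero_iff.2 hf0
    field_simp
  · intro i hi
    simp [ext, not_lt.2 hi]
  · intro a ha
    rw [real_inner_smul_left, horth a ha, mul_zero]

variable {n : ℕ} {W : Type*} [AddCommGroup W] [Module ℂ W]
  (e : (Fin 2 → Fin n → ℂ) ≃ₗ[ℂ] W)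

/-- The product of the vectors `f_c ⊗ u` where `(c, u)` runs through a list. -/
def listProd (l : List (Fin 2 × EuclideanSpace ℝ (Fin n))) : ExteriorAlgebra ℂ W :=
  (l.map fun a => ι ℂ (tens e a.1 (cx a.2))).prod

theorem listProd_cons (c : Fin 2) (u : EuclideanSpace ℝ (Fin n))
    (l : List (Fin 2 × EuclideanSpace ℝ (Fin n))) :
    listProd e ((c, u) :: l) = ι ℂ (tens e c (cx u)) * listProd e l := by
  simp [listProd]

/-- The products of `d` vectors `f_c ⊗ u` with orthonormal real `u` in the span of the first `k`
coordinate vectors. -/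
def orthoProds (k : ℕ) (d : ℤ) : Set (ExteriorAlgebra ℂ W) :=
  {x | ∃ l, IsOrthoList k l ∧ (l.length : ℤ) = d ∧ listProd e l = x}

theorem listProd_mem_poly (k : ℕ) (l : List (Fin 2 × EuclideanSpace ℝ (Fin n)))
    (hl : ∀ a ∈ l, ∀ i : Fin n, k ≤ i.val → a.2 i = 0) : listProd e l ∈ poly e k l.length := by
  induction l with
  | nil => exact one_mem_poly e k
  | cons a l ih =>
    rw [listProd_cons, List.length_cons]
    push_cast
    refine ι_mul_mem_poly e k _ _ _ (fun c i hi => ?_) (ih fun b hb => hl b (by simp [hb]))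
    have := hl a (by simp) i hi
    rcases a with ⟨c', u⟩
    fin_cases c <;> fin_cases c' <;> simp_all [tens, cx]

theorem orthoProds_mono (k : ℕ) (d : ℤ) :
    (orthoProds e k d : Set (ExteriorAlgebra ℂ W)) ⊆ orthoProds e (k + 1) d := by
  rintro _ ⟨l, hl, hd, rfl⟩
  exact ⟨l, hl.mono, hd, rfl⟩

theorem gen_mul_mem_orthoProds {k : ℕ} (hk : k < n) {d : ℤ} (c : Fin 2) {x : ExteriorAlgebra ℂ W}
    (hx : x ∈ orthoProds e k (d - 1)) : gen e c k * x ∈ orthoProds e (k + 1) d := by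
  obtain ⟨l, hl, hd, rfl⟩ := hx
  refine ⟨(c, EuclideanSpace.single ⟨k, hk⟩ 1) :: l, hl.mono.cons c (by simp) ?_ ?_, ?_, ?_⟩
  · intro i hi
    have : i ≠ ⟨k, hk⟩ := by rintro rfl; simp at hi
    simp [this]
  · exact fun a ha => inner_single_eq_zero hk (hl.supp a ha)
  · simp [hd]
  · rw [listProd_cons, cx_single]

theorem gen_mul_mem_span {k : ℕ} (hk : k < n) {d : ℤ} (c : Fin 2) {x : ExteriorAlgebra ℂ W}
    (hx : x ∈ Submodule.span ℂ (orthoProds e k (d - 1))) :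
    gen e c k * x ∈ Submodule.span ℂ (orthoProds e (k + 1) d) := by
  induction hx using Submodule.span_induction with
  | mem x hx => exact Submodule.subset_span (gen_mul_mem_orthoProds e hk c hx)
  | zero => rw [mul_zero]; exact zero_mem _
  | add x y _ _ hx hy => rw [mul_add]; exact add_mem hx hy
  | smul a x _ hx => rw [mul_smul_comm]; exact Submodule.smul_mem _ _ hx

/-- The product `gen e 0 k * gen e 1 k` repeats the vector `e_k`, so it is not of the orthonormal
kind. The bound on `d` leaves room for a unit vector `f` in the first `k` coordinates orthogonal to
all factors of `x`. Replacing `e_k` by `f` in both places changes the product by a combination of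
products over orthonormal pairs in the plane of `e_k` and `f`. -/
theorem exists_sub_mem_span {k : ℕ} (hk : k < n) {d : ℤ} (hd : d ≤ k + 1)
    {x : ExteriorAlgebra ℂ W} (hx : x ∈ Submodule.span ℂ (orthoProds e k (d - 2))) :
    ∃ y ∈ poly e k d, gen e 0 k * (gen e 1 k * x) - y ∈
      Submodule.span ℂ (orthoProds e (k + 1) d) := by
  induction hx using Submodule.span_induction with
  | zero => exact ⟨0, zero_mem _, by simp⟩
  | add x y _ _ hx hy =>
    obtain ⟨a, ha, ha'⟩ := hx
    obtain ⟨b, hb, hb'⟩ := hy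
    refine ⟨a + b, add_mem ha hb, ?_⟩
    rw [mul_add, mul_add, add_sub_add_comm]
    exact add_mem ha' hb'
  | smul c x _ hx =>
    obtain ⟨a, ha, ha'⟩ := hx
    refine ⟨c • a, Submodule.smul_mem _ _ ha, ?_⟩
    rw [mul_smul_comm, mul_smul_comm, ← smul_sub]
    exact Submodule.smul_mem _ _ ha'
  | mem x hx =>
    obtain ⟨l, hl, hlen, rfl⟩ := hx
    obtain ⟨f, hf, hfs, hfo⟩ := IsOrthoList.exists_orthogonal hk (l := l) (by omega)
    set g := EuclideanSpace.single (⟨k, hk⟩ : Fin n) (1 : ℝ) with hg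
    have hgg : inner ℝ g g = (1 : ℝ) := by simp [hg]
    have hgf : inner ℝ g f = (0 : ℝ) := inner_single_eq_zero hk hfs
    have hfg : inner ℝ f g = (0 : ℝ) := by rw [real_inner_comm, hgf]
    have hgo : ∀ a ∈ l, inner ℝ g a.2 = (0 : ℝ) :=
      fun a ha => inner_single_eq_zero hk (hl.supp a ha)
    have hgs : ∀ i : Fin n, k + 1 ≤ i.val → g i = 0 := by
      intro i hi
      have : i ≠ ⟨k, hk⟩ := by rintro rfl; simp at hi
      simp [hg, this]
    have hfs' : ∀ i : Fin n, k + 1 ≤ i.val → f i = 0 := fun i hi => hfs i (by omega)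
    have pair : ∀ (c c' : Fin 2) (p q r s : ℝ), p * p + q * q = 1 → r * r + s * s = 1 →
        p * r + q * s = 0 → ι ℂ (tens e c (cx (p • g + q • f))) *
          (ι ℂ (tens e c' (cx (r • g + s • f))) * listProd e l) ∈
            Submodule.span ℂ (orthoProds e (k + 1) d) := by
      intro c c' p q r s h1 h2 h3
      apply Submodule.subset_span
      rw [← listProd_cons, ← listProd_cons]
      refine ⟨_, (hl.mono.cons c' ?_ ?_ ?_).cons c ?_ ?_ ?_, ?_, rfl⟩
      · simp only [inner_add_left, inner_add_right, real_inner_smul_left, real_inner_smul_right,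
          hgg, hf, hgf, hfg]
        linarith
      · intro i hi; simp [hgs i hi, hfs' i hi]
      · intro a ha
        simp [inner_add_left, real_inner_smul_left, hgo a ha, hfo a ha]
      · simp only [inner_add_left, inner_add_right, real_inner_smul_left, real_inner_smul_right,
          hgg, hf, hgf, hfg]
        linarith
      · intro i hi; simp [hgs i hi, hfs' i hi]
      · intro a ha
        rcases List.mem_cons.1 ha with rfl | ha
        · simp only [inner_add_left, inner_add_right, real_inner_smul_left, real_inner_smul_right,
            hgg, hf, hgf, hfg]
          linarith
        · simp [inner_add_left, real_inner_smul_left, hgo a ha, hfo a ha]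
      · simp only [List.length_cons]; push_cast; omega
    have hgk : cx g = coordVec n k := cx_single hk
    refine ⟨ι ℂ (tens e 0 (cx f)) * (ι ℂ (tens e 1 (cx f)) * listProd e l), ?_, ?_⟩
    · rw [← listProd_cons, ← listProd_cons]
      have := listProd_mem_poly e k ((0, f) :: (1, f) :: l) (by
        intro a ha i hi
        simp only [List.mem_cons] at ha
        rcases ha with rfl | rfl | ha
        exacts [hfs i hi, hfs i hi, hl.supp a ha i hi])
      have hd' : d =
          (((0, f) :: (1, f) :: l : List (Fin 2 × EuclideanSpace ℝ (Fin n))).length : ℤ) := by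
        simp only [List.length_cons]; push_cast; omega
      rwa [hd']
    -- The pair `(3g + 4f)/5`, `(4g - 3f)/5` expands to `(12 gg - 9 gf + 16 fg - 12 ff)/25`.
    -- Multiplying by `25/12` and cancelling the mixed terms with the pairs `(g, f)` and `(f, g)`
    -- leaves `gg - ff`.
    · have t1 := pair 0 1 (3 / 5) (4 / 5) (4 / 5) (-3 / 5) (by norm_num) (by norm_num) (by norm_num)
      have t2 := pair 0 1 1 0 0 1 (by norm_num) (by norm_num) (by norm_num)
      have t3 := pair 0 1 0 1 1 0 (by norm_num) (by norm_num) (by norm_num)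
      have := add_mem (add_mem (Submodule.smul_mem _ (25 / 12 : ℂ) t1)
        (Submodule.smul_mem _ (3 / 4 : ℂ) t2)) (Submodule.smul_mem _ (-4 / 3 : ℂ) t3)
      convert this using 1
      simp only [cx_add, cx_smul, map_add, map_smul, hgk, add_mul, mul_add, smul_mul_assoc,
        mul_smul_comm]
      push_cast
      module

variable [FiniteDimensional ℂ W]

theorem lower_orthoProds {k : ℕ} {d : ℤ} {x : ExteriorAlgebra ℂ W}
    (hx : x ∈ orthoProds e k d) : lower e x = 0 := by
  obtain ⟨l, hl, -, rfl⟩ := hx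
  have h := contract_list_prod_eq_zero (sform e) (l.map fun a => tens e a.1 (cx a.2)) ?_
  · rw [List.map_map] at h
    exact h
  intro v hv w hw
  obtain ⟨a, ha, rfl⟩ := List.mem_map.1 hv
  obtain ⟨b, hb, rfl⟩ := List.mem_map.1 hw
  by_cases hab : a = b
  · rw [hab, sform_tens_self]
  have h0 : cx a.2 ⬝ᵥ cx b.2 = 0 := by
    obtain ⟨i, rfl⟩ := List.get_of_mem ha
    obtain ⟨j, rfl⟩ := List.get_of_mem hb
    rw [cx_dotProduct, Complex.ofReal_eq_zero]
    rcases lt_trichotomy i j with hij | hij | hij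
    · exact List.pairwise_iff_get.1 hl.orth _ _ hij
    · exact absurd (by rw [hij]) hab
    · rw [real_inner_comm]
      exact List.pairwise_iff_get.1 hl.orth _ _ hij
  rcases a with ⟨a, u⟩
  rcases b with ⟨b, v⟩
  fin_cases a <;> fin_cases b <;>
    simp_all [sform_tens_self, sform_tens_zero_one, sform_tens_one_zero]

theorem lower_span_orthoProds {k : ℕ} {d : ℤ} {x : ExteriorAlgebra ℂ W}
    (hx : x ∈ Submodule.span ℂ (orthoProds e k d)) : lower e x = 0 := by
  have : Submodule.span ℂ (orthoProds e k d) ≤ LinearMap.ker (lower e) :=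
    Submodule.span_le.2 fun y hy => lower_orthoProds e hy
  exact this hx

/-- Primitivity passes to the components `x1`, `x2`, `x3`, which are handled by induction. The part
with both new generators is traded for an element `y` on the first `k` pairs, so that `x0 + y` is
again primitive and only it remains. -/
theorem mem_span_orthoProds (k : ℕ) (hk : k ≤ n) : ∀ (d : ℤ) (x : ExteriorAlgebra ℂ W), d ≤ k →
    x ∈ poly e k d → lower e x = 0 → x ∈ Submodule.span ℂ (orthoProds e k d) := by
  induction k with
  | zero =>
    intro d x _ hx _
    rw [poly] at hx
    split_ifs at hx with hd
    · refine Submodule.span_mono ?_ hx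
      rintro _ rfl
      exact ⟨[], ⟨by simp, by simp, by simp⟩, by simp [hd], by simp [listProd]⟩
    · rw [Submodule.mem_bot] at hx
      rw [hx]
      exact zero_mem _
  | succ k ih =>
    intro d x hd hx h
    push_cast at hd
    have ih := ih (by omega)
    obtain ⟨x0, h0, x1, h1, x2, h2, x3, h3, rfl⟩ := (mem_poly_succ e).1 hx
    have h' := h
    rw [lower_decomp e hk h1 h2 h3] at h'
    have hk' : k ≤ n := by omega
    obtain ⟨-, z1, z2, z3⟩ := poly_components_eq_zero e hk
      (add_mem (lower_mem_poly e k hk' _ _ h0) (Submodule.smul_mem _ _ h3))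
      (lower_mem_poly e k hk' _ _ h1) (lower_mem_poly e k hk' _ _ h2)
      (lower_mem_poly e k hk' _ _ h3) h'
    have s1 := gen_mul_mem_span e hk 0 (ih _ _ (by omega) h1 z1)
    have s2 := gen_mul_mem_span e hk 1 (ih _ _ (by omega) h2 z2)
    obtain ⟨y, hy, s3⟩ := exists_sub_mem_span e hk hd (ih _ _ (by omega) h3 z3)
    have hx0 : x0 + gen e 0 k * x1 + gen e 1 k * x2 + gen e 0 k * (gen e 1 k * x3) =
        (x0 + y) + (gen e 0 k * x1 + gen e 1 k * x2 + (gen e 0 k * (gen e 1 k * x3) - y)) := by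
      abel
    have s := add_mem (add_mem s1 s2) s3
    rw [hx0] at h ⊢
    refine add_mem ?_ s
    rw [map_add, lower_span_orthoProds e s, add_zero] at h
    -- When `d = k + 1` the remainder lies just above the middle degree, where `lower` is injective,
    -- so it vanishes; in smaller degree the induction hypothesis applies.
    rcases hd.eq_or_lt with hd' | hd'
    · rw [lower_iterate_injective e k hk' 1 _ _ (add_mem h0 hy) (by push_cast; omega)
        (by simpa using h)]
      exact zero_mem _
    · exact Submodule.span_mono (orthoProds_mono e k d) (ih _ _ (by omega) (add_mem h0 hy) h)

/-- The primitive elements of degree `n` are spanned by the products of vectors `f_c ⊗ u` where `u`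
runs through a real orthonormal basis. -/
theorem primitive_mem_span {x : ExteriorAlgebra ℂ W} (hx : x ∈ ⋀[ℂ]^n W) (h : lower e x = 0) :
    x ∈ Submodule.span ℂ {y | ∃ (u : OrthonormalBasis (Fin n) ℝ (EuclideanSpace ℝ (Fin n)))
      (c : Fin n → Fin 2), y = ExteriorAlgebra.ιMulti ℂ n fun i => tens e (c i) (cx (u i))} := by
  refine Submodule.span_mono ?_
    (mem_span_orthoProds e n le_rfl n x le_rfl (exteriorPower_le_poly e n hx) h)
  rintro _ ⟨l, hl, hlen, rfl⟩
  have hlen : l.length = n := by exact_mod_cast hlen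
  have ho : Orthonormal ℝ fun i : Fin n => (l.get (i.cast hlen.symm)).2 := by
    rw [orthonormal_iff_ite]
    intro i j
    split_ifs with hij
    · subst hij
      exact hl.unit _ (List.get_mem _ _)
    · rcases lt_or_gt_of_ne hij with hij | hij
      · exact List.pairwise_iff_get.1 hl.orth _ _ hij
      · rw [real_inner_comm]
        exact List.pairwise_iff_get.1 hl.orth _ _ hij
  obtain ⟨b, hb⟩ := Orthonormal.exists_orthonormalBasis_extension_of_card_eq (𝕜 := ℝ)
    (E := EuclideanSpace ℝ (Fin n)) (by simp)
    (v := fun i : Fin n => (l.get (i.cast hlen.symm)).2) (s := Set.univ)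
    (ho.comp Subtype.val Subtype.val_injective)
  refine ⟨b, fun i => (l.get (i.cast hlen.symm)).1, ?_⟩
  simp only [hb _ (Set.mem_univ _)]
  rw [ExteriorAlgebra.ιMulti_apply, listProd]
  congr 1
  apply List.ext_get
  · simp [hlen]
  · intro i h1 h2
    simp

end Orthonormal

/-! ### Interchanging two subspaces by an isometric involution -/

section Swap

open Submodule

variable {E : Type*} [NormedAddCommGroup E] [InnerProductSpace ℝ E]

/-- First-order condition at a maximum: if `s` maximises the inner product with `t` over the unit
sphere of `S`, then the projection of `t` to `S` is a multiple of `s`. -/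
theorem inner_eq_zero_of_forall_le {S : Submodule ℝ E} {s t : E} (hs : s ∈ S) (hss : ‖s‖ = 1)
    (h : ∀ x ∈ S, inner ℝ x t ≤ inner ℝ s t * ‖x‖) {x : E} (hx : x ∈ S)
    (hxs : inner ℝ x s = (0 : ℝ)) : inner ℝ x t = (0 : ℝ) := by
  set a := inner ℝ s t
  set b := inner ℝ x t
  set N := inner ℝ x x
  have hsx : inner ℝ s x = (0 : ℝ) := by rw [real_inner_comm, hxs]
  have hN : 0 ≤ N := real_inner_self_nonneg
  -- The test vector is `N` times the projection of `t` to the span of `s` and `x`. Squaring the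
  -- inequality gives `m * m ≤ a * a * N * m` with `m = a * a * N + b * b`, hence `b⁴ ≤ 0`.
  have h1 := h _ (add_mem (S.smul_mem (a * N) hs) (S.smul_mem b hx))
  have h2 : inner ℝ ((a * N) • s + b • x) t = a * a * N + b * b := by
    simp only [inner_add_left, real_inner_smul_left]
    ring
  have h3 : ‖(a * N) • s + b • x‖ ^ 2 = N * (a * a * N + b * b) := by
    rw [← real_inner_self_eq_norm_sq]
    simp only [inner_add_left, inner_add_right, real_inner_smul_left, real_inner_smul_right,
      hsx, hxs, real_inner_self_eq_norm_sq s, hss]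
    ring
  rw [h2] at h1
  set m := a * a * N + b * b with hm
  have hm0 : 0 ≤ m := by nlinarith [mul_nonneg (mul_self_nonneg a) hN, mul_self_nonneg b]
  have h4 : m * m ≤ a * a * (N * m) := by
    have := mul_self_le_mul_self hm0 h1
    nlinarith
  have h5 : (b * b) * (b * b) ≤ 0 := by
    have : 0 ≤ a * a * N := mul_nonneg (mul_self_nonneg a) hN
    nlinarith [mul_nonneg this (mul_self_nonneg b)]
  nlinarith [mul_self_nonneg (b * b), mul_self_nonneg b, pow_eq_zero_iff (two_ne_zero)
    |>.1 (le_antisymm (by nlinarith : (b * b) ^ 2 ≤ 0) (sq_nonneg _))]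

theorem reflection_orthogonal_singleton_apply (d x : E) :
    reflection (ℝ ∙ d)ᗮ x = x - (2 * (inner ℝ d x / ‖d‖ ^ 2)) • d := by
  rw [reflection_orthogonal_apply, reflection_singleton_apply]
  simp [two_mul, two_smul, add_smul]

variable [FiniteDimensional ℝ E]

/-- A pair of unit vectors realising the smallest principal angle exists by compactness, and
maximality in each variable gives the two orthogonality statements. -/
theorem exists_principal_vectors {S T : Submodule ℝ E} (hS : S ≠ ⊥) (hT : T ≠ ⊥) :
    ∃ s ∈ S, ∃ t ∈ T, ‖s‖ = 1 ∧ ‖t‖ = 1 ∧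
      (∀ x ∈ S, inner ℝ x s = (0 : ℝ) → inner ℝ x t = (0 : ℝ)) ∧
      (∀ x ∈ T, inner ℝ x t = (0 : ℝ) → inner ℝ x s = (0 : ℝ)) := by
  have : Nontrivial S := Submodule.nontrivial_iff_ne_bot.2 hS
  have : Nontrivial T := Submodule.nontrivial_iff_ne_bot.2 hT
  have hc : IsCompact (Metric.sphere (0 : S) 1 ×ˢ Metric.sphere (0 : T) 1) :=
    (isCompact_sphere _ _).prod (isCompact_sphere _ _)
  have hne : (Metric.sphere (0 : S) 1 ×ˢ Metric.sphere (0 : T) 1).Nonempty :=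
    (NormedSpace.sphere_nonempty.2 zero_le_one).prod (NormedSpace.sphere_nonempty.2 zero_le_one)
  obtain ⟨⟨s, t⟩, hst, hmax⟩ := hc.exists_isMaxOn hne
    (f := fun p => inner ℝ (p.1 : E) (p.2 : E)) (by fun_prop)
  obtain ⟨hs, ht⟩ := Set.mem_prod.1 hst
  have hs : ‖(s : E)‖ = 1 := by simpa using hs
  have ht : ‖(t : E)‖ = 1 := by simpa using ht
  have key : ∀ x ∈ S, ∀ y ∈ T, inner ℝ x y ≤ inner ℝ (s : E) (t : E) * (‖x‖ * ‖y‖) := by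
    intro x hx y hy
    rcases eq_or_ne x 0 with rfl | hx0
    · simp
    rcases eq_or_ne y 0 with rfl | hy0
    · simp
    have hx1 : 0 < ‖x‖ := norm_pos_iff.2 hx0
    have hy1 : 0 < ‖y‖ := norm_pos_iff.2 hy0
    have := hmax (a := (⟨‖x‖⁻¹ • x, S.smul_mem _ hx⟩, ⟨‖y‖⁻¹ • y, T.smul_mem _ hy⟩))
      ⟨by simp [norm_smul, hx1.ne'], by simp [norm_smul, hy1.ne']⟩
    simp only [Set.mem_ofPred_eq, real_inner_smul_left, real_inner_smul_right] at this
    rw [← mul_assoc, ← mul_inv, inv_mul_le_iff₀ (by positivity)] at this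
    linarith
  refine ⟨s, s.2, t, t.2, hs, ht, fun x hx h => ?_, fun x hx h => ?_⟩
  · exact inner_eq_zero_of_forall_le s.2 hs (fun y hy => by simpa [ht] using key y hy t t.2) hx h
  · refine inner_eq_zero_of_forall_le t.2 ht (fun y hy => ?_) hx h
    rw [real_inner_comm, real_inner_comm _ (t : E)]
    simpa [hs] using key s s.2 y hy

/-- Principal vectors `s`, `t` are split off, the complements are interchanged by induction, and the
result is composed with the reflection exchanging `s` and `t`. The last clause serves the induction:
it makes the involution for the complements fix `s` and `t`. -/
theorem exists_swap (k : ℕ) : ∀ S T : Submodule ℝ E, Module.finrank ℝ S = k →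
    Module.finrank ℝ T = k → ∃ g : E ≃ₗᵢ[ℝ] E, (∀ x, g (g x) = x) ∧ (∀ x ∈ S, g x ∈ T) ∧
      (∀ x ∈ T, g x ∈ S) ∧ ∀ x ∈ Sᗮ, x ∈ Tᗮ → g x = x := by
  induction k with
  | zero =>
    intro S T hS hT
    rw [Submodule.finrank_eq_zero] at hS hT
    subst hS hT
    exact ⟨LinearIsometryEquiv.refl ℝ E, by simp, by simp, by simp, by simp⟩
  | succ k ih =>
    intro S T hS hT
    obtain ⟨s, hs, t, ht, hs1, ht1, h1, h2⟩ := exists_principal_vectors (S := S) (T := T)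
      (by rintro rfl; simp at hS) (by rintro rfl; simp at hT)
    have fr : ∀ (S : Submodule ℝ E) (s : E), s ∈ S → ‖s‖ = 1 → Module.finrank ℝ S = k + 1 →
        Module.finrank ℝ ((ℝ ∙ s)ᗮ ⊓ S : Submodule ℝ E) = k := by
      intro S s hs hs1 hS
      have := Submodule.finrank_add_inf_finrank_orthogonal
        ((Submodule.span_singleton_le_iff_mem s S).2 hs)
      rw [finrank_span_singleton (by rintro rfl; simp at hs1), hS] at this
      omega
    obtain ⟨g, hg, hgS, hgT, hfix⟩ := ih _ _ (fr S s hs hs1 hS) (fr T t ht ht1 hT)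
    have mS : ∀ {x}, x ∈ S → inner ℝ x s = (0 : ℝ) → x ∈ (ℝ ∙ s)ᗮ ⊓ S := fun hx h =>
      ⟨Submodule.mem_orthogonal_singleton_iff_inner_left.2 h, hx⟩
    have mT : ∀ {x}, x ∈ T → inner ℝ x t = (0 : ℝ) → x ∈ (ℝ ∙ t)ᗮ ⊓ T := fun hx h =>
      ⟨Submodule.mem_orthogonal_singleton_iff_inner_left.2 h, hx⟩
    have oS : ∀ {x}, x ∈ (ℝ ∙ s)ᗮ ⊓ S → inner ℝ x s = (0 : ℝ) ∧ inner ℝ x t = (0 : ℝ) := by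
      intro x hx
      have := Submodule.mem_orthogonal_singleton_iff_inner_left.1 hx.1
      exact ⟨this, h1 x hx.2 this⟩
    have oT : ∀ {x}, x ∈ (ℝ ∙ t)ᗮ ⊓ T → inner ℝ x s = (0 : ℝ) ∧ inner ℝ x t = (0 : ℝ) := by
      intro x hx
      have := Submodule.mem_orthogonal_singleton_iff_inner_left.1 hx.1
      exact ⟨h2 x hx.2 this, this⟩
    have gs : g s = s := hfix s (fun x hx => (oS hx).1) (fun x hx => (oT hx).1)
    have gt : g t = t := hfix t (fun x hx => (oS hx).2) (fun x hx => (oT hx).2)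
    set r := reflection (ℝ ∙ (s - t))ᗮ with hr
    have rs : r s = t := reflection_sub (by rw [hs1, ht1])
    have rt : r t = s := by rw [← rs, hr, reflection_reflection]
    have rfix : ∀ x, inner ℝ x s = (0 : ℝ) → inner ℝ x t = (0 : ℝ) → r x = x := by
      intro x hxs hxt
      apply reflection_mem_subspace_eq_self
      rw [Submodule.mem_orthogonal_singleton_iff_inner_left, inner_sub_right, hxs, hxt, sub_zero]
    -- Since `g` fixes `s - t`, it commutes with the reflection along it, so the composite is again
    -- an involution.
    have comm : ∀ x, g (r x) = r (g x) := by
      intro x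
      have : inner ℝ (s - t) (g x) = (inner ℝ (s - t) x : ℝ) := by
        conv_lhs => rw [← gs, ← gt, ← map_sub]
        exact g.inner_map_map _ _
      rw [hr, reflection_orthogonal_singleton_apply, reflection_orthogonal_singleton_apply, this,
        map_sub, map_smul, map_sub, gs, gt]
    have dec : ∀ (S : Submodule ℝ E) (s x : E), s ∈ S → ‖s‖ = 1 → x ∈ S →
        x - (inner ℝ x s : ℝ) • s ∈ S ∧ inner ℝ (x - (inner ℝ x s : ℝ) • s) s = (0 : ℝ) := by
      intro S s x hs hs1 hx
      refine ⟨sub_mem hx (S.smul_mem _ hs), ?_⟩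
      rw [inner_sub_left, real_inner_smul_left, real_inner_self_eq_norm_sq, hs1]
      ring
    refine ⟨g.trans r, ?_, ?_, ?_, ?_⟩
    · intro x
      simp only [LinearIsometryEquiv.trans_apply]
      rw [comm, hg, hr, reflection_reflection]
    · intro x hx
      obtain ⟨d1, d2⟩ := dec S s x hs hs1 hx
      have hy := hgS _ (mS d1 d2)
      rw [← sub_add_cancel x ((inner ℝ x s : ℝ) • s), LinearIsometryEquiv.trans_apply, map_add,
        map_add, map_smul, map_smul, gs, rs, rfix _ (oT hy).1 (oT hy).2]
      exact add_mem hy.2 (T.smul_mem _ ht)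
    · intro x hx
      obtain ⟨d1, d2⟩ := dec T t x ht ht1 hx
      have hy := hgT _ (mT d1 d2)
      rw [← sub_add_cancel x ((inner ℝ x t : ℝ) • t), LinearIsometryEquiv.trans_apply, map_add,
        map_add, map_smul, map_smul, gt, rt, rfix _ (oS hy).1 (oS hy).2]
      exact add_mem hy.2 (S.smul_mem _ hs)
    · intro x hxS hxT
      rw [LinearIsometryEquiv.trans_apply, hfix x (fun y hy => hxS y hy.2) (fun y hy => hxT y hy.2)]
      refine rfix x ?_ ?_
      · rw [real_inner_comm]; exact hxS s hs
      · rw [real_inner_comm]; exact hxT t ht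

end Swap

/-! ### Operators attached to a frame -/

section Operators

variable {n : ℕ} {W : Type*} [AddCommGroup W] [Module ℂ W]

/-- After applying a linear functional this is the uniqueness of the determinant among scalar
alternating `n`-forms on `ℂⁿ`. No independence of `w` is needed. -/
theorem ιMulti_sum_smul (w w' : Fin n → W) (M : Matrix (Fin n) (Fin n) ℂ)
    (h : ∀ i, w' i = ∑ j, M i j • w j) :
    ExteriorAlgebra.ιMulti ℂ n w' = M.det • ExteriorAlgebra.ιMulti ℂ n w := by
  have key : ∀ φ : Module.Dual ℂ (ExteriorAlgebra ℂ W),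
      φ (ExteriorAlgebra.ιMulti ℂ n w') = φ (M.det • ExteriorAlgebra.ιMulti ℂ n w) := by
    intro φ
    let f : (Fin n → ℂ) [⋀^Fin n]→ₗ[ℂ] ℂ := φ.compAlternatingMap
      ((ExteriorAlgebra.ιMulti ℂ n).compLinearMap (Fintype.linearCombination ℂ w))
    have hf := congrArg (fun F => F fun i => M i) (f.eq_smul_basis_det (Pi.basisFun ℂ (Fin n)))
    simp only [AlternatingMap.smul_apply, Pi.basisFun_det, smul_eq_mul] at hf
    have h1 : (f fun i => M i) = φ (ExteriorAlgebra.ιMulti ℂ n w') := by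
      simp only [f, LinearMap.compAlternatingMap_apply, AlternatingMap.compLinearMap_apply,
        Fintype.linearCombination_apply]
      congr 2
      ext i
      exact (h i).symm
    have h2 : f (Pi.basisFun ℂ (Fin n)) = φ (ExteriorAlgebra.ιMulti ℂ n w) := by
      simp only [f, LinearMap.compAlternatingMap_apply, AlternatingMap.compLinearMap_apply,
        Fintype.linearCombination_apply]
      congr 2
      ext i
      simp [Pi.single_apply]
    rw [h1, h2] at hf
    rw [hf, map_smul, smul_eq_mul, mul_comm]
    rfl
  rw [← sub_eq_zero, ← Module.forall_dual_apply_eq_zero_iff ℂ]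
  intro φ
  rw [map_sub, key, sub_self]

/-- The complex matrix of a linear isometry of `ℝⁿ`. -/
def cmat (g : EuclideanSpace ℝ (Fin n) ≃ₗᵢ[ℝ] EuclideanSpace ℝ (Fin n)) :
    Matrix (Fin n) (Fin n) ℂ :=
  Matrix.of fun i j => (g (EuclideanSpace.single j 1) i : ℂ)

theorem cmat_mulVec (g : EuclideanSpace ℝ (Fin n) ≃ₗᵢ[ℝ] EuclideanSpace ℝ (Fin n))
    (u : EuclideanSpace ℝ (Fin n)) : cmat g *ᵥ cx u = cx (g u) := by
  have hu : u = ∑ j, u j • EuclideanSpace.single j (1 : ℝ) := by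
    ext i
    simp [Pi.single_apply]
  ext i
  conv_rhs => rw [hu]
  simp [cmat, cx, Matrix.mulVec, dotProduct, mul_comm]

variable (e : (Fin 2 → Fin n → ℂ) ≃ₗ[ℂ] W)

/-- The endomorphism `h ⊗ k` of a space identified with `ℂ² ⊗ ℂⁿ`. -/
def act (h : Matrix (Fin 2) (Fin 2) ℂ) (k : Matrix (Fin n) (Fin n) ℂ) : W →ₗ[ℂ] W :=
  e.toLinearMap ∘ₗ (LinearMap.pi fun c' => ∑ c, h c' c • (k.mulVecLin ∘ₗ LinearMap.proj c)) ∘ₗ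
    e.symm.toLinearMap

theorem act_tens (h : Matrix (Fin 2) (Fin 2) ℂ) (k : Matrix (Fin n) (Fin n) ℂ) (c : Fin 2)
    (a : Fin n → ℂ) :
    act e h k (tens e c a) = h 0 c • tens e 0 (k *ᵥ a) + h 1 c • tens e 1 (k *ᵥ a) := by
  apply e.symm.injective
  ext c' i
  fin_cases c <;> fin_cases c' <;> simp [act, tens]

theorem linearMap_ext_tens {W' : Type*} [AddCommGroup W'] [Module ℂ W'] {f g : W →ₗ[ℂ] W'}
    (h : ∀ c a, f (tens e c a) = g (tens e c a)) : f = g := by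
  ext v
  rw [eq_tens_add_tens e v, map_add, map_add, h, h]

theorem sform_ext {B : W →ₗ[ℂ] W →ₗ[ℂ] ℂ}
    (h : ∀ c c' a b, B (tens e c a) (tens e c' b) = sform e (tens e c a) (tens e c' b)) :
    B = sform e :=
  linearMap_ext_tens e fun c a => linearMap_ext_tens e fun c' b => h c c' a b

/-- The Weyl element of `SL₂`. -/
def weylMat : Matrix (Fin 2) (Fin 2) ℂ := !![0, -1; 1, 0]

/-- The element `diag(t, t⁻¹)` of `SL₂`. -/
def torusMat (t : ℂ) : Matrix (Fin 2) (Fin 2) ℂ := !![t, 0; 0, t⁻¹]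

/-- The endomorphisms given by the Weyl element and the torus of `SL₂` and by real orthogonal
matrices. -/
inductive IsFrameOp : (W →ₗ[ℂ] W) → Prop
  | weyl : IsFrameOp (act e weylMat 1)
  | torus (t : ℂ) (ht : t ≠ 0) : IsFrameOp (act e (torusMat t) 1)
  | isom (g : EuclideanSpace ℝ (Fin n) ≃ₗᵢ[ℝ] EuclideanSpace ℝ (Fin n)) :
    IsFrameOp (act e 1 (cmat g))

theorem cmat_transpose_mul_self
    (g : EuclideanSpace ℝ (Fin n) ≃ₗᵢ[ℝ] EuclideanSpace ℝ (Fin n)) :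
    (cmat g)ᵀ * cmat g = 1 := by
  ext i j
  have h : ((cmat g)ᵀ * cmat g) i j =
      cx (g (EuclideanSpace.single i 1)) ⬝ᵥ cx (g (EuclideanSpace.single j 1)) := rfl
  rw [h, cx_dotProduct, g.inner_map_map, EuclideanSpace.inner_single_left]
  by_cases hij : i = j <;> simp [Matrix.one_apply, hij]

theorem cmat_dotProduct (g : EuclideanSpace ℝ (Fin n) ≃ₗᵢ[ℝ] EuclideanSpace ℝ (Fin n))
    (a b : Fin n → ℂ) : (cmat g *ᵥ a) ⬝ᵥ (cmat g *ᵥ b) = a ⬝ᵥ b := by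
  rw [Matrix.dotProduct_mulVec, ← Matrix.mulVec_transpose, Matrix.mulVec_mulVec,
    cmat_transpose_mul_self, Matrix.one_mulVec]

theorem act_weyl_zero (a : Fin n → ℂ) : act e weylMat 1 (tens e 0 a) = tens e 1 a := by
  simp [act_tens, weylMat]

theorem act_weyl_one (a : Fin n → ℂ) : act e weylMat 1 (tens e 1 a) = -tens e 0 a := by
  simp [act_tens, weylMat]

theorem act_torus (t : ℂ) (c : Fin 2) (a : Fin n → ℂ) :
    act e (torusMat t) 1 (tens e c a) = (if c = 0 then t else t⁻¹) • tens e c a := by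
  fin_cases c <;> simp [act_tens, torusMat]

theorem act_isom (k : Matrix (Fin n) (Fin n) ℂ) (c : Fin 2) (a : Fin n → ℂ) :
    act e 1 k (tens e c a) = tens e c (k *ᵥ a) := by
  fin_cases c <;> simp [act_tens]

theorem IsFrameOp.compl_sform {e : (Fin 2 → Fin n → ℂ) ≃ₗ[ℂ] W} {F : W →ₗ[ℂ] W}
    (hF : IsFrameOp e F) : (sform e).compl₁₂ F F = sform e := by
  apply sform_ext
  intro c c' a b
  rw [LinearMap.compl₁₂_apply]
  cases hF with
  | weyl =>
    fin_cases c <;> fin_cases c' <;>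
      simp [act_weyl_zero, act_weyl_one, sform_tens_self, sform_tens_zero_one, sform_tens_one_zero]
  | torus t ht =>
    fin_cases c <;> fin_cases c' <;>
      simp [act_torus, sform_tens_self, sform_tens_zero_one, sform_tens_one_zero, ht]
  | isom g =>
    fin_cases c <;> fin_cases c' <;>
      simp [act_isom, sform_tens_self, sform_tens_zero_one, sform_tens_one_zero, cmat_dotProduct]

theorem sform_tens_orthonormal (u : OrthonormalBasis (Fin n) ℝ (EuclideanSpace ℝ (Fin n)))
    (c : Fin n → Fin 2) (i j : Fin n) :
    sform e (tens e (c i) (cx (u i))) (tens e (c j) (cx (u j))) = 0 := by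
  by_cases hij : i = j
  · rw [hij, sform_tens_self]
  have h : cx (u i) ⬝ᵥ cx (u j) = 0 := by
    rw [cx_dotProduct, u.orthonormal.2 hij, Complex.ofReal_zero]
  generalize c i = a
  generalize c j = b
  fin_cases a <;> fin_cases b <;>
    simp [sform_tens_self, sform_tens_zero_one, sform_tens_one_zero, h]

/-- By hypothesis `g (u i)` involves only those `u' j` with `c' j = 1 - c i`, and the Weyl element
turns `f_{c i}` into `± f_{1 - c i}`. Each factor thus lands in the span of the factors of the
second product, and the scalar is a determinant. -/
theorem act_weyl_act_isom_ortho (g : EuclideanSpace ℝ (Fin n) ≃ₗᵢ[ℝ] EuclideanSpace ℝ (Fin n))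
    (u u' : OrthonormalBasis (Fin n) ℝ (EuclideanSpace ℝ (Fin n))) (c c' : Fin n → Fin 2)
    (h : ∀ i j, c' j = c i → inner ℝ (u' j) (g (u i)) = (0 : ℝ)) :
    ∃ a : ℂ, ExteriorAlgebra.map (act e weylMat 1) (ExteriorAlgebra.map (act e 1 (cmat g))
      (ExteriorAlgebra.ιMulti ℂ n fun i => tens e (c i) (cx (u i)))) =
        a • ExteriorAlgebra.ιMulti ℂ n fun i => tens e (c' i) (cx (u' i)) := by
  rw [ExteriorAlgebra.map_apply_ιMulti, ExteriorAlgebra.map_apply_ιMulti]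
  refine ⟨_, ιMulti_sum_smul _ _ (Matrix.of fun i j =>
    (if c i = 0 then 1 else -1) * ((inner ℝ (u' j) (g (u i)) : ℝ) : ℂ)) fun i => ?_⟩
  have hg : cx (g (u i)) = ∑ j, ((inner ℝ (u' j) (g (u i)) : ℝ) : ℂ) • cx (u' j) := by
    conv_lhs => rw [← u'.sum_repr (g (u i))]
    ext k
    simp [cx, OrthonormalBasis.repr_apply_apply]
  have hJ : ∀ a, act e weylMat 1 (tens e (c i) a) =
      (if c i = 0 then (1 : ℂ) else -1) • tens e (1 - c i) a := by
    intro a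
    generalize c i = b
    fin_cases b <;> simp [act_weyl_zero, act_weyl_one]
  simp only [Function.comp_apply, act_isom, cmat_mulVec, hJ]
  rw [hg, map_sum, Finset.smul_sum]
  refine Finset.sum_congr rfl fun j _ => ?_
  rw [map_smul, smul_smul, Matrix.of_apply]
  by_cases hij : c' j = c i
  · rw [h i j hij]
    simp
  · have : 1 - c i = c' j := by
      revert hij
      generalize c i = a
      generalize c' j = b
      fin_cases a <;> fin_cases b <;> simp
    rw [this]

/-- On vectors the composite squares to `J² ⊗ g² = -1`, hence on `n`-vectors to `(-1)ⁿ`. -/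
theorem act_weyl_act_isom_sq {g : EuclideanSpace ℝ (Fin n) ≃ₗᵢ[ℝ] EuclideanSpace ℝ (Fin n)}
    (hg : ∀ x, g (g x) = x) (hn : Odd n) (w : Fin n → Fin 2 × EuclideanSpace ℝ (Fin n)) :
    let F := ExteriorAlgebra.map (act e weylMat 1)
    let G := ExteriorAlgebra.map (act e 1 (cmat g))
    F (G (F (G (ExteriorAlgebra.ιMulti ℂ n fun i => tens e (w i).1 (cx (w i).2))))) =
      -ExteriorAlgebra.ιMulti ℂ n fun i => tens e (w i).1 (cx (w i).2) := by
  intro F G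
  simp only [F, G, ExteriorAlgebra.map_apply_ιMulti]
  rw [ιMulti_sum_smul (fun i => tens e (w i).1 (cx (w i).2)) _ (-1)]
  · rw [Matrix.det_neg, Matrix.det_one, Fintype.card_fin, hn.neg_one_pow]
    simp
  · intro i
    have h : ∀ c a, act e weylMat 1 (act e 1 (cmat g) (act e weylMat 1 (act e 1 (cmat g)
        (tens e c (cx a))))) = -tens e c (cx a) := by
      intro c a
      fin_cases c <;> simp [act_isom, act_weyl_zero, act_weyl_one, cmat_mulVec, hg]
    rw [Finset.sum_eq_single i (fun j _ hj => by simp [Matrix.one_apply_ne hj.symm]) (by simp)]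
    simp [h]

variable [FiniteDimensional ℂ W]

/-- The primitive elements of degree `n`, as a subspace of the exterior algebra. -/
def prim : Submodule ℂ (ExteriorAlgebra ℂ W) := ⋀[ℂ]^n W ⊓ LinearMap.ker (lower e)

theorem IsFrameOp.map_mem_prim {e : (Fin 2 → Fin n → ℂ) ≃ₗ[ℂ] W} {F : W →ₗ[ℂ] W}
    (hF : IsFrameOp e F) {x : ExteriorAlgebra ℂ W} (hx : x ∈ prim e) :
    ExteriorAlgebra.map F x ∈ prim e := by
  refine ⟨?_, ?_⟩
  · have := (exteriorPower.map n F ⟨x, hx.1⟩).2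
    rwa [coe_exteriorPower_map] at this
  · change lower e _ = 0
    rw [lower, contract_map, hF.compl_sform, LinearMap.mem_ker.1 hx.2, map_zero]

theorem ιMulti_mem_prim (w : Fin n → W) (h : ∀ i j, sform e (w i) (w j) = 0) :
    ExteriorAlgebra.ιMulti ℂ n w ∈ prim e := by
  refine ⟨(exteriorPower.ιMulti ℂ n w).2, ?_⟩
  have := contract_list_prod_eq_zero (sform e) (List.ofFn w) (by
    intro v hv u hu
    obtain ⟨i, rfl⟩ := List.mem_ofFn.1 hv
    obtain ⟨j, rfl⟩ := List.mem_ofFn.1 hu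
    exact h i j)
  rw [List.map_ofFn] at this
  change lower e _ = 0
  rw [ExteriorAlgebra.ιMulti_apply]
  exact this

/-- A quadratic form on the exterior algebra which is invariant on primitive elements under the
frame operators pairs any two products of orthonormal vectors to zero. -/
theorem polar_ortho_eq_zero (hn : Odd n) (R : QuadraticForm ℂ (ExteriorAlgebra ℂ W))
    (hR : ∀ F : W →ₗ[ℂ] W, IsFrameOp e F → ∀ x ∈ prim e, R (ExteriorAlgebra.map F x) = R x)
    (u u' : OrthonormalBasis (Fin n) ℝ (EuclideanSpace ℝ (Fin n))) (c c' : Fin n → Fin 2) :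
    QuadraticMap.polar R (ExteriorAlgebra.ιMulti ℂ n fun i => tens e (c i) (cx (u i)))
      (ExteriorAlgebra.ιMulti ℂ n fun i => tens e (c' i) (cx (u' i))) = 0 := by
  set x := ExteriorAlgebra.ιMulti ℂ n fun i => tens e (c i) (cx (u i)) with hx
  set y := ExteriorAlgebra.ιMulti ℂ n fun i => tens e (c' i) (cx (u' i)) with hy
  have hxP : x ∈ prim e := ιMulti_mem_prim e _ (sform_tens_orthonormal e u c)
  have hyP : y ∈ prim e := ιMulti_mem_prim e _ (sform_tens_orthonormal e u' c')
  have hpolar : ∀ F : W →ₗ[ℂ] W, IsFrameOp e F → ∀ x ∈ prim e, ∀ y ∈ prim e,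
      QuadraticMap.polar R (ExteriorAlgebra.map F x) (ExteriorAlgebra.map F y) =
        QuadraticMap.polar R x y := by
    intro F hF x hx y hy
    rw [QuadraticMap.polar, QuadraticMap.polar, ← map_add, hR F hF _ (add_mem hx hy), hR F hF x hx,
      hR F hF y hy]
  -- The equality of cardinalities says that the torus weights of `x` and `y` are opposite.
  by_cases hcard : Fintype.card {i // c i = 1} = Fintype.card {i // c' i = 0}
  · let S := Submodule.span ℝ (Set.range fun i : {i // c i = 1} => u i)
    let T := Submodule.span ℝ (Set.range fun i : {i // c' i = 0} => u' i)
    obtain ⟨g, hg, hST, hTS, -⟩ := exists_swap _ S T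
      (finrank_span_eq_card (u.orthonormal.linearIndependent.comp _ Subtype.val_injective))
      ((finrank_span_eq_card (u'.orthonormal.linearIndependent.comp _ Subtype.val_injective)).trans
        hcard.symm)
    have hS : ∀ i, c i = 0 → ∀ v ∈ S, inner ℝ (u i) v = (0 : ℝ) := by
      intro i hi v hv
      induction hv using Submodule.span_induction with
      | mem v hv =>
        obtain ⟨j, rfl⟩ := hv
        refine u.orthonormal.2 fun h => ?_
        rw [h, j.2] at hi
        exact one_ne_zero hi
      | zero => simp
      | add v w _ _ hv hw => rw [inner_add_right, hv, hw, add_zero]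
      | smul a v _ hv => rw [real_inner_smul_right, hv, mul_zero]
    have hT : ∀ i, c' i = 1 → ∀ v ∈ T, inner ℝ (u' i) v = (0 : ℝ) := by
      intro i hi v hv
      induction hv using Submodule.span_induction with
      | mem v hv =>
        obtain ⟨j, rfl⟩ := hv
        refine u'.orthonormal.2 fun h => ?_
        rw [h, j.2] at hi
        exact zero_ne_one hi
      | zero => simp
      | add v w _ _ hv hw => rw [inner_add_right, hv, hw, add_zero]
      | smul a v _ hv => rw [real_inner_smul_right, hv, mul_zero]
    have hadj : ∀ v w, inner ℝ (g v) w = (inner ℝ v (g w) : ℝ) := by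
      intro v w
      rw [← g.inner_map_map v (g w), hg]
    have h1 : ∀ i j, c' j = c i → inner ℝ (u' j) (g (u i)) = (0 : ℝ) := by
      intro i j hij
      rcases (by omega : c i = 0 ∨ c i = 1) with hi | hi
      · rw [← hadj, real_inner_comm]
        exact hS i hi _ (hTS _ (Submodule.subset_span ⟨⟨j, hij.trans hi⟩, rfl⟩))
      · exact hT j (hij.trans hi) _ (hST _ (Submodule.subset_span ⟨⟨i, hi⟩, rfl⟩))
    have h2 : ∀ i j, c j = c' i → inner ℝ (u j) (g (u' i)) = (0 : ℝ) := by
      intro i j hij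
      rw [← hadj, real_inner_comm]
      exact h1 j i hij.symm
    obtain ⟨a, ha⟩ := act_weyl_act_isom_ortho e g u u' c c' h1
    obtain ⟨b, hb⟩ := act_weyl_act_isom_ortho e g u' u c' c h2
    have hsq := act_weyl_act_isom_sq e hg hn fun i => (c i, u i)
    simp only at hsq
    rw [ha, map_smul, map_smul, hb, smul_smul, ← hx] at hsq
    -- The composite sends `x` to `a • y` and `y` to `b • x`, and its square gives `(a * b) • x =
    -- -x`. With the symmetry of the polar form, the value is its own negative.
    have e1 : QuadraticMap.polar R x y = QuadraticMap.polar R (a • y) (b • x) := by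
      rw [← ha, ← hb, hpolar _ .weyl _ ((IsFrameOp.isom g).map_mem_prim hxP) _
        ((IsFrameOp.isom g).map_mem_prim hyP), hpolar _ (.isom g) _ hxP _ hyP]
    rw [QuadraticMap.polar_smul_left, QuadraticMap.polar_smul_right, smul_smul, smul_eq_mul,
      QuadraticMap.polar_comm, ← smul_eq_mul, ← QuadraticMap.polar_smul_right, hsq,
      QuadraticMap.polar_neg_right, QuadraticMap.polar_comm] at e1
    exact self_eq_neg.1 e1
  -- One torus element suffices: powers of `t = 2` with different exponents are different.
  · have htor : ∀ (u : OrthonormalBasis (Fin n) ℝ (EuclideanSpace ℝ (Fin n))) (c : Fin n → Fin 2),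
        ExteriorAlgebra.map (act e (torusMat 2) 1)
          (ExteriorAlgebra.ιMulti ℂ n fun i => tens e (c i) (cx (u i))) =
          (∏ i, if c i = 0 then (2 : ℂ) else 2⁻¹) •
            ExteriorAlgebra.ιMulti ℂ n fun i => tens e (c i) (cx (u i)) := by
      intro u c
      rw [ExteriorAlgebra.map_apply_ιMulti, ← AlternatingMap.map_smul_univ]
      congr 1
      ext i
      simp [act_torus]
    have e1 := hpolar _ (.torus 2 two_ne_zero) x hxP y hyP
    rw [htor, htor, QuadraticMap.polar_smul_left, QuadraticMap.polar_smul_right, smul_smul,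
      smul_eq_mul, mul_left_eq_self₀] at e1
    refine e1.resolve_left fun h => hcard ?_
    have hp : ∀ c : Fin n → Fin 2, (∏ i, if c i = 0 then (2 : ℂ) else 2⁻¹) =
        2 ^ Fintype.card {i // c i = 0} * (2⁻¹) ^ Fintype.card {i // c i = 1} := by
      intro c
      rw [Finset.prod_ite, Finset.prod_const, Finset.prod_const, Fintype.card_subtype,
        Fintype.card_subtype]
      congr 3
      ext i
      simp only [Finset.mem_filter, Finset.mem_univ, true_and]
      omega
    have hs : ∀ c : Fin n → Fin 2,
        Fintype.card {i // c i = 0} + Fintype.card {i // c i = 1} = n := by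
      intro c
      have := Fintype.card_subtype_compl fun i => c i = 0
      have h' : Fintype.card {i // ¬ c i = 0} = Fintype.card {i // c i = 1} :=
        Fintype.card_congr (Equiv.subtypeEquivRight fun i => by omega)
      have h'' := Fintype.card_subtype_le fun i => c i = 0
      rw [Fintype.card_fin] at this h''
      omega
    rw [hp, hp] at h
    have k1 := hs c
    have k2 := hs c'
    set p := Fintype.card {i // c i = 0}
    set q := Fintype.card {i // c i = 1}
    set p' := Fintype.card {i // c' i = 0}
    set q' := Fintype.card {i // c' i = 1}
    have h3 : (2 : ℂ) ^ (p + p') = 2 ^ (q + q') := by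
      have : (2 : ℂ) ^ p * 2⁻¹ ^ q * (2 ^ p' * 2⁻¹ ^ q') * 2 ^ (q + q') = 2 ^ (q + q') := by
        rw [h, one_mul]
      rw [← this, pow_add, pow_add]
      have i1 : (2 : ℂ)⁻¹ ^ q * 2 ^ q = 1 := by rw [← mul_pow]; norm_num
      have i2 : (2 : ℂ)⁻¹ ^ q' * 2 ^ q' = 1 := by rw [← mul_pow]; norm_num
      linear_combination (-(2 : ℂ) ^ p * 2 ^ p' * 2⁻¹ ^ q' * 2 ^ q') * i1 - (2 : ℂ) ^ p * 2 ^ p' * i2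
    have h4 : p + p' = q + q' := by
      have : (2 : ℕ) ^ (p + p') = 2 ^ (q + q') := by exact_mod_cast h3
      exact Nat.pow_right_injective le_rfl this
    omega

/-- A quadratic form on the exterior algebra which is invariant on primitive elements under the
frame operators vanishes on primitive elements. -/
theorem eq_zero_of_invariant (hn : Odd n) (R : QuadraticForm ℂ (ExteriorAlgebra ℂ W))
    (hR : ∀ F : W →ₗ[ℂ] W, IsFrameOp e F → ∀ x ∈ prim e, R (ExteriorAlgebra.map F x) = R x)
    {x : ExteriorAlgebra ℂ W} (hx : x ∈ prim e) : R x = 0 := by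
  have hspan := primitive_mem_span e hx.1 hx.2
  have h1 : ∀ y, (∃ (u : OrthonormalBasis (Fin n) ℝ (EuclideanSpace ℝ (Fin n)))
      (c : Fin n → Fin 2), y = ExteriorAlgebra.ιMulti ℂ n fun i => tens e (c i) (cx (u i))) →
      R.polarBilin y x = 0 := by
    rintro _ ⟨u, c, rfl⟩
    have hle : Submodule.span ℂ {y | ∃ (u : OrthonormalBasis (Fin n) ℝ (EuclideanSpace ℝ (Fin n)))
        (c : Fin n → Fin 2), y = ExteriorAlgebra.ιMulti ℂ n fun i => tens e (c i) (cx (u i))} ≤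
        LinearMap.ker (R.polarBilin
          (ExteriorAlgebra.ιMulti ℂ n fun i => tens e (c i) (cx (u i)))) := by
      rw [Submodule.span_le]
      rintro _ ⟨u', c', rfl⟩
      exact polar_ortho_eq_zero e hn R hR u u' c c'
    exact hle hspan
  have h2 : R.polarBilin x x = 0 := by
    have hle : Submodule.span ℂ {y | ∃ (u : OrthonormalBasis (Fin n) ℝ (EuclideanSpace ℝ (Fin n)))
        (c : Fin n → Fin 2), y = ExteriorAlgebra.ιMulti ℂ n fun i => tens e (c i) (cx (u i))} ≤
        LinearMap.ker (R.polarBilin.flip x) := by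
      rw [Submodule.span_le]
      exact h1
    exact hle hspan
  rw [QuadraticMap.polarBilin_apply_apply, QuadraticMap.polar_self] at h2
  simpa using h2

end Operators

/-! ### Multihomogeneous polynomials invariant under permutations and `SL₂` -/

section Binary

variable {n : ℕ}

/-- The monomial `∏ vᵢ(cᵢ) vᵢ(c'ᵢ)` in binary variables. -/
def mono (c c' : Fin n → Fin 2) (v : Fin n → Fin 2 → ℂ) : ℂ := ∏ i, v i (c i) * v i (c' i)

/-- The action of the Weyl element on binary variables. -/
def weylVar (v : Fin n → Fin 2 → ℂ) : Fin n → Fin 2 → ℂ := fun i => ![-v i 1, v i 0]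

/-- The action of the torus on binary variables. -/
def torusVar (t : ℂ) (v : Fin n → Fin 2 → ℂ) : Fin n → Fin 2 → ℂ :=
  fun i => ![t * v i 0, t⁻¹ * v i 1]

/-- The total degree of `mono c c'` in the second variables. -/
def wt (c c' : Fin n → Fin 2) : ℕ := ∑ i, ((c i).val + (c' i).val)

theorem mono_torusVar {t : ℂ} (ht : t ≠ 0) (c c' : Fin n → Fin 2) (v : Fin n → Fin 2 → ℂ) :
    mono c c' (torusVar t v) = t ^ (2 * n) * (t⁻¹) ^ (2 * wt c c') * mono c c' v := by
  have h : ∀ i, torusVar t v i (c i) * torusVar t v i (c' i) =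
      t ^ 2 * (t⁻¹) ^ (2 * ((c i).val + (c' i).val)) * (v i (c i) * v i (c' i)) := by
    intro i
    simp only [torusVar]
    generalize c i = a
    generalize c' i = b
    fin_cases a <;> fin_cases b <;> simp <;> field_simp
  simp only [mono, h]
  rw [Finset.prod_mul_distrib, Finset.prod_mul_distrib, Finset.prod_const, Finset.card_univ,
    Fintype.card_fin, Finset.prod_pow_eq_pow_sum, ← pow_mul, wt, Finset.mul_sum]

theorem exists_perm_of_card {d d' : Fin n → ℕ}
    (h : ∀ k, Fintype.card {i // d i = k} = Fintype.card {i // d' i = k}) :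
    ∃ τ : Equiv.Perm (Fin n), ∀ i, d' (τ i) = d i :=
  ⟨Equiv.ofFiberEquiv fun k => Fintype.equivOfCardEq (h k), fun i => Equiv.ofFiberEquiv_map _ i⟩

/-- Numbers in `{0, 1, 2}` of average one contain as many zeros as twos, so `d` and `2 - d` have the
same multiset of values. -/
theorem exists_perm_two_sub {d : Fin n → ℕ} (hd : ∀ i, d i ≤ 2) (hsum : ∑ i, d i = n) :
    ∃ τ : Equiv.Perm (Fin n), ∀ i, 2 - d (τ i) = d i := by
  have hc : ∀ k, Fintype.card {i // d i = k} = ∑ i, if d i = k then 1 else 0 := by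
    intro k
    rw [Fintype.card_subtype, Finset.card_filter]
  have hc' : ∀ k, Fintype.card {i // 2 - d i = k} = ∑ i, if 2 - d i = k then 1 else 0 := by
    intro k
    rw [Fintype.card_subtype, Finset.card_filter]
  have h02 : (∑ i, if d i = 0 then 1 else 0) = ∑ i, if d i = 2 then 1 else 0 := by
    have h1 : ∑ i, (d i + if d i = 0 then 1 else 0) =
        ∑ i : Fin n, (1 + if d i = 2 then 1 else 0) := by
      refine Finset.sum_congr rfl fun i _ => ?_
      have := hd i
      split_ifs <;> omega
    rw [Finset.sum_add_distrib, Finset.sum_add_distrib, hsum] at h1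
    simpa using h1
  refine exists_perm_of_card (d' := fun i => 2 - d i) fun k => ?_
  rw [hc, hc']
  obtain rfl | rfl | rfl | hk : k = 0 ∨ k = 1 ∨ k = 2 ∨ 3 ≤ k := by omega
  · rw [h02]
    refine Finset.sum_congr rfl fun i _ => ?_
    have := hd i
    split_ifs <;> omega
  · refine Finset.sum_congr rfl fun i _ => ?_
    have := hd i
    split_ifs <;> omega
  · rw [← h02]
    refine Finset.sum_congr rfl fun i _ => ?_
    have := hd i
    split_ifs <;> omega
  · refine Finset.sum_congr rfl fun i _ => ?_
    have := hd i
    split_ifs <;> omega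

/-- The Weyl element replaces each exponent `d` of a second variable by `2 - d`, at the cost of a
total sign `(-1) ^ wt`. In weight `n` the new exponents are a rearrangement of the old ones. -/
theorem mono_weylVar (hn : Odd n) {c c' : Fin n → Fin 2} (h : wt c c' = n) :
    ∃ τ : Equiv.Perm (Fin n), ∀ v, mono c c' (weylVar v) = -mono c c' (v ∘ τ) := by
  obtain ⟨τ, hτ⟩ := exists_perm_two_sub (d := fun i => (c i).val + (c' i).val)
    (fun i => by omega) h
  refine ⟨τ, fun v => ?_⟩
  have h1 : ∀ i, weylVar v i (c i) * weylVar v i (c' i) =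
      (-1) ^ ((c i).val + (c' i).val) * (v i (1 - c i) * v i (1 - c' i)) := by
    intro i
    simp only [weylVar]
    generalize c i = a
    generalize c' i = b
    fin_cases a <;> fin_cases b <;> simp
  have h2 : ∀ i, v (τ i) (1 - c (τ i)) * v (τ i) (1 - c' (τ i)) =
      v (τ i) (c i) * v (τ i) (c' i) := by
    intro i
    have := hτ i
    revert this
    generalize c i = a
    generalize c' i = b
    generalize c (τ i) = a'
    generalize c' (τ i) = b'
    generalize v (τ i) = w
    fin_cases a <;> fin_cases b <;> fin_cases a' <;> fin_cases b' <;> simp [mul_comm]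
  have h3 : ∏ i, v i (1 - c i) * v i (1 - c' i) = ∏ i, v (τ i) (c i) * v (τ i) (c' i) := by
    rw [← Equiv.prod_comp τ]
    exact Finset.prod_congr rfl fun i _ => h2 i
  simp only [mono, h1, Function.comp_apply]
  rw [Finset.prod_mul_distrib, Finset.prod_pow_eq_pow_sum, h3]
  change (-1) ^ wt c c' * _ = _
  rw [h, hn.neg_one_pow, neg_one_mul]

theorem sum_root_pow {N : ℕ} {ζ : ℂ} (hζ : IsPrimitiveRoot ζ N) (j : ℕ) :
    ∑ k ∈ Finset.range N, (ζ ^ k) ^ j = if N ∣ j then (N : ℂ) else 0 := by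
  simp only [← pow_mul, mul_comm _ j]
  simp only [pow_mul ζ j]
  split_ifs with h
  · rw [(hζ.pow_eq_one_iff_dvd j).2 h]
    simp
  · have h1 : ζ ^ j ≠ 1 := fun h' => h ((hζ.pow_eq_one_iff_dvd j).1 h')
    rw [geom_sum_eq h1, ← pow_mul, mul_comm, pow_mul, hζ.pow_eq_one, one_pow, sub_self, zero_div]

theorem wt_le (c c' : Fin n → Fin 2) : wt c c' ≤ 2 * n := by
  calc wt c c' ≤ ∑ _i : Fin n, 2 := Finset.sum_le_sum fun i _ => by omega
    _ = 2 * n := by simp [mul_comm]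

/-- Averaging over the torus leaves weight `n`; averaging over permutations and the Weyl element
then pairs every monomial with its negative. The coefficients `b` need no symmetry of their own. -/
theorem sum_mono_eq_zero (hn : Odd n) (b : (Fin n → Fin 2) → (Fin n → Fin 2) → ℂ)
    (H : (Fin n → Fin 2 → ℂ) → ℂ) (hH : ∀ v, H v = ∑ c, ∑ c', mono c c' v * b c c')
    (hperm : ∀ (σ : Equiv.Perm (Fin n)) v, H (v ∘ σ) = H v)
    (hweyl : ∀ v, H (weylVar v) = H v)
    (htorus : ∀ t : ℂ, t ≠ 0 → ∀ v, H (torusVar t v) = H v) (v : Fin n → Fin 2 → ℂ) : H v = 0 := by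
  have hbal : ∀ v, H v = ∑ c, ∑ c', if wt c c' = n then mono c c' v * b c c' else 0 := by
    intro v
    have hN0 : ((2 * n + 1 : ℕ) : ℂ) ≠ 0 := Nat.cast_ne_zero.2 (Nat.succ_ne_zero (2 * n))
    -- Roots of unity of order `2n + 1` stand in for the torus integral: the monomials are scaled by
    -- powers `2 * wt + 1`, which lie between `1` and `4n + 1`, and the only odd multiple of `2n +
    -- 1` there is `2n + 1` itself.
    have hζ := Complex.isPrimitiveRoot_exp (2 * n + 1) (Nat.succ_ne_zero _)
    set ζ := Complex.exp (2 * Real.pi * Complex.I / ((2 * n + 1 : ℕ) : ℂ))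
    have hz0 : ζ ≠ 0 := hζ.ne_zero (Nat.succ_ne_zero _)
    have hmono : ∀ (k : ℕ) c c', mono c c' (torusVar (ζ ^ k)⁻¹ v) =
        (ζ ^ k) ^ (2 * wt c c' + 1) * mono c c' v := by
      intro k c c'
      have h1 : (ζ ^ k) ^ (2 * n + 1) = 1 := by
        rw [← pow_mul, mul_comm, pow_mul, hζ.pow_eq_one, one_pow]
      have h2 : ((ζ ^ k)⁻¹) ^ (2 * n) = ζ ^ k := by
        have hk : ζ ^ k ≠ 0 := pow_ne_zero _ hz0
        rw [inv_pow, inv_eq_of_mul_eq_one_right]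
        rw [← pow_succ, h1]
      rw [mono_torusVar (inv_ne_zero (pow_ne_zero _ hz0)), h2, inv_inv, pow_succ', mul_assoc]
    have hsum : ((2 * n + 1 : ℕ) : ℂ) * H v =
        ∑ k ∈ Finset.range (2 * n + 1), H (torusVar (ζ ^ k)⁻¹ v) := by
      rw [Finset.sum_congr rfl fun k _ => htorus _ (inv_ne_zero (pow_ne_zero k hz0)) v]
      simp
    apply mul_left_cancel₀ hN0
    rw [hsum]
    simp only [hH, hmono]
    rw [Finset.sum_comm, Finset.mul_sum]
    refine Finset.sum_congr rfl fun c _ => ?_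
    rw [Finset.sum_comm, Finset.mul_sum]
    refine Finset.sum_congr rfl fun c' _ => ?_
    simp only [mul_assoc]
    rw [← Finset.sum_mul, sum_root_pow hζ]
    have := wt_le c c'
    have hdvd : 2 * n + 1 ∣ 2 * wt c c' + 1 ↔ wt c c' = n := by
      constructor
      · rintro ⟨q, hq⟩
        have hq1 : q < 2 := by
          by_contra hq2
          have : (2 * n + 1) * 2 ≤ (2 * n + 1) * q := Nat.mul_le_mul_left _ (by omega)
          omega
        interval_cases q <;> omega
      · rintro h; rw [h]
    simp only [hdvd]
    split_ifs <;> simp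
  have hfin : (2 * (Fintype.card (Equiv.Perm (Fin n)) : ℂ)) * H v =
      ∑ σ : Equiv.Perm (Fin n), (H (v ∘ σ) + H (weylVar (v ∘ σ))) := by
    simp only [hweyl, hperm, Finset.sum_const, Finset.card_univ, nsmul_eq_mul]
    ring
  have hzero : ∑ σ : Equiv.Perm (Fin n), (H (v ∘ σ) + H (weylVar (v ∘ σ))) = 0 := by
    simp only [hbal, ← Finset.sum_add_distrib]
    rw [Finset.sum_comm]
    refine Finset.sum_eq_zero fun c _ => ?_
    rw [Finset.sum_comm]
    refine Finset.sum_eq_zero fun c' _ => ?_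
    by_cases h : wt c c' = n
    · obtain ⟨τ, hτ⟩ := mono_weylVar hn h
      simp only [h, if_true, hτ, Finset.sum_add_distrib, Function.comp_assoc]
      have : ∑ σ : Equiv.Perm (Fin n), -mono c c' (v ∘ ⇑σ ∘ ⇑τ) * b c c' =
          ∑ σ : Equiv.Perm (Fin n), -mono c c' (v ∘ ⇑σ) * b c c' :=
        Equiv.sum_comp (Equiv.mulRight τ) fun σ => -mono c c' (v ∘ ⇑σ) * b c c'
      rw [this, ← Finset.sum_add_distrib]
      exact Finset.sum_eq_zero fun σ _ => by ring
    · simp [h]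
  rw [hzero] at hfin
  refine (mul_eq_zero.1 hfin).resolve_left ?_
  exact mul_ne_zero two_ne_zero (Nat.cast_ne_zero.2 Fintype.card_ne_zero)

end Binary

/-! ### Quadratic forms on the cone over the Lagrangian Grassmannian -/

section Cone

variable {n : ℕ} {W : Type*} [AddCommGroup W] [Module ℂ W]

theorem two_mul_apply_eq_polar (R : QuadraticForm ℂ (ExteriorAlgebra ℂ W))
    (x : ExteriorAlgebra ℂ W) : 2 * R x = R.polarBilin x x := by
  rw [QuadraticMap.polarBilin_apply_apply, QuadraticMap.polar_self, two_smul, two_mul]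

/-- The values of a quadratic form along a line of families of vectors are polynomial. -/
theorem exists_polynomial_ιMulti (R : QuadraticForm ℂ (ExteriorAlgebra ℂ W)) (a b : Fin n → W) :
    ∃ p : Polynomial ℂ, ∀ z : ℂ, R (ExteriorAlgebra.ιMulti ℂ n (a + z • b)) = p.eval z := by
  let X : Finset (Fin n) → ExteriorAlgebra ℂ W := fun s => ExteriorAlgebra.ιMulti ℂ n
    (s.piecewise b a)
  refine ⟨∑ s, ∑ t, Polynomial.C (2⁻¹ * R.polarBilin (X s) (X t)) *
    Polynomial.X ^ (s.card + t.card), fun z => ?_⟩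
  have h : ExteriorAlgebra.ιMulti ℂ n (a + z • b) = ∑ s : Finset (Fin n), z ^ s.card • X s := by
    rw [add_comm, AlternatingMap.map_add_univ]
    refine Finset.sum_congr rfl fun s _ => ?_
    have h1 := (ExteriorAlgebra.ιMulti ℂ (M := W) n).toMultilinearMap.map_piecewise_smul
      (fun _ => z) (s.piecewise b a) s
    rw [Finset.prod_const] at h1
    rw [← AlternatingMap.coe_multilinearMap]
    refine Eq.trans ?_ h1
    congr 1
    ext i
    by_cases hi : i ∈ s <;> simp [hi]
  have h2 : R (ExteriorAlgebra.ιMulti ℂ n (a + z • b)) =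
      2⁻¹ * R.polarBilin (ExteriorAlgebra.ιMulti ℂ n (a + z • b))
        (ExteriorAlgebra.ιMulti ℂ n (a + z • b)) := by
    rw [← two_mul_apply_eq_polar]; ring
  rw [h2, h, Polynomial.eval_finsetSum, LinearMap.map_sum₂, Finset.mul_sum]
  refine Finset.sum_congr rfl fun s _ => ?_
  rw [map_sum, Finset.mul_sum, Polynomial.eval_finsetSum]
  refine Finset.sum_congr rfl fun t _ => ?_
  simp only [map_smul, LinearMap.smul_apply, smul_eq_mul, Polynomial.eval_mul, Polynomial.eval_C,
    Polynomial.eval_pow, Polynomial.eval_X, pow_add]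
  ring

open ComplexOrder in
/-- If the rows of `(X, Y)` span a Lagrangian subspace, then it can be moved by a shear to the graph
of a linear map. -/
theorem exists_symm_det_ne_zero (X Y : Matrix (Fin n) (Fin n) ℂ) (hXY : X * Yᵀ = Y * Xᵀ)
    (hinj : ∀ z : Fin n → ℂ, z ᵥ* X = 0 → z ᵥ* Y = 0 → z = 0) :
    ∃ C : Matrix (Fin n) (Fin n) ℂ, Cᵀ = C ∧ (X + Y * C).det ≠ 0 := by
  -- `K` is the intersection of the row space of `(X, Y)` with `0 ⊕ ℂⁿ`, the obstruction to being a
  -- graph. The matrix `C` is a sum of squares of conjugated basis vectors of `K`: it is symmetric,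
  -- and positivity of the Hermitian form makes it nondegenerate on `K`.
  let K : Submodule ℂ (Fin n → ℂ) :=
    (LinearMap.ker (Matrix.vecMulLinear X)).map (Matrix.vecMulLinear Y)
  let k := Module.finBasis ℂ K
  refine ⟨∑ j, Matrix.vecMulVec (star (k j : Fin n → ℂ)) (star (k j : Fin n → ℂ)), ?_, ?_⟩
  · rw [Matrix.transpose_sum]
    exact Finset.sum_congr rfl fun j _ => Matrix.transpose_vecMulVec _ _
  set C := ∑ j, Matrix.vecMulVec (star (k j : Fin n → ℂ)) (star (k j : Fin n → ℂ)) with hC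
  intro hdet
  obtain ⟨z, hz0, hz⟩ := Matrix.exists_vecMul_eq_zero_iff.2 hdet
  apply hz0
  set y := z ᵥ* Y with hy
  have hyC : y ᵥ* C = ∑ j, (y ⬝ᵥ star (k j : Fin n → ℂ)) • star (k j : Fin n → ℂ) := by
    rw [hC, Matrix.vecMul_sum]
    exact Finset.sum_congr rfl fun j _ => Matrix.vecMul_vecMulVec _ _ _
  set q : Fin n → ℂ := ∑ j, star (y ⬝ᵥ star (k j : Fin n → ℂ)) • (k j : Fin n → ℂ) with hq
  have hqK : q ∈ K := Submodule.sum_mem _ fun j _ => K.smul_mem _ (k j).2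
  have hyq : y ᵥ* C = star q := by
    rw [hyC, hq, star_sum]
    exact Finset.sum_congr rfl fun j _ => by rw [star_smul, star_star]
  have hx : z ᵥ* X = -star q := by
    rw [Matrix.vecMul_add, ← Matrix.vecMul_vecMul, ← hy, hyq] at hz
    exact eq_neg_of_add_eq_zero_left hz
  -- Isotropy makes `K` orthogonal to the row space of `X`. As `z ᵥ* X = -star q` with `q ∈ K`, this
  -- forces `q = 0`.
  have horth : q ⬝ᵥ (z ᵥ* X) = 0 := by
    obtain ⟨z', hz', hz'q⟩ := hqK
    replace hz' : z' ᵥ* X = 0 := hz'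
    replace hz'q : z' ᵥ* Y = q := hz'q
    rw [← hz'q, ← Matrix.mulVec_transpose X z, ← Matrix.dotProduct_mulVec, Matrix.mulVec_mulVec,
      ← hXY, ← Matrix.mulVec_mulVec, Matrix.dotProduct_mulVec, hz', zero_dotProduct]
  rw [hx, dotProduct_neg, neg_eq_zero, dotProduct_comm, dotProduct_star_self_eq_zero] at horth
  rw [horth, star_zero, neg_zero] at hx
  refine hinj z hx ?_
  have hyK : y ∈ K := ⟨z, hx, rfl⟩
  have hcoef : ∀ j, y ⬝ᵥ star (k j : Fin n → ℂ) = 0 := by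
    intro j
    have h0 : ∑ j, star (y ⬝ᵥ star (k j : Fin n → ℂ)) • k j = 0 := by
      apply Subtype.ext
      rw [Submodule.coe_sum, Submodule.coe_zero, ← horth, hq]
      rfl
    have := Fintype.linearIndependent_iff.1 k.linearIndependent _ h0 j
    rwa [star_eq_zero] at this
  have hyy : y ⬝ᵥ star y = 0 := by
    have hrep : y = ∑ j, (k.repr ⟨y, hyK⟩ j) • (k j : Fin n → ℂ) := by
      have := congrArg Subtype.val (k.sum_repr ⟨y, hyK⟩)
      rw [Submodule.coe_sum] at this
      exact this.symm
    conv_lhs => rw [show star y = ∑ j, star (k.repr ⟨y, hyK⟩ j) • star (k j : Fin n → ℂ) by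
      conv_lhs => rw [hrep]
      rw [star_sum]
      exact Finset.sum_congr rfl fun j _ => star_smul _ _]
    rw [dotProduct_sum]
    exact Finset.sum_eq_zero fun j _ => by rw [dotProduct_smul, hcoef, smul_zero]
  rwa [dotProduct_comm, dotProduct_star_self_eq_zero] at hyy

variable (e : (Fin 2 → Fin n → ℂ) ≃ₗ[ℂ] W)

/-- The family of vectors `f₀ ⊗ Xᵢ + f₁ ⊗ Yᵢ`, with `Xᵢ`, `Yᵢ` the rows of two matrices. -/
def rowFamily (X Y : Matrix (Fin n) (Fin n) ℂ) : Fin n → W :=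
  fun i => tens e 0 (X i) + tens e 1 (Y i)

theorem sform_rowFamily (X Y : Matrix (Fin n) (Fin n) ℂ) (i j : Fin n) :
    sform e (rowFamily e X Y i) (rowFamily e X Y j) = (X * Yᵀ) i j - (Y * Xᵀ) i j := by
  simp only [rowFamily, map_add, LinearMap.add_apply, sform_tens_self, sform_tens_zero_one,
    sform_tens_one_zero, Matrix.mul_apply', zero_add, add_zero]
  rw [sub_eq_add_neg]
  exact add_comm _ _

theorem ιMulti_rowFamily_mul (M X Y : Matrix (Fin n) (Fin n) ℂ) :
    ExteriorAlgebra.ιMulti ℂ n (rowFamily e (M * X) (M * Y)) =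
      M.det • ExteriorAlgebra.ιMulti ℂ n (rowFamily e X Y) := by
  refine ιMulti_sum_smul _ _ M fun i => ?_
  have h : ∀ X : Matrix (Fin n) (Fin n) ℂ, (M * X) i = ∑ j, M i j • X j := by
    intro X
    ext k
    simp [Matrix.mul_apply]
  simp only [rowFamily, h, map_sum, map_smul, smul_add, Finset.sum_add_distrib]

theorem eq_rowFamily (w : Fin n → W) : w = rowFamily e (fun i => e.symm (w i) 0)
    (fun i => e.symm (w i) 1) := by
  ext i
  exact eq_tens_add_tens e (w i)

theorem rowFamily_add_smul (X X' Y Y' : Matrix (Fin n) (Fin n) ℂ) (z : ℂ) :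
    rowFamily e (X + z • X') (Y + z • Y') = rowFamily e X Y + z • rowFamily e X' Y' := by
  ext i
  have h : ∀ X X' : Matrix (Fin n) (Fin n) ℂ, (X + z • X') i = X i + z • X' i := fun _ _ => rfl
  simp only [rowFamily, h, map_add, map_smul, Pi.add_apply, Pi.smul_apply, smul_add]
  abel

/-- The wedge product of the vectors `vᵢ ⊗ eᵢ`. -/
def binProd (v : Fin n → Fin 2 → ℂ) : ExteriorAlgebra ℂ W :=
  ExteriorAlgebra.ιMulti ℂ n fun i => ∑ c, v i c • tens e c (Pi.single i 1)

theorem binProd_eq_sum (v : Fin n → Fin 2 → ℂ) : binProd e v = ∑ c : Fin n → Fin 2,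
    (∏ i, v i (c i)) • ExteriorAlgebra.ιMulti ℂ n fun i => tens e (c i) (Pi.single i 1) := by
  rw [binProd, ← AlternatingMap.coe_multilinearMap, MultilinearMap.map_sum]
  refine Finset.sum_congr rfl fun c _ => ?_
  rw [MultilinearMap.map_smul_univ]

theorem two_mul_apply_binProd (R : QuadraticForm ℂ (ExteriorAlgebra ℂ W))
    (v : Fin n → Fin 2 → ℂ) : 2 * R (binProd e v) = ∑ c, ∑ c', mono c c' v *
      R.polarBilin (ExteriorAlgebra.ιMulti ℂ n fun i => tens e (c i) (Pi.single i 1))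
        (ExteriorAlgebra.ιMulti ℂ n fun i => tens e (c' i) (Pi.single i 1)) := by
  rw [two_mul_apply_eq_polar, binProd_eq_sum, LinearMap.map_sum₂]
  refine Finset.sum_congr rfl fun c _ => ?_
  rw [map_sum]
  refine Finset.sum_congr rfl fun c' _ => ?_
  simp only [map_smul, LinearMap.smul_apply, smul_eq_mul, mono, Finset.prod_mul_distrib]
  ring

theorem sform_binProd (v : Fin n → Fin 2 → ℂ) (i j : Fin n) :
    sform e (∑ c, v i c • tens e c (Pi.single i 1))
      (∑ c, v j c • tens e c (Pi.single j 1)) = 0 := by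
  simp only [Fin.sum_univ_two, map_add, map_smul, LinearMap.add_apply, LinearMap.smul_apply,
    sform_tens_self, sform_tens_zero_one, sform_tens_one_zero, smul_eq_mul]
  by_cases hij : i = j
  · subst hij
    ring
  · simp [hij]

/-- A quadratic form is invariant on the cone over the Lagrangian Grassmannian. -/
def ConeInvariant (R : QuadraticForm ℂ (ExteriorAlgebra ℂ W)) : Prop :=
  ∀ F : W →ₗ[ℂ] W, IsFrameOp e F → ∀ w : Fin n → W, (∀ i j, sform e (w i) (w j) = 0) →
    R (ExteriorAlgebra.map F (ExteriorAlgebra.ιMulti ℂ n w)) = R (ExteriorAlgebra.ιMulti ℂ n w)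

variable {e}

/-- The frame operators used preserve this family: permutation matrices permute the variables, up to
the sign of the permutation, which squares away, and `SL₂` acts on all variables at once. -/
theorem ConeInvariant.binProd_eq_zero (hn : Odd n) {R : QuadraticForm ℂ (ExteriorAlgebra ℂ W)}
    (hR : ConeInvariant e R) (v : Fin n → Fin 2 → ℂ) : R (binProd e v) = 0 := by
  have h := sum_mono_eq_zero hn _ (fun v => 2 * R (binProd e v)) (two_mul_apply_binProd e R)
    ?_ ?_ ?_ v
  · simpa using h
  · intro σ v
    congr 1
    have h1 := hR _ (.isom (LinearIsometryEquiv.piLpCongrLeft 2 ℝ ℝ σ)) _ (sform_binProd e (v ∘ σ))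
    rw [ExteriorAlgebra.map_apply_ιMulti] at h1
    have h2 : (act e 1 (cmat (LinearIsometryEquiv.piLpCongrLeft 2 ℝ ℝ σ)) ∘ fun i =>
        ∑ c, (v ∘ σ) i c • tens e c (Pi.single i 1)) =
        (fun i => ∑ c, v i c • tens e c (Pi.single i 1)) ∘ σ := by
      ext i
      have hc : cmat (LinearIsometryEquiv.piLpCongrLeft 2 ℝ ℝ σ) *ᵥ Pi.single i 1 =
          Pi.single (σ i) 1 := by
        ext j
        rw [Matrix.mulVec_single_one]
        simp [cmat, Matrix.col, Pi.single_apply, apply_ite]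
      simp [act_isom, hc]
    rw [h2, AlternatingMap.map_perm] at h1
    rw [binProd, ← h1, binProd]
    rcases Int.units_eq_one_or (Equiv.Perm.sign σ) with h | h <;> simp [h]
  · intro v
    congr 1
    have h1 := hR _ .weyl _ (sform_binProd e v)
    rw [ExteriorAlgebra.map_apply_ιMulti] at h1
    rw [binProd, binProd, ← h1]
    congr 2
    ext i
    simp [weylVar, act_weyl_zero, act_weyl_one, add_comm]
  · intro t ht v
    congr 1
    have h1 := hR _ (.torus t ht) _ (sform_binProd e v)
    rw [ExteriorAlgebra.map_apply_ιMulti] at h1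
    rw [binProd, binProd, ← h1]
    congr 2
    ext i
    simp [torusVar, act_torus, smul_smul, mul_comm]

/-- In an orthonormal eigenbasis `u` of `A` the graph is spanned by the vectors `(f₀ + λᵢ f₁) ⊗ uᵢ`,
an orthogonal translate of the family in `binProd`. -/
theorem ConeInvariant.realGraph_eq_zero (hn : Odd n) {R : QuadraticForm ℂ (ExteriorAlgebra ℂ W)}
    (hR : ConeInvariant e R) (A : Matrix (Fin n) (Fin n) ℝ) (hA : Aᵀ = A) :
    R (ExteriorAlgebra.ιMulti ℂ n (rowFamily e 1 (A.map Complex.ofReal))) = 0 := by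
  have hA' : A.IsHermitian := by
    rw [Matrix.IsHermitian, Matrix.conjTranspose_eq_transpose_of_trivial, hA]
  set u := hA'.eigenvectorBasis
  set U : Matrix (Fin n) (Fin n) ℂ := Matrix.of fun i => cx (u i) with hU
  have hdet : U.det ≠ 0 := by
    have : U * Uᵀ = 1 := by
      ext i j
      have h : (U * Uᵀ) i j = cx (u i) ⬝ᵥ cx (u j) := rfl
      rw [h, cx_dotProduct, orthonormal_iff_ite.1 u.orthonormal]
      by_cases hij : i = j <;> simp [Matrix.one_apply, hij]
    intro h
    have := congrArg Matrix.det this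
    rw [Matrix.det_mul, h, zero_mul, Matrix.det_one] at this
    exact zero_ne_one this
  have hUA : ∀ i, (U * A.map Complex.ofReal) i = (hA'.eigenvalues i : ℂ) • cx (u i) := by
    intro i
    have h1 := hA'.mulVec_eigenvectorBasis i
    ext j
    have h2 := congrFun h1 j
    have h3 : (U * A.map Complex.ofReal) i j = (((A *ᵥ (u i).ofLp) j : ℝ) : ℂ) := by
      simp only [Matrix.mul_apply, hU, Matrix.of_apply, cx, Matrix.map_apply, Matrix.mulVec,
        dotProduct]
      push_cast
      refine Finset.sum_congr rfl fun k _ => ?_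
      rw [mul_comm]
      congr 2
      conv_lhs => rw [← hA]
      rfl
    rw [h3, h2]
    simp [cx, u]
  have h1 := ιMulti_rowFamily_mul e U 1 (A.map Complex.ofReal)
  have h2 := hR _ (.isom u.repr.symm) _
    (sform_binProd e fun i => ![1, (hA'.eigenvalues i : ℂ)])
  have h3 := hR.binProd_eq_zero hn fun i => ![1, (hA'.eigenvalues i : ℂ)]
  rw [binProd] at h3
  rw [h3, ExteriorAlgebra.map_apply_ιMulti] at h2
  have h4 : rowFamily e (U * 1) (U * A.map Complex.ofReal) =
      (act e 1 (cmat u.repr.symm) ∘ fun i =>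
        ∑ c, (![1, (hA'.eigenvalues i : ℂ)] : Fin 2 → ℂ) c • tens e c (Pi.single i 1)) := by
    ext i
    have hc : cmat u.repr.symm *ᵥ Pi.single i 1 = cx (u i) := by
      have := cmat_mulVec u.repr.symm (EuclideanSpace.single i 1)
      rw [OrthonormalBasis.repr_symm_single] at this
      rw [← this]
      congr 1
      ext j
      by_cases hij : j = i <;> simp [cx, hij]
    have hUi : U i = cx (u i) := rfl
    simp only [rowFamily, hUA, mul_one, hUi, Function.comp_apply, map_add, map_smul, act_isom, hc,
      Fin.sum_univ_two, Matrix.cons_val_zero, Matrix.cons_val_one, one_smul]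
  rw [← h4, h1, QuadraticMap.map_smul, smul_eq_mul] at h2
  exact (mul_eq_zero.1 h2).resolve_left (mul_ne_zero hdet hdet)

/-- Along `Re A + z Im A` the value is a polynomial in `z` vanishing at every real `z`; it is
evaluated at `z = i`. -/
theorem ConeInvariant.graph_eq_zero (hn : Odd n) {R : QuadraticForm ℂ (ExteriorAlgebra ℂ W)}
    (hR : ConeInvariant e R) (A : Matrix (Fin n) (Fin n) ℂ) (hA : Aᵀ = A) :
    R (ExteriorAlgebra.ιMulti ℂ n (rowFamily e 1 A)) = 0 := by
  have hre : (A.map Complex.re)ᵀ = A.map Complex.re := by rw [← Matrix.transpose_map, hA]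
  have him : (A.map Complex.im)ᵀ = A.map Complex.im := by rw [← Matrix.transpose_map, hA]
  obtain ⟨p, hp⟩ := exists_polynomial_ιMulti R
    (rowFamily e 1 ((A.map Complex.re).map Complex.ofReal))
    (rowFamily e 0 ((A.map Complex.im).map Complex.ofReal))
  have hp0 : p = 0 := by
    refine Polynomial.eq_zero_of_infinite_isRoot p (Set.Infinite.mono ?_
      (Set.infinite_range_of_injective Complex.ofReal_injective))
    rintro _ ⟨t, rfl⟩
    change p.eval (t : ℂ) = 0
    rw [← hp, ← rowFamily_add_smul, smul_zero, add_zero]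
    have := hR.realGraph_eq_zero hn (A.map Complex.re + t • A.map Complex.im) (by
      rw [Matrix.transpose_add, Matrix.transpose_smul, hre, him])
    convert this using 4
    ext i j
    simp
  have h := hp Complex.I
  rw [hp0, Polynomial.eval_zero, ← rowFamily_add_smul, smul_zero, add_zero] at h
  convert h using 4
  ext i j
  simp [mul_comm Complex.I, Complex.re_add_im]

/-- A quadratic form which is invariant on the cone over the Lagrangian Grassmannian vanishes on
it. -/
theorem ConeInvariant.eq_zero (hn : Odd n) {R : QuadraticForm ℂ (ExteriorAlgebra ℂ W)}
    (hR : ConeInvariant e R) (w : Fin n → W) (hw : ∀ i j, sform e (w i) (w j) = 0)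
    (hli : LinearIndependent ℂ w) : R (ExteriorAlgebra.ιMulti ℂ n w) = 0 := by
  obtain ⟨X, Y, rfl⟩ : ∃ X Y : Matrix (Fin n) (Fin n) ℂ, w = rowFamily e X Y :=
    ⟨_, _, eq_rowFamily e w⟩
  have hXY : X * Yᵀ = Y * Xᵀ := by
    ext i j
    have := hw i j
    rwa [sform_rowFamily, sub_eq_zero] at this
  obtain ⟨C, hC, hdet⟩ := exists_symm_det_ne_zero X Y hXY (by
    intro z hX hY
    ext i
    refine Fintype.linearIndependent_iff.1 hli z ?_ i
    have h : ∀ X : Matrix (Fin n) (Fin n) ℂ, ∑ i, z i • X i = z ᵥ* X := by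
      intro X
      ext k
      simp [Matrix.vecMul, dotProduct]
    simp only [rowFamily, smul_add, Finset.sum_add_distrib, ← map_smul, ← map_sum, h, hX, hY,
      map_zero, add_zero])
  -- The deformation `(X + t Y C, Y)` stays Lagrangian because `C` is symmetric. Wherever `q(t) =
  -- det (X + t Y C)` is nonzero it is a graph, so `p * q = 0`; since `q(1) ≠ 0`, the polynomial `p`
  -- vanishes, also at `t = 0`.
  obtain ⟨p, hp⟩ := exists_polynomial_ιMulti R (rowFamily e X Y) (rowFamily e (Y * C) 0)
  set q : Polynomial ℂ :=
    (X.map Polynomial.C + (Polynomial.X : Polynomial ℂ) • (Y * C).map Polynomial.C).det with hq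
  have hqe : ∀ t, q.eval t = (X + t • (Y * C)).det := by
    intro t
    rw [hq, ← Polynomial.coe_evalRingHom, RingHom.map_det]
    generalize Y * C = D
    congr 1
    ext i j
    simp
    ring
  have hq0 : q ≠ 0 := by
    intro h
    apply hdet
    have := hqe 1
    rw [h, Polynomial.eval_zero, one_smul] at this
    exact this.symm
  have hpq : p * q = 0 := by
    apply Polynomial.funext
    intro t
    rw [Polynomial.eval_mul, Polynomial.eval_zero, ← hp, hqe, ← rowFamily_add_smul, smul_zero,
      add_zero, mul_eq_zero]
    by_cases hd : (X + t • (Y * C)).det = 0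
    · exact Or.inr hd
    left
    set Z := X + t • (Y * C) with hZ
    have hu : IsUnit Z.det := isUnit_iff_ne_zero.2 hd
    have hsymm : Y * Zᵀ = Z * Yᵀ := by
      rw [hZ, Matrix.transpose_add, Matrix.mul_add, Matrix.add_mul, hXY, Matrix.transpose_smul,
        Matrix.transpose_mul, hC, Matrix.mul_smul, Matrix.smul_mul, Matrix.mul_assoc]
    have hZA : Z * (Z⁻¹ * Y) = Y := by
      rw [← Matrix.mul_assoc, Matrix.mul_nonsing_inv _ hu, Matrix.one_mul]
    have hA : (Z⁻¹ * Y)ᵀ = Z⁻¹ * Y := by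
      have hu' : IsUnit Zᵀ.det := by rwa [Matrix.det_transpose]
      rw [Matrix.transpose_mul, Matrix.transpose_nonsing_inv]
      calc Yᵀ * Zᵀ⁻¹ = Z⁻¹ * (Z * Yᵀ) * Zᵀ⁻¹ := by
            rw [← Matrix.mul_assoc, Matrix.nonsing_inv_mul _ hu, Matrix.one_mul]
        _ = Z⁻¹ * Y := by
            rw [← hsymm, Matrix.mul_assoc, Matrix.mul_assoc, Matrix.mul_nonsing_inv _ hu',
              Matrix.mul_one]
    have := ιMulti_rowFamily_mul e Z 1 (Z⁻¹ * Y)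
    rw [hZA, Matrix.mul_one] at this
    rw [this, QuadraticMap.map_smul, hR.graph_eq_zero hn _ hA, smul_zero]
  have hp0 := (mul_eq_zero.1 hpq).resolve_right hq0
  have := hp 0
  rwa [hp0, Polynomial.eval_zero, zero_smul, add_zero] at this

end Cone

/-! ### A basis adapted to the contact grading -/

section AdaptedBasis

/-- Index type of a basis of the standard representation consisting of two dual isotropic pairs of
vectors and an orthonormal basis of their orthogonal complement. -/
abbrev AIdx (m : ℕ) : Type := Fin 2 ⊕ Fin (halfDim m) ⊕ Fin 2

/-- The involution of the index set given by the duality of the adapted basis. -/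
def dualIdx {m : ℕ} : AIdx m → AIdx m :=
  Sum.elim (fun c => Sum.inr (Sum.inr c)) (Sum.elim (fun i => Sum.inr (Sum.inl i)) Sum.inl)

theorem dualIdx_dualIdx {m : ℕ} (x : AIdx m) : dualIdx (dualIdx x) = x := by
  rcases x with c | i | c <;> rfl

/-- The Gram matrix of the adapted basis. -/
def aform (m : ℕ) : Matrix (AIdx m) (AIdx m) ℂ :=
    Matrix.of fun x y => if dualIdx x = y then 1 else 0

theorem aform_mul {m : ℕ} {κ : Type*} (A : Matrix (AIdx m) κ ℂ) (x : AIdx m) (y : κ) :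
    (aform m * A) x y = A (dualIdx x) y := by
  simp [Matrix.mul_apply, aform]

theorem mul_aform {m : ℕ} {κ : Type*} (A : Matrix κ (AIdx m) ℂ) (x : κ) (y : AIdx m) :
    (A * aform m) x y = A x (dualIdx y) := by
  have h : ∀ z, dualIdx z = y ↔ z = dualIdx y := fun z =>
    ⟨fun h => by rw [← h, dualIdx_dualIdx], fun h => by rw [h, dualIdx_dualIdx]⟩
  simp [Matrix.mul_apply, aform, h]

theorem aform_mul_aform (m : ℕ) : aform m * aform m = 1 := by
  ext x y
  rw [aform_mul]
  simp [aform, dualIdx_dualIdx, Matrix.one_apply]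

/-- The weights of the adapted basis. -/
def aweight {m : ℕ} : AIdx m → ℂ := Sum.elim (fun _ => 1) (Sum.elim (fun _ => 0) fun _ => -1)

/-- A vector of the standard representation given by its three blocks of coordinates. -/
def blockVec {m : ℕ} (a : ℂ) (x y : Fin (m + 2) → ℂ) : Idx m → ℂ :=
  Sum.elim (fun _ => a) (Sum.elim x y)

theorem blockVec_form {m : ℕ} (a a' : ℂ) (x x' y y' : Fin (m + 2) → ℂ) :
    blockVec a x y ⬝ᵥ form m *ᵥ blockVec a' x' y' = 2 * a * a' + (x ⬝ᵥ y' + y ⬝ᵥ x') := by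
  simp [blockVec, dotProduct, Matrix.mulVec, form, LieAlgebra.Orthogonal.JB,
    LieAlgebra.Orthogonal.JD, Matrix.one_apply]
  ring

/-- The first two hyperbolic pairs carry the weights `±1`. The zero-weight complement gets an
orthonormal basis, so that the real orthogonal group acts on `ℂⁿ` in its usual form. -/
theorem exists_adapted_matrix (m : ℕ) : ∃ S : Matrix (Idx m) (AIdx m) ℂ,
    Sᵀ * form m * S = aform m ∧
    ∀ i x, gradingDiag m i * S i x = S i x * aweight x := by
  -- The form takes the value 2 on the isolated basis vector, on a sum `e + f` over a hyperbolic
  -- pair, and `-2` on `e - f`. The scalars `s` and `i s` normalise these to length one.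
  obtain ⟨s, hs⟩ : ∃ s : ℂ, s * s = 1 / 2 := ⟨((Real.sqrt (1 / 2) : ℝ) : ℂ), by
    rw [← Complex.ofReal_mul, Real.mul_self_sqrt (by norm_num)]; norm_num⟩
  let lo : Fin 2 → Fin (m + 2) := fun c => ⟨c.val, by omega⟩
  let hi : Fin m → Fin (m + 2) := fun j => ⟨j.val + 2, by omega⟩
  have hlo : ∀ c c', lo c = lo c' ↔ c = c' := by simp [lo, Fin.ext_iff]
  have hhi : ∀ c c', hi c = hi c' ↔ c = c' := by simp [hi, Fin.ext_iff]
  have hne : ∀ c j, lo c ≠ hi j := by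
    intro c j h
    have := Fin.ext_iff.1 h
    simp only [lo, hi] at this
    omega
  obtain ⟨f⟩ : Nonempty (Fin (halfDim m) ≃ Unit ⊕ Fin m ⊕ Fin m) :=
    ⟨Fintype.equivOfCardEq (by simp [halfDim]; omega)⟩
  let I' : ℂ := Complex.I * s
  have hI : I' * I' = -(1 / 2) := by
    rw [← hs]; simp only [I']; linear_combination (s * s) * Complex.I_mul_I
  let mid : Unit ⊕ Fin m ⊕ Fin m → Idx m → ℂ := Sum.elim (fun _ => blockVec s 0 0)
    (Sum.elim (fun j => blockVec 0 (s • Pi.single (hi j) 1) (s • Pi.single (hi j) 1))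
      (fun j => blockVec 0 (I' • Pi.single (hi j) 1) (-I' • Pi.single (hi j) 1)))
  let col : AIdx m → Idx m → ℂ := Sum.elim (fun c => blockVec 0 (Pi.single (lo c) 1) 0)
    (Sum.elim (fun i => mid (f i)) fun c => blockVec 0 0 (Pi.single (lo c) 1))
  have hmid : ∀ p q, mid p ⬝ᵥ form m *ᵥ mid q = if p = q then 1 else 0 := by
    intro p q
    rcases p with p | p | p <;> rcases q with q | q | q <;>
      simp only [mid, Sum.elim_inl, Sum.elim_inr, blockVec_form, smul_dotProduct, dotProduct_smul,
        single_dotProduct, zero_dotProduct, dotProduct_zero, Pi.single_apply, hhi,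
        smul_eq_mul, Sum.inr.injEq, Sum.inl.injEq, reduceCtorEq, if_false, mul_zero, add_zero,
        zero_mul, one_mul, neg_mul] <;>
      first
        | (simp only [if_true]; linear_combination 2 * hs)
        | ring1
        | (split_ifs <;> first
            | ring1
            | linear_combination 2 * hs
            | linear_combination (-2) * hI)
  refine ⟨Matrix.of fun i x => col x i, ?_, ?_⟩
  · ext x y
    have h : ((Matrix.of fun i x => col x i)ᵀ * form m * Matrix.of fun i x => col x i :
        Matrix (AIdx m) (AIdx m) ℂ) x y = col x ⬝ᵥ form m *ᵥ col y := by
      rw [Matrix.mul_assoc]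
      rfl
    rw [h]
    have hml : ∀ p x y, (∀ j, x (hi j) = 0) → (∀ j, y (hi j) = 0) →
        mid p ⬝ᵥ form m *ᵥ blockVec 0 x y = 0 := by
      intro p x y hx hy
      rcases p with p | p | p <;>
        simp [mid, blockVec_form, smul_dotProduct, hx, hy, -neg_smul]
    have hlm : ∀ p x y, (∀ j, x (hi j) = 0) → (∀ j, y (hi j) = 0) →
        blockVec 0 x y ⬝ᵥ form m *ᵥ mid p = 0 := by
      intro p x y hx hy
      rcases p with p | p | p <;>
        simp [mid, blockVec_form, dotProduct_smul, hx, hy, -neg_smul]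
    have hz : ∀ c j, (Pi.single (lo c) 1 : Fin (m + 2) → ℂ) (hi j) = 0 := fun c j => by
      rw [Pi.single_eq_of_ne (hne c j).symm]
    rcases x with x | x | x <;> rcases y with y | y | y <;>
      simp only [col, Sum.elim_inl, Sum.elim_inr, aform, dualIdx, Matrix.of_apply,
        Sum.inr.injEq, Sum.inl.injEq, reduceCtorEq, if_false]
    · simp [blockVec_form]
    · exact hlm _ _ _ (hz x) (by simp)
    · simp [blockVec_form, Pi.single_apply, hlo, eq_comm]
    · exact hml _ _ _ (hz y) (by simp)
    · rw [hmid]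
      simp
    · exact hml _ _ _ (by simp) (hz y)
    · simp [blockVec_form, Pi.single_apply, hlo, eq_comm]
    · exact hlm _ _ _ (by simp) (hz x)
    · simp [blockVec_form]
  · have w0 : ∀ a x y i, (∀ c, x (lo c) = 0) → (∀ c, y (lo c) = 0) →
        gradingDiag m i * blockVec a x y i = 0 := by
      intro a x y i hx hy
      rcases i with i | i | i
      · simp [gradingDiag]
      all_goals
        by_cases hi2 : i.val < 2
        · have := hx ⟨i.val, hi2⟩
          have := hy ⟨i.val, hi2⟩
          simp_all [blockVec, gradingDiag, lo]
        · exact mul_eq_zero_of_left (if_neg hi2) _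
    have hs0 : ∀ j c, (Pi.single (hi j) 1 : Fin (m + 2) → ℂ) (lo c) = 0 := fun j c => by
      rw [Pi.single_eq_of_ne (hne c j)]
    have hl : ∀ c i, ¬ i.val < 2 → (Pi.single (lo c) 1 : Fin (m + 2) → ℂ) i = 0 := by
      intro c i h
      rw [Pi.single_eq_of_ne]
      rintro rfl
      exact h c.2
    intro i x
    rw [Matrix.of_apply]
    rcases x with x | x | x
    · rcases i with i | i | i
      · simp [col, blockVec, gradingDiag, aweight]
      · by_cases hi2 : i.val < 2
        · have hi3 : gradingDiag m (Sum.inr (Sum.inl i)) = 1 := if_pos hi2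
          simp [col, blockVec, hi3, aweight]
        · simp only [col, blockVec, Sum.elim_inl, Sum.elim_inr, hl x i hi2, mul_zero, zero_mul]
      · simp [col, blockVec, gradingDiag, aweight]
    · simp only [col, Sum.elim_inl, Sum.elim_inr, aweight, mul_zero, mid]
      generalize f x = p
      rcases p with p | p | p <;> refine w0 _ _ _ _ ?_ ?_ <;> intro c <;> simp [hs0]
    · rcases i with i | i | i
      · simp [col, blockVec, gradingDiag, aweight]
      · simp [col, blockVec, gradingDiag, aweight]
      · by_cases hi2 : i.val < 2
        · have hi3 : gradingDiag m (Sum.inr (Sum.inr i)) = -1 := if_pos hi2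
          simp [col, blockVec, hi3, aweight]
        · simp only [col, blockVec, Sum.elim_inr, hl x i hi2, mul_zero, zero_mul]

variable (m : ℕ)

/-- The matrix whose columns form an adapted basis. -/
def basisMat : Matrix (Idx m) (AIdx m) ℂ := (exists_adapted_matrix m).choose

theorem basisMat_form : (basisMat m)ᵀ * form m * basisMat m = aform m :=
  (exists_adapted_matrix m).choose_spec.1

theorem gradingDiag_mul_basisMat : Matrix.diagonal (gradingDiag m) * basisMat m =
    basisMat m * Matrix.diagonal (aweight (m := m)) := by
  ext i x
  rw [Matrix.diagonal_mul, Matrix.mul_diagonal]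
  exact (exists_adapted_matrix m).choose_spec.2 i x

/-- The inverse of the matrix of the adapted basis. -/
def basisInv : Matrix (AIdx m) (Idx m) ℂ := aform m * (basisMat m)ᵀ * form m

theorem basisInv_mul : basisInv m * basisMat m = 1 := by
  rw [basisInv, Matrix.mul_assoc, Matrix.mul_assoc, ← Matrix.mul_assoc _ (form m), basisMat_form,
    aform_mul_aform]

theorem basisMat_mul : basisMat m * basisInv m = 1 :=
  (Matrix.mul_eq_one_comm_of_card_eq _ _ _ (by
    simp only [Fintype.card_sum, Fintype.card_fin, Fintype.card_unit, halfDim]; omega)).1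
    (basisInv_mul m)

theorem aform_basisInv : (basisInv m)ᵀ * aform m * basisInv m = form m := by
  rw [← basisMat_form]
  calc _ = (basisMat m * basisInv m)ᵀ * form m * (basisMat m * basisInv m) := by
        simp only [Matrix.transpose_mul, Matrix.mul_assoc]
    _ = _ := by rw [basisMat_mul, Matrix.transpose_one, Matrix.one_mul, Matrix.mul_one]

variable {m}

/-- The matrix in the standard basis of an endomorphism given by its matrix in the adapted
basis. -/
def ofAdapted (Y : Matrix (AIdx m) (AIdx m) ℂ) : Matrix (Idx m) (Idx m) ℂ :=
  basisMat m * Y * basisInv m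

/-- The matrix in the adapted basis of an endomorphism given by its matrix in the standard
basis. -/
def toAdapted (A : Matrix (Idx m) (Idx m) ℂ) : Matrix (AIdx m) (AIdx m) ℂ :=
  basisInv m * A * basisMat m

theorem toAdapted_ofAdapted (Y : Matrix (AIdx m) (AIdx m) ℂ) : toAdapted (ofAdapted Y) = Y := by
  calc _ = (basisInv m * basisMat m) * Y * (basisInv m * basisMat m) := by
        simp only [toAdapted, ofAdapted, Matrix.mul_assoc]
    _ = Y := by rw [basisInv_mul, Matrix.one_mul, Matrix.mul_one]

theorem ofAdapted_toAdapted (A : Matrix (Idx m) (Idx m) ℂ) : ofAdapted (toAdapted A) = A := by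
  calc _ = (basisMat m * basisInv m) * A * (basisMat m * basisInv m) := by
        simp only [toAdapted, ofAdapted, Matrix.mul_assoc]
    _ = A := by rw [basisMat_mul, Matrix.one_mul, Matrix.mul_one]

theorem ofAdapted_mul (Y Z : Matrix (AIdx m) (AIdx m) ℂ) :
    ofAdapted (Y * Z) = ofAdapted Y * ofAdapted Z := by
  calc _ = basisMat m * Y * (1 : Matrix (AIdx m) (AIdx m) ℂ) * Z * basisInv m := by
        rw [Matrix.mul_one]
        simp only [ofAdapted, Matrix.mul_assoc]
    _ = _ := by
        rw [← basisInv_mul]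
        simp only [ofAdapted, Matrix.mul_assoc]

theorem ofAdapted_one : ofAdapted (1 : Matrix (AIdx m) (AIdx m) ℂ) = 1 := by
  rw [ofAdapted, Matrix.mul_one, basisMat_mul]

theorem ofAdapted_add (Y Z : Matrix (AIdx m) (AIdx m) ℂ) :
    ofAdapted (Y + Z) = ofAdapted Y + ofAdapted Z := by
  rw [ofAdapted, Matrix.mul_add, Matrix.add_mul, ofAdapted, ofAdapted]

theorem ofAdapted_sub (Y Z : Matrix (AIdx m) (AIdx m) ℂ) :
    ofAdapted (Y - Z) = ofAdapted Y - ofAdapted Z := by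
  rw [ofAdapted, Matrix.mul_sub, Matrix.sub_mul, ofAdapted, ofAdapted]

theorem ofAdapted_smul (c : ℂ) (Y : Matrix (AIdx m) (AIdx m) ℂ) :
    ofAdapted (c • Y) = c • ofAdapted Y := by
  rw [ofAdapted, Matrix.mul_smul, Matrix.smul_mul, ofAdapted]

theorem toAdapted_smul (c : ℂ) (A : Matrix (Idx m) (Idx m) ℂ) :
    toAdapted (c • A) = c • toAdapted A := by
  rw [toAdapted, Matrix.mul_smul, Matrix.smul_mul, toAdapted]

theorem ofAdapted_aweight :
    ofAdapted (Matrix.diagonal (aweight (m := m))) = Matrix.diagonal (gradingDiag m) := by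
  rw [ofAdapted, ← gradingDiag_mul_basisMat, Matrix.mul_assoc, basisMat_mul, Matrix.mul_one]

theorem ofAdapted_mem {Y : Matrix (AIdx m) (AIdx m) ℂ}
    (hY : ∀ x y, Y (dualIdx y) x = -Y (dualIdx x) y) : ofAdapted Y ∈ 𝔤 m := by
  have h : Yᵀ * aform m = -(aform m * Y) := by
    ext x y
    rw [mul_aform, Matrix.neg_apply, aform_mul]
    exact hY x y
  rw [mem_𝔤]
  calc (ofAdapted Y)ᵀ * form m
      = (basisInv m)ᵀ * Yᵀ * ((basisMat m)ᵀ * form m) * (basisMat m * basisInv m) := by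
        rw [basisMat_mul, Matrix.mul_one]
        simp only [ofAdapted, Matrix.transpose_mul, Matrix.mul_assoc]
    _ = (basisInv m)ᵀ * (Yᵀ * ((basisMat m)ᵀ * form m * basisMat m)) * basisInv m := by
        simp only [Matrix.mul_assoc]
    _ = -((basisInv m)ᵀ * aform m * (Y * basisInv m)) := by
        rw [basisMat_form, h]
        simp only [Matrix.mul_neg, Matrix.neg_mul, Matrix.mul_assoc]
    _ = -((basisInv m)ᵀ * aform m * (basisInv m * basisMat m) * (Y * basisInv m)) := by
        rw [basisInv_mul, Matrix.mul_one]
    _ = -((basisInv m)ᵀ * aform m * basisInv m * ofAdapted Y) := by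
        simp only [ofAdapted, Matrix.mul_assoc]
    _ = _ := by rw [aform_basisInv, Matrix.mul_neg]

theorem toAdapted_skew {A : Matrix (Idx m) (Idx m) ℂ} (hA : A ∈ 𝔤 m) (x y : AIdx m) :
    toAdapted A (dualIdx y) x = -toAdapted A (dualIdx x) y := by
  have h : (toAdapted A)ᵀ * aform m = -(aform m * toAdapted A) := by
    rw [← basisMat_form]
    calc _ = (basisMat m)ᵀ * (Aᵀ * ((basisMat m * basisInv m)ᵀ * form m)) * basisMat m := by
          simp only [toAdapted, Matrix.transpose_mul, Matrix.mul_assoc]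
      _ = -((basisMat m)ᵀ * form m * (basisMat m * basisInv m) * A * basisMat m) := by
          rw [basisMat_mul, Matrix.transpose_one, Matrix.one_mul, Matrix.mul_one, mem_𝔤.1 hA]
          simp only [Matrix.mul_neg, Matrix.neg_mul, Matrix.mul_assoc]
      _ = _ := by simp only [toAdapted, Matrix.mul_assoc]
  have := congrFun (congrFun h x) y
  rwa [mul_aform, Matrix.neg_apply, aform_mul] at this

end AdaptedBasis

/-! ### The frame of the contact space -/

section ContactFrame

variable {m : ℕ}

/-- The adapted matrix of an element of degree `-1`. -/
def negOneMat (x : Fin 2 → Fin (halfDim m) → ℂ) : Matrix (AIdx m) (AIdx m) ℂ :=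
  Matrix.of (Sum.elim (fun _ => 0) (Sum.elim (fun i => Sum.elim (fun c => x c i) 0)
    fun c => Sum.elim 0 (Sum.elim (fun i => -x c i) 0)))

theorem negOneMat_mem (x : Fin 2 → Fin (halfDim m) → ℂ) : ofAdapted (negOneMat x) ∈ 𝔤 m := by
  refine ofAdapted_mem fun p q => ?_
  rcases p with p | p | p <;> rcases q with q | q | q <;> simp [negOneMat, dualIdx]

theorem mem_gr_iff {i : ℤ} {A : 𝔤 m} : A ∈ gr m i ↔
    ∀ p q, (aweight p - aweight q) * toAdapted (A : Matrix (Idx m) (Idx m) ℂ) p q =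
      i * toAdapted (A : Matrix (Idx m) (Idx m) ℂ) p q := by
  have h : ((⁅gradingElt m, A⁆ : 𝔤 m) : Matrix (Idx m) (Idx m) ℂ) =
      ofAdapted (Matrix.diagonal (aweight (m := m)) * toAdapted (A : Matrix (Idx m) (Idx m) ℂ) -
        toAdapted (A : Matrix (Idx m) (Idx m) ℂ) * Matrix.diagonal (aweight (m := m))) := by
    rw [ofAdapted_sub, ofAdapted_mul, ofAdapted_mul, ofAdapted_toAdapted, ofAdapted_aweight]
    rfl
  rw [mem_gr, ← Subtype.coe_inj, h]
  constructor
  · intro h p q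
    have := congrFun (congrFun (congrArg toAdapted h) p) q
    rw [toAdapted_ofAdapted, Matrix.sub_apply, Matrix.diagonal_mul, Matrix.mul_diagonal,
      SetLike.val_smul, toAdapted_smul, Matrix.smul_apply, smul_eq_mul] at this
    linear_combination this
  · intro h
    rw [SetLike.val_smul, ← ofAdapted_toAdapted (A : Matrix (Idx m) (Idx m) ℂ),
      ← ofAdapted_smul, toAdapted_ofAdapted]
    congr 1
    ext p q
    rw [Matrix.sub_apply, Matrix.diagonal_mul, Matrix.mul_diagonal, Matrix.smul_apply, smul_eq_mul]
    linear_combination h p q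

theorem negOneMat_mem_gr (x : Fin 2 → Fin (halfDim m) → ℂ) :
    (⟨ofAdapted (negOneMat x), negOneMat_mem x⟩ : 𝔤 m) ∈ gr m (-1) := by
  rw [mem_gr_iff]
  intro p q
  rw [toAdapted_ofAdapted]
  rcases p with p | p | p <;> rcases q with q | q | q <;> simp [negOneMat, aweight]

/-- Degree `-1` leaves only the blocks lowering the weight by one, and skewness expresses the second
of them through the first. -/
theorem toAdapted_of_mem_gr {A : 𝔤 m} (hA : A ∈ gr m (-1)) :
    negOneMat (fun c i => toAdapted (A : Matrix (Idx m) (Idx m) ℂ) (Sum.inr (Sum.inl i))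
      (Sum.inl c))
      = toAdapted (A : Matrix (Idx m) (Idx m) ℂ) := by
  have h := mem_gr_iff.1 hA
  ext p q
  have hpq := h p q
  have hs := toAdapted_skew A.2 q (dualIdx p)
  rw [dualIdx_dualIdx] at hs
  clear h
  generalize toAdapted (A : Matrix (Idx m) (Idx m) ℂ) = Y at *
  rcases p with p | p | p <;> rcases q with q | q | q <;>
    simp [negOneMat, aweight, dualIdx] at * <;>
    first
      | linear_combination (-1) * hpq
      | linear_combination (-1 / 2) * hpq
      | linear_combination (-1 / 3) * hpq
      | linear_combination hpq
      | exact hs.symm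

/-- The identification of `𝔤_{-1}` with `ℂ² ⊗ ℂⁿ`. -/
def frame (m : ℕ) : (Fin 2 → Fin (halfDim m) → ℂ) ≃ₗ[ℂ] V m where
  toFun x := ⟨⟨ofAdapted (negOneMat x), negOneMat_mem x⟩, negOneMat_mem_gr x⟩
  map_add' x y := by
    apply Subtype.ext
    apply Subtype.ext
    change ofAdapted _ = ofAdapted _ + ofAdapted _
    rw [← ofAdapted_add]
    congr 1
    ext p q
    rcases p with p | p | p <;> rcases q with q | q | q <;> simp [negOneMat, add_comm]
  map_smul' c x := by
    apply Subtype.ext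
    apply Subtype.ext
    change ofAdapted _ = c • ofAdapted _
    rw [← ofAdapted_smul]
    congr 1
    ext p q
    rcases p with p | p | p <;> rcases q with q | q | q <;> simp [negOneMat]
  invFun A c i :=
    toAdapted ((A : 𝔤 m) : Matrix (Idx m) (Idx m) ℂ) (Sum.inr (Sum.inl i)) (Sum.inl c)
  left_inv x := by
    ext c i
    simp only [toAdapted_ofAdapted]
    rfl
  right_inv A := by
    apply Subtype.ext
    apply Subtype.ext
    change ofAdapted (negOneMat _) = _
    rw [toAdapted_of_mem_gr A.2, ofAdapted_toAdapted]

theorem coe_frame (x : Fin 2 → Fin (halfDim m) → ℂ) :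
    ((frame m x : 𝔤 m) : Matrix (Idx m) (Idx m) ℂ) = ofAdapted (negOneMat x) := rfl

/-- The adapted matrix of a generator of `𝔤_{-2}`. -/
def negTwoMat (m : ℕ) : Matrix (AIdx m) (AIdx m) ℂ :=
  Matrix.of (Sum.elim (fun _ => 0) (Sum.elim (fun _ => 0)
    fun c => Sum.elim (fun c' => weylMat c c') 0))

theorem negOneMat_mul (x y : Fin 2 → Fin (halfDim m) → ℂ) :
    negOneMat x * negOneMat y - negOneMat y * negOneMat x =
      (x 0 ⬝ᵥ y 1 - x 1 ⬝ᵥ y 0) • negTwoMat m := by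
  ext p q
  rcases p with p | p | p <;> rcases q with q | q | q <;>
    simp [negOneMat, negTwoMat, Matrix.mul_apply, Fintype.sum_sum_type]
  fin_cases p <;> fin_cases q <;> simp [weylMat, dotProduct, mul_comm] <;> ring

theorem negTwoMat_mem (m : ℕ) : ofAdapted (negTwoMat m) ∈ 𝔤 m := by
  refine ofAdapted_mem fun p q => ?_
  rcases p with p | p | p <;> rcases q with q | q | q <;> simp [negTwoMat, dualIdx]
  fin_cases p <;> fin_cases q <;> simp [weylMat]

theorem negTwoMat_mem_gr (m : ℕ) :
    (⟨ofAdapted (negTwoMat m), negTwoMat_mem m⟩ : 𝔤 m) ∈ gr m (-2) := by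
  rw [mem_gr_iff]
  intro p q
  rw [toAdapted_ofAdapted]
  rcases p with p | p | p <;> rcases q with q | q | q <;> simp [negTwoMat, aweight]
  ring

/-- A generator of `𝔤_{-2}`. -/
def negTwoElt (m : ℕ) : gr m (-2) :=
    ⟨⟨ofAdapted (negTwoMat m), negTwoMat_mem m⟩, negTwoMat_mem_gr m⟩

theorem negTwoElt_ne_zero (m : ℕ) : negTwoElt m ≠ 0 := by
  intro h
  have h1 : ofAdapted (negTwoMat m) = ofAdapted 0 := by
    rw [ofAdapted, ofAdapted, Matrix.mul_zero, Matrix.zero_mul]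
    exact congrArg (fun z : gr m (-2) => ((z : 𝔤 m) : Matrix (Idx m) (Idx m) ℂ)) h
  have h2 := congrArg toAdapted h1
  rw [toAdapted_ofAdapted, toAdapted_ofAdapted] at h2
  have := congrFun (congrFun h2 (Sum.inr (Sum.inr 1))) (Sum.inl 0)
  simp [negTwoMat, weylMat] at this

theorem omega_eq (x y : V m) : omega m x y = sform (frame m) x y • negTwoElt m := by
  obtain ⟨x, rfl⟩ := (frame m).surjective x
  obtain ⟨y, rfl⟩ := (frame m).surjective y
  rw [sform_apply, LinearEquiv.symm_apply_apply, LinearEquiv.symm_apply_apply]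
  apply Subtype.ext
  apply Subtype.ext
  change ofAdapted (negOneMat x) * ofAdapted (negOneMat y) -
    ofAdapted (negOneMat y) * ofAdapted (negOneMat x) = _ • ofAdapted (negTwoMat m)
  rw [← ofAdapted_mul, ← ofAdapted_mul, ← ofAdapted_sub, negOneMat_mul, ofAdapted_smul]

end ContactFrame

/-! ### Elements of the Levi subgroup -/

section Levi

variable {m : ℕ}

/-- A Lie algebra automorphism fixing the grading element maps each eigenspace into itself; equality
comes from applying this to the inverse. -/
theorem mem_G₀_of_Ad_gradingElt {g : SO m} (h : Ad m g (gradingElt m) = gradingElt m) :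
    g ∈ G₀ m := by
  have key : ∀ g : SO m, Ad m g (gradingElt m) = gradingElt m →
      ∀ i : ℤ, ∀ x ∈ gr m i, Ad m g x ∈ gr m i := by
    intro g h i x hx
    rw [mem_gr] at *
    rw [← h, ← Ad_lie, hx, map_smul]
  have hinv : ∀ x, Ad m g⁻¹ (Ad m g x) = x := fun x => by
    rw [← Module.End.mul_apply, ← map_mul, inv_mul_cancel, map_one, Module.End.one_apply]
  have hinv' : ∀ x, Ad m g (Ad m g⁻¹ x) = x := fun x => by
    rw [← Module.End.mul_apply, ← map_mul, mul_inv_cancel, map_one, Module.End.one_apply]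
  intro i
  apply le_antisymm
  · rintro _ ⟨x, hx, rfl⟩
    exact key g h i x hx
  · intro x hx
    exact ⟨_, key g⁻¹ (by conv_lhs => rw [← h, hinv]) i x hx, hinv' x⟩

/-- A block diagonal matrix in the adapted basis. -/
def blockDiag (P : Matrix (Fin 2) (Fin 2) ℂ) (K : Matrix (Fin (halfDim m)) (Fin (halfDim m)) ℂ)
    (R : Matrix (Fin 2) (Fin 2) ℂ) : Matrix (AIdx m) (AIdx m) ℂ :=
  Matrix.fromBlocks P 0 0 (Matrix.fromBlocks K 0 0 R)

variable (P P' R R' : Matrix (Fin 2) (Fin 2) ℂ)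
  (K K' : Matrix (Fin (halfDim m)) (Fin (halfDim m)) ℂ)

theorem blockDiag_mul : blockDiag P K R * blockDiag P' K' R' =
    blockDiag (P * P') (K * K') (R * R') := by
  simp [blockDiag, Matrix.fromBlocks_multiply]

theorem blockDiag_one : blockDiag 1 (1 : Matrix (Fin (halfDim m)) (Fin (halfDim m)) ℂ) 1 = 1 := by
  simp [blockDiag]

theorem det_blockDiag : (blockDiag P K R).det = P.det * (K.det * R.det) := by
  rw [blockDiag, Matrix.det_fromBlocks_zero₂₁, Matrix.det_fromBlocks_zero₂₁]

theorem blockDiag_mul_aweight : blockDiag P K R * Matrix.diagonal (aweight (m := m)) =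
    Matrix.diagonal (aweight (m := m)) * blockDiag P K R := by
  ext p q
  rw [Matrix.mul_diagonal, Matrix.diagonal_mul]
  rcases p with p | p | p <;> rcases q with q | q | q <;> simp [blockDiag, aweight]

theorem blockDiag_transpose_mul_aform (hK : Kᵀ * K = 1) (hPR : Pᵀ * R = 1) :
    (blockDiag P K R)ᵀ * aform m * blockDiag P K R = aform m := by
  have h1 : aform m * blockDiag P K R = blockDiag R K P * aform m := by
    ext p q
    rw [aform_mul, mul_aform]
    rcases p with p | p | p <;> rcases q with q | q | q <;> simp [blockDiag, dualIdx]
  have h2 : (blockDiag P K R)ᵀ = blockDiag Pᵀ Kᵀ Rᵀ := by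
    simp [blockDiag, Matrix.fromBlocks_transpose]
  have hRP : Rᵀ * P = 1 := by
    rw [← Matrix.transpose_one, ← hPR, Matrix.transpose_mul, Matrix.transpose_transpose]
  rw [Matrix.mul_assoc, h1, ← Matrix.mul_assoc, h2, blockDiag_mul, hK, hPR, hRP, blockDiag_one,
    Matrix.one_mul]

/-- The element of the group with a given block diagonal matrix. -/
def blockElt (hK : Kᵀ * K = 1) (hdet : K.det = 1) (hPR : Pᵀ * R = 1) : SO m :=
  ⟨⟨ofAdapted (blockDiag P K R), by
    have h : P.det * R.det = 1 := by
        rw [← Matrix.det_transpose, ← Matrix.det_mul, hPR, Matrix.det_one]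
    rw [ofAdapted, Matrix.det_conj_of_mul_eq_one (basisMat_mul m) (basisInv_mul m), det_blockDiag,
      hdet,
      one_mul, h]⟩, by
    change (ofAdapted (blockDiag P K R))ᵀ * form m * ofAdapted (blockDiag P K R) = form m
    calc _ = (basisInv m)ᵀ * ((blockDiag P K R)ᵀ * ((basisMat m)ᵀ * form m * basisMat m) *
          blockDiag P K R) * basisInv m := by
          simp only [ofAdapted, Matrix.transpose_mul, Matrix.mul_assoc]
      _ = _ := by
          rw [basisMat_form, blockDiag_transpose_mul_aform P R K hK hPR, aform_basisInv]⟩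

theorem mat_blockElt (hK : Kᵀ * K = 1) (hdet : K.det = 1) (hPR : Pᵀ * R = 1) :
    mat (blockElt P R K hK hdet hPR) = ofAdapted (blockDiag P K R) := rfl

theorem mat_blockElt_inv (hK : Kᵀ * K = 1) (hdet : K.det = 1) (hPR : Pᵀ * R = 1) :
    mat (blockElt P R K hK hdet hPR)⁻¹ = ofAdapted (blockDiag Rᵀ Kᵀ Pᵀ) := by
  have hRP : Rᵀ * P = 1 := by
    rw [← Matrix.transpose_one, ← hPR, Matrix.transpose_mul, Matrix.transpose_transpose]
  have h : ofAdapted (blockDiag Rᵀ Kᵀ Pᵀ) * mat (blockElt P R K hK hdet hPR) = 1 := by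
    rw [mat_blockElt, ← ofAdapted_mul, blockDiag_mul, hK, hPR, hRP, blockDiag_one, ofAdapted_one]
  rw [← Matrix.one_mul (mat (blockElt P R K hK hdet hPR)⁻¹), ← h, Matrix.mul_assoc, mat_mul_inv,
    Matrix.mul_one]

theorem blockElt_mem (hK : Kᵀ * K = 1) (hdet : K.det = 1) (hPR : Pᵀ * R = 1) :
    blockElt P R K hK hdet hPR ∈ G₀ m := by
  apply mem_G₀_of_Ad_gradingElt
  apply Subtype.ext
  change mat (blockElt P R K hK hdet hPR) * Matrix.diagonal (gradingDiag m) *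
    mat (blockElt P R K hK hdet hPR)⁻¹ = Matrix.diagonal (gradingDiag m)
  have h : mat (blockElt P R K hK hdet hPR) * Matrix.diagonal (gradingDiag m) =
      Matrix.diagonal (gradingDiag m) * mat (blockElt P R K hK hdet hPR) := by
    rw [mat_blockElt, ← ofAdapted_aweight, ← ofAdapted_mul, ← ofAdapted_mul, blockDiag_mul_aweight]
  rw [h, Matrix.mul_assoc, mat_mul_inv, Matrix.mul_one]

/-- Conjugation sends the block `x` to `K x P⁻¹`, and `P⁻¹ = Rᵀ`, so `R` acts on the factor `ℂ²`. -/
theorem actGr_blockElt (hK : Kᵀ * K = 1) (hdet : K.det = 1) (hPR : Pᵀ * R = 1) :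
    actGr (-1) ⟨blockElt P R K hK hdet hPR, blockElt_mem P R K hK hdet hPR⟩ =
      act (frame m) R K := by
  ext1 A
  obtain ⟨x, rfl⟩ := (frame m).surjective A
  apply Subtype.ext
  apply Subtype.ext
  change mat (blockElt P R K hK hdet hPR) * ofAdapted (negOneMat x) *
    mat (blockElt P R K hK hdet hPR)⁻¹ =
      ((act (frame m) R K (frame m x) : 𝔤 m) : Matrix (Idx m) (Idx m) ℂ)
  rw [mat_blockElt_inv, mat_blockElt, ← ofAdapted_mul, ← ofAdapted_mul]
  have : act (frame m) R K (frame m x) = frame m (fun c' => ∑ c, R c' c • (K *ᵥ x c)) := by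
    simp only [act, LinearMap.comp_apply, LinearEquiv.coe_coe, LinearEquiv.symm_apply_apply]
    congr 1
  rw [this, coe_frame]
  congr 1
  ext p q
  rcases p with p | p | p <;> rcases q with q | q | q <;>
    simp [Matrix.mul_apply, Fintype.sum_sum_type, blockDiag, negOneMat]
  · simp only [Matrix.mulVec, dotProduct]
    ring
  · simp only [Matrix.mulVec, dotProduct, Finset.mul_sum, ← Finset.sum_neg_distrib,
      ← Finset.sum_add_distrib]
    exact Finset.sum_congr rfl fun a _ => by ring

end Levi

/-! ### The homomorphism from `GL₂ × O(n)` -/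

section LeviHom

variable {n : ℕ}

theorem cmat_mul (g h : EuclideanSpace ℝ (Fin n) ≃ₗᵢ[ℝ] EuclideanSpace ℝ (Fin n)) :
    cmat (g * h) = cmat g * cmat h := by
  ext i j
  exact (congrFun (cmat_mulVec g (h (EuclideanSpace.single j 1))) i).symm

theorem cmat_one : cmat (1 : EuclideanSpace ℝ (Fin n) ≃ₗᵢ[ℝ] EuclideanSpace ℝ (Fin n)) = 1 := by
  ext i j
  by_cases h : i = j
  · subst h
    simp [cmat]
  · simp [cmat, h]

theorem cmat_neg : cmat
    (LinearIsometryEquiv.neg ℝ : EuclideanSpace ℝ (Fin n) ≃ₗᵢ[ℝ] EuclideanSpace ℝ (Fin n))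
    = -1 := by
  ext i j
  by_cases h : i = j
  · subst h
    simp [cmat]
  · simp [cmat, h]

theorem det_cmat_mul_self (g : EuclideanSpace ℝ (Fin n) ≃ₗᵢ[ℝ] EuclideanSpace ℝ (Fin n)) :
    (cmat g).det * (cmat g).det = 1 := by
  have := congrArg Matrix.det (cmat_transpose_mul_self g)
  rwa [Matrix.det_mul, Matrix.det_transpose, Matrix.det_one] at this

/-- The multiple of determinant one of the matrix of an isometry of an odd-dimensional space. -/
def scmat (g : EuclideanSpace ℝ (Fin n) ≃ₗᵢ[ℝ] EuclideanSpace ℝ (Fin n)) :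
    Matrix (Fin n) (Fin n) ℂ := (cmat g).det • cmat g

theorem scmat_mul (g h : EuclideanSpace ℝ (Fin n) ≃ₗᵢ[ℝ] EuclideanSpace ℝ (Fin n)) :
    scmat (g * h) = scmat g * scmat h := by
  rw [scmat, scmat, scmat, cmat_mul, Matrix.det_mul, Matrix.smul_mul, Matrix.mul_smul, smul_smul]

theorem scmat_one : scmat (1 : EuclideanSpace ℝ (Fin n) ≃ₗᵢ[ℝ] EuclideanSpace ℝ (Fin n)) = 1 := by
  rw [scmat, cmat_one, Matrix.det_one, one_smul]

theorem scmat_transpose_mul_self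
    (g : EuclideanSpace ℝ (Fin n) ≃ₗᵢ[ℝ] EuclideanSpace ℝ (Fin n)) :
    (scmat g)ᵀ * scmat g = 1 := by
  rw [scmat, Matrix.transpose_smul, Matrix.smul_mul, Matrix.mul_smul, smul_smul,
    det_cmat_mul_self, one_smul, cmat_transpose_mul_self]

/-- The determinant is `det(g) ^ (n + 1)`, an even power of a sign. Thus the whole orthogonal group,
generated by reflections, maps to `SO(n)`. -/
theorem det_scmat (hn : Odd n) (g : EuclideanSpace ℝ (Fin n) ≃ₗᵢ[ℝ] EuclideanSpace ℝ (Fin n)) :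
    (scmat g).det = 1 := by
  obtain ⟨k, rfl⟩ := hn
  rw [scmat, Matrix.det_smul, Fintype.card_fin, pow_succ, mul_assoc, det_cmat_mul_self, mul_one,
    pow_mul, sq, det_cmat_mul_self, one_pow]

theorem odd_halfDim (m : ℕ) : Odd (halfDim m) := ⟨m, rfl⟩

theorem inv_transpose_mul (h : GL (Fin 2) ℂ) :
    ((h⁻¹ : GL (Fin 2) ℂ) : Matrix (Fin 2) (Fin 2) ℂ)ᵀᵀ * (h : Matrix (Fin 2) (Fin 2) ℂ) = 1 := by
  rw [Matrix.transpose_transpose, Units.inv_mul]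

/-- The homomorphism from `GL₂ × O(n)` to the Levi subgroup. -/
def levi (m : ℕ) : GL (Fin 2) ℂ ×
    (EuclideanSpace ℝ (Fin (halfDim m)) ≃ₗᵢ[ℝ] EuclideanSpace ℝ (Fin (halfDim m))) →* G₀ m where
  toFun p := ⟨_, blockElt_mem _ _ _ (scmat_transpose_mul_self p.2) (det_scmat (odd_halfDim m) p.2)
    (inv_transpose_mul p.1)⟩
  map_one' := by
    apply Subtype.ext
    apply Subtype.ext
    apply Subtype.ext
    change ofAdapted (blockDiag _ (scmat 1) _) = 1
    simp only [Prod.fst_one, inv_one, Units.val_one, Matrix.transpose_one]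
    rw [scmat_one, blockDiag_one, ofAdapted_one]
  map_mul' p q := by
    apply Subtype.ext
    apply Subtype.ext
    apply Subtype.ext
    change ofAdapted (blockDiag _ (scmat (p.2 * q.2)) _) =
      ofAdapted (blockDiag _ _ _) * ofAdapted (blockDiag _ _ _)
    rw [← ofAdapted_mul, blockDiag_mul, scmat_mul, ← Matrix.transpose_mul, ← Units.val_mul,
      ← mul_inv_rev]
    rfl

theorem actGr_levi {m : ℕ} (h : GL (Fin 2) ℂ)
    (g : EuclideanSpace ℝ (Fin (halfDim m)) ≃ₗᵢ[ℝ] EuclideanSpace ℝ (Fin (halfDim m))) :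
    actGr (-1) (levi m (h, g)) = act (frame m) h (scmat g) :=
  actGr_blockElt _ _ _ _ _ _

end LeviHom

/-! ### Homomorphisms from an orthogonal group to a commutative group -/

section Orthogonal

variable {E : Type*} [NormedAddCommGroup E] [InnerProductSpace ℝ E]

theorem mul_reflection (g : E ≃ₗᵢ[ℝ] E) (v : E) :
    g * (ℝ ∙ v)ᗮ.reflection = (ℝ ∙ g v)ᗮ.reflection * g := by
  ext x
  change g ((ℝ ∙ v)ᗮ.reflection x) = (ℝ ∙ g v)ᗮ.reflection (g x)
  rw [reflection_orthogonal_singleton_apply, reflection_orthogonal_singleton_apply, map_sub,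
    map_smul, g.inner_map_map, g.norm_map]

/-- After rescaling to equal length, the reflection along the difference conjugates one reflection
to the other, and a commutative target does not see conjugation. -/
theorem map_reflection_eq {A : Type*} [CommGroup A] (φ : (E ≃ₗᵢ[ℝ] E) →* A) {v w : E} (hv : v ≠ 0)
    (hw : w ≠ 0) : φ (ℝ ∙ v)ᗮ.reflection = φ (ℝ ∙ w)ᗮ.reflection := by
  have hc : ‖v‖ / ‖w‖ ≠ 0 := div_ne_zero (norm_ne_zero_iff.2 hv) (norm_ne_zero_iff.2 hw)
  have hspan : (ℝ ∙ ((‖v‖ / ‖w‖) • w))ᗮ.reflection = (ℝ ∙ w)ᗮ.reflection := by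
    simp only [Submodule.span_singleton_smul_eq hc.isUnit w]
  rw [← hspan]
  have hn : ‖v‖ = ‖(‖v‖ / ‖w‖) • w‖ := by
    rw [norm_smul, norm_div, norm_norm, norm_norm, div_mul_cancel₀ _ (norm_ne_zero_iff.2 hw)]
  generalize (‖v‖ / ‖w‖) • w = w' at hn
  have h := mul_reflection (ℝ ∙ (v - w'))ᗮ.reflection v
  rw [Submodule.reflection_sub hn] at h
  have := congrArg φ h
  rw [map_mul, map_mul, mul_comm] at this
  exact mul_right_cancel this

theorem prod_reflection_apply {n : ℕ} (l : List (Fin n)) (hl : l.Nodup)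
    (x : EuclideanSpace ℝ (Fin n)) (j : Fin n) :
    (l.map fun i => (ℝ ∙ EuclideanSpace.single i (1 : ℝ))ᗮ.reflection).prod x j =
      if j ∈ l then -x j else x j := by
  induction l with
  | nil => simp
  | cons i l ih =>
    rw [List.nodup_cons] at hl
    rw [List.map_cons, List.prod_cons]
    change (ℝ ∙ EuclideanSpace.single i (1 : ℝ))ᗮ.reflection ((l.map fun i =>
      (ℝ ∙ EuclideanSpace.single i (1 : ℝ))ᗮ.reflection).prod x) j = _
    rw [reflection_orthogonal_singleton_apply, EuclideanSpace.inner_single_left]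
    have hi := ih hl.2
    by_cases hij : j = i
    · subst hij
      simp [hi, hl.1]
      ring
    · simp [hi, hij]

theorem neg_eq_prod_reflection (n : ℕ) :
    (LinearIsometryEquiv.neg ℝ : EuclideanSpace ℝ (Fin n) ≃ₗᵢ[ℝ] EuclideanSpace ℝ (Fin n)) =
      ((List.finRange n).map fun i => (ℝ ∙ EuclideanSpace.single i (1 : ℝ))ᗮ.reflection).prod := by
  ext x j
  rw [prod_reflection_apply _ (List.nodup_finRange n)]
  simp

/-- A homomorphism from an odd orthogonal group to a commutative group which kills `-1` is
trivial. -/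
theorem eq_one_of_map_neg_eq_one {n : ℕ} (hn : Odd n) {A : Type*} [CommGroup A]
    (φ : (EuclideanSpace ℝ (Fin n) ≃ₗᵢ[ℝ] EuclideanSpace ℝ (Fin n)) →* A)
    (hφ : φ (LinearIsometryEquiv.neg ℝ) = 1) : φ = 1 := by
  have hne : ∀ i : Fin n, EuclideanSpace.single i (1 : ℝ) ≠ 0 := fun i h => by
    simpa using congrArg norm h
  let i₀ : Fin n := ⟨0, hn.pos⟩
  set a := φ (ℝ ∙ EuclideanSpace.single i₀ (1 : ℝ))ᗮ.reflection with ha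
  -- All reflections have the same image `a`, with `a² = 1`. Since `-1` is a product of `n`
  -- reflections, also `aⁿ = 1`, so `a = 1` for odd `n`.
  have h2 : a ^ 2 = 1 := by
    rw [sq, ha, ← map_mul, Submodule.reflection_mul_reflection, map_one]
  have h1 : a ^ n = 1 := by
    rw [← hφ, neg_eq_prod_reflection, map_list_prod, List.map_map]
    have : (φ ∘ fun i : Fin n => (ℝ ∙ EuclideanSpace.single i (1 : ℝ))ᗮ.reflection) =
        fun _ => a := by
      ext i
      exact map_reflection_eq φ (hne i) (hne i₀)
    rw [this, List.map_const', List.prod_replicate, List.length_finRange]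
  have h : a = 1 := by
    obtain ⟨k, rfl⟩ := hn
    rwa [pow_succ, pow_mul, h2, one_pow, one_mul] at h1
  have htop : (⊤ : Subgroup (EuclideanSpace ℝ (Fin n) ≃ₗᵢ[ℝ] EuclideanSpace ℝ (Fin n))) ≤
      φ.ker := by
    rw [← LinearIsometryEquiv.reflections_generate, Subgroup.closure_le]
    rintro _ ⟨v, rfl⟩
    rw [SetLike.mem_coe, MonoidHom.mem_ker]
    by_cases hv : v = 0
    · have : (ℝ ∙ v)ᗮ.reflection = 1 := by
        ext1 x
        rw [reflection_orthogonal_singleton_apply, hv]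
        simp
      simp only [this, map_one]
    · exact (map_reflection_eq φ hv (hne i₀)).trans h
  ext g
  exact htop (Subgroup.mem_top g)

end Orthogonal

/-! ### Elements of the semisimple part of the Levi subgroup -/

section Semisimple

open scoped commutatorElement

variable {m : ℕ}

theorem exists_mem_G₀ss_of_mul_eq (A B : GL (Fin 2) ℂ) (h : Matrix (Fin 2) (Fin 2) ℂ)
    (hAB : (A : Matrix (Fin 2) (Fin 2) ℂ) * B = h * (B * A)) :
    ∃ g ∈ G₀ss m, actGr (-1) g = act (frame m) h 1 := by
  refine ⟨levi m (⁅A, B⁆, 1), ?_, ?_⟩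
  · have : levi m (⁅A, B⁆, 1) = ⁅levi m (A, 1), levi m (B, 1)⁆ := by
      rw [← map_commutatorElement]
      congr 1
    rw [this]
    exact Subgroup.commutator_mem_commutator (Subgroup.mem_top _) (Subgroup.mem_top _)
  · rw [actGr_levi, scmat_one]
    congr 1
    have : ((⁅A, B⁆ : GL (Fin 2) ℂ) : Matrix (Fin 2) (Fin 2) ℂ) * (B * A) = h * (B * A) := by
      rw [← hAB, ← Units.val_mul, ← Units.val_mul, ← Units.val_mul]
      congr 1
      rw [commutatorElement_def]
      group
    rw [← Units.val_mul] at this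
    exact (B * A).isUnit.mul_right_cancel this

/-- The map from `O(n)` to the abelianisation of `G₀` kills `-1`, because `scmat` does, and is
therefore trivial. -/
theorem levi_isom_mem_G₀ss
    (g : EuclideanSpace ℝ (Fin (halfDim m)) ≃ₗᵢ[ℝ] EuclideanSpace ℝ (Fin (halfDim m))) :
    levi m (1, g) ∈ G₀ss m := by
  rw [G₀ss, ← Abelianization.ker_of, MonoidHom.mem_ker]
  let φ := (Abelianization.of (G := G₀ m)).comp ((levi m).comp (MonoidHom.inr (GL (Fin 2) ℂ) _))
  have hneg : levi m (1, LinearIsometryEquiv.neg ℝ) = levi m (1, 1) := by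
    apply Subtype.ext
    apply Subtype.ext
    apply Subtype.ext
    change ofAdapted (blockDiag _ (scmat _) _) = ofAdapted (blockDiag _ (scmat _) _)
    congr 2
    rw [scmat_one, scmat, cmat_neg, Matrix.det_neg, Matrix.det_one, Fintype.card_fin,
      (odd_halfDim m).neg_one_pow]
    simp
  have h : φ = 1 := eq_one_of_map_neg_eq_one (odd_halfDim m) φ (by
    change Abelianization.of (levi m (1, LinearIsometryEquiv.neg ℝ)) = 1
    rw [hneg]
    exact (congrArg _ (levi m).map_one).trans (map_one _))
  exact DFunLike.congr_fun h g

/-- The two `SL₂` operators are commutators in `GL₂`; an isometry of determinant `-1` is reached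
only up to the sign `c`. -/
theorem IsFrameOp.exists_mem_G₀ss {F : V m →ₗ[ℂ] V m} (hF : IsFrameOp (frame m) F) :
    ∃ g ∈ G₀ss m, ∃ c : ℂ, c * c = 1 ∧ actGr (-1) g = c • F := by
  cases hF with
  | weyl =>
    -- Conjugation by `diag(1, -1)` inverts a rotation, so its commutator with a rotation by 45
    -- degrees, here scaled by `√2`, is a rotation by 90 degrees.
    obtain ⟨g, hg, h⟩ := exists_mem_G₀ss_of_mul_eq (m := m)
      (Matrix.GeneralLinearGroup.mkOfDetNeZero !![1, 0; 0, -1] (by simp))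
      (Matrix.GeneralLinearGroup.mkOfDetNeZero !![1, 1; -1, 1] (by norm_num [Matrix.det_fin_two]))
      weylMat (by
        ext i j
        fin_cases i <;> fin_cases j <;>
          simp [Matrix.GeneralLinearGroup.mkOfDetNeZero, weylMat])
    exact ⟨g, hg, 1, mul_one 1, by rw [h, one_smul]⟩
  | torus t ht =>
    -- Conjugating `diag(1, t)` by the coordinate swap gives `diag(t, 1)`, and the quotient of the
    -- two is `diag(t, t⁻¹)`.
    obtain ⟨g, hg, h⟩ := exists_mem_G₀ss_of_mul_eq (m := m)
      (Matrix.GeneralLinearGroup.mkOfDetNeZero !![0, 1; 1, 0] (by simp))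
      (Matrix.GeneralLinearGroup.mkOfDetNeZero !![1, 0; 0, t] (by simp [ht]))
      (torusMat t) (by
        ext i j
        fin_cases i <;> fin_cases j <;>
          simp [Matrix.GeneralLinearGroup.mkOfDetNeZero, torusMat, ht])
    exact ⟨g, hg, 1, mul_one 1, by rw [h, one_smul]⟩
  | isom g =>
    refine ⟨levi m (1, g), levi_isom_mem_G₀ss g, (cmat g).det, det_cmat_mul_self g, ?_⟩
    rw [actGr_levi]
    apply linearMap_ext_tens (frame m)
    intro c a
    rw [Units.val_one, act_isom, LinearMap.smul_apply, act_isom, scmat, Matrix.smul_mulVec,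
      map_smul]

end Semisimple

/-! ### Quadrics on the Plücker space -/

section PluckerSpace

theorem map_smul_of_mem {n : ℕ} {W : Type*} [AddCommGroup W] [Module ℂ W] (F : W →ₗ[ℂ] W) (c : ℂ)
    {x : ExteriorAlgebra ℂ W} (hx : x ∈ ⋀[ℂ]^n W) :
    ExteriorAlgebra.map (c • F) x = c ^ n • ExteriorAlgebra.map F x := by
  rw [← ExteriorAlgebra.ιMulti_span_fixedDegree] at hx
  induction hx using Submodule.span_induction with
  | mem x hx =>
    obtain ⟨v, rfl⟩ := hx
    rw [ExteriorAlgebra.map_apply_ιMulti, ExteriorAlgebra.map_apply_ιMulti]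
    have := (ExteriorAlgebra.ιMulti ℂ n).map_smul_univ (fun _ => c) (F ∘ v)
    rw [Finset.prod_const, Finset.card_univ, Fintype.card_fin] at this
    exact this
  | zero => simp
  | add x y _ _ hx hy => rw [map_add, hx, hy, map_add, smul_add]
  | smul a x _ hx => rw [map_smul, hx, map_smul, smul_comm]

theorem map_subtype_mem_span {n : ℕ} {W : Type*} [AddCommGroup W] [Module ℂ W]
    {L : Submodule ℂ W} (b : Module.Basis (Fin n) ℂ L) {x : ⋀[ℂ]^n W} (hx : x ∈ detLine n L) :
    ∃ c : ℂ, (x : ExteriorAlgebra ℂ W) = c • ExteriorAlgebra.ιMulti ℂ n fun i => (b i : W) := by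
  obtain ⟨y, rfl⟩ := hx
  have hy : y ∈ Submodule.span ℂ (Set.range (exteriorPower.ιMulti ℂ n (M := L))) := by
    rw [exteriorPower.ιMulti_span]
    trivial
  induction hy using Submodule.span_induction with
  | mem y hy =>
    obtain ⟨v, rfl⟩ := hy
    refine ⟨Matrix.det (Matrix.of fun i j => b.repr (v i) j), ?_⟩
    rw [exteriorPower.map_apply_ιMulti]
    refine ιMulti_sum_smul (fun i => (b i : W)) (L.subtype ∘ v) _ fun i => ?_
    conv_lhs => rw [Function.comp_apply, ← b.sum_repr (v i), map_sum]
    rfl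
  | zero => exact ⟨0, by simp⟩
  | add y z _ _ hy hz =>
    obtain ⟨c, hc⟩ := hy
    obtain ⟨d, hd⟩ := hz
    exact ⟨c + d, by rw [map_add, Submodule.coe_add, hc, hd, add_smul]⟩
  | smul a y _ hy =>
    obtain ⟨c, hc⟩ := hy
    exact ⟨a * c, by rw [map_smul, Submodule.coe_smul, hc, mul_smul]⟩

variable {m : ℕ}

theorem omega_eq_zero_iff {x y : V m} : omega m x y = 0 ↔ sform (frame m) x y = 0 := by
  rw [omega_eq, smul_eq_zero, or_iff_left (negTwoElt_ne_zero m)]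

/-- Every functional on `𝔤_{-2}` turns `ω` into a multiple of `sform`, and some functional gives a
nonzero multiple. -/
theorem mem_primitive_iff {x : ⋀[ℂ]^(halfDim m) (V m)} :
    x ∈ primitive (halfDim m) (omega m) ↔ (x : ExteriorAlgebra ℂ (V m)) ∈ prim (frame m) := by
  have h : ∀ ℓ : Module.Dual ℂ (gr m (-2)),
      (omega m).compr₂ ℓ = ℓ (negTwoElt m) • sform (frame m) := by
    intro ℓ
    ext x y
    rw [LinearMap.compr₂_apply, omega_eq, map_smul, LinearMap.smul_apply, LinearMap.smul_apply,
      smul_eq_mul, smul_eq_mul, mul_comm]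
  constructor
  · intro hx
    refine ⟨x.2, ?_⟩
    by_contra hne
    refine negTwoElt_ne_zero m ((Module.forall_dual_apply_eq_zero_iff ℂ _).1 fun ℓ => ?_)
    have := hx ℓ
    rw [h, contract_smul, smul_eq_zero] at this
    exact this.resolve_right hne
  · intro hx ℓ
    rw [h, contract_smul]
    exact (congrArg _ (LinearMap.mem_ker.1 hx.2)).trans (smul_zero _)

/-- The inclusion of the Plücker space into the exterior algebra. -/
def pluckerIncl (m : ℕ) : Plucker m →ₗ[ℂ] ExteriorAlgebra ℂ (V m) :=
  Submodule.subtype _ ∘ₗ Primitive.incl (halfDim m) (omega m)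

theorem pluckerIncl_injective (m : ℕ) : Function.Injective (pluckerIncl m) :=
  fun _ _ h => Subtype.ext (Subtype.ext h)

theorem pluckerIncl_mem (w : Plucker m) : pluckerIncl m w ∈ prim (frame m) :=
  mem_primitive_iff.1 (Subtype.property (p := (· ∈ primitive (halfDim m) (omega m))) w)

theorem exists_pluckerIncl_eq {x : ExteriorAlgebra ℂ (V m)} (hx : x ∈ prim (frame m)) :
    ∃ w, pluckerIncl m w = x :=
  ⟨⟨⟨x, hx.1⟩, mem_primitive_iff.2 hx⟩, rfl⟩

theorem pluckerIncl_actPlucker (g : G₀ m) (w : Plucker m) :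
    pluckerIncl m (actPlucker g w) = ExteriorAlgebra.map (actGr (-1) g) (pluckerIncl m w) :=
  coe_exteriorPower_map (halfDim m) (actGr (-1) g) (Primitive.incl _ _ w)

/-- Composition with a linear retraction. The extension need not be invariant; only its values on
primitive elements are used. -/
theorem exists_extension (Q : Quadric m) : ∃ R : QuadraticForm ℂ (ExteriorAlgebra ℂ (V m)),
    ∀ w, R (pluckerIncl m w) = Q w := by
  obtain ⟨π, hπ⟩ := LinearMap.exists_leftInverse_of_injective (pluckerIncl m)
    (LinearMap.ker_eq_bot.2 (pluckerIncl_injective m))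
  exact ⟨Q.comp π, fun w => congrArg Q (LinearMap.congr_fun hπ w)⟩

theorem quadric_map_eq_pullQuadric {Q : Quadric m} {R : QuadraticForm ℂ (ExteriorAlgebra ℂ (V m))}
    (hR : ∀ w, R (pluckerIncl m w) = Q w) {F : V m →ₗ[ℂ] V m} {g : G₀ m} {c : ℂ} (hc : c * c = 1)
    (hg : actGr (-1) g = c • F) (w : Plucker m) :
    R (ExteriorAlgebra.map F (pluckerIncl m w)) = pullQuadric g Q w := by
  have h1 : pullQuadric g Q w = R (pluckerIncl m (actPlucker g w)) := (hR _).symm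
  have h2 : ∀ x, R (c ^ halfDim m • x) = R x := fun x => by
    rw [QuadraticMap.map_smul, ← mul_pow, hc, one_pow, one_smul]
  rw [h1, pluckerIncl_actPlucker, hg, map_smul_of_mem F c (pluckerIncl_mem w).1, h2]

theorem quadric_eq_zero {Q : Quadric m} (hQ : ∀ g ∈ G₀ss m, pullQuadric g Q = Q) : Q = 0 := by
  obtain ⟨R, hR⟩ := exists_extension Q
  ext w
  rw [← hR, zero_apply]
  refine eq_zero_of_invariant (frame m) (odd_halfDim m) R (fun F hF x hx => ?_) (pluckerIncl_mem w)
  obtain ⟨w, rfl⟩ := exists_pluckerIncl_eq hx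
  obtain ⟨g, hg, c, hc, hgF⟩ := hF.exists_mem_G₀ss
  rw [quadric_map_eq_pullQuadric hR hc hgF, hQ g hg, hR]

theorem span_isLagrangian {w : Fin (halfDim m) → V m}
    (hw : ∀ i j, sform (frame m) (w i) (w j) = 0) (hli : LinearIndependent ℂ w) :
    IsLagrangian (halfDim m) (omega m) (Submodule.span ℂ (Set.range w)) := by
  refine ⟨by rw [finrank_span_eq_card hli, Fintype.card_fin], fun x hx y hy => ?_⟩
  rw [omega_eq_zero_iff]
  induction hx, hy using Submodule.span_induction₂ with
  | mem_mem x y hx hy =>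
    obtain ⟨i, rfl⟩ := hx
    obtain ⟨j, rfl⟩ := hy
    exact hw i j
  | zero_left y => simp
  | zero_right x => simp
  | add_left x y z _ _ _ hx hy => rw [map_add, LinearMap.add_apply, hx, hy, add_zero]
  | add_right x y z _ _ _ hx hy => rw [map_add, hx, hy, add_zero]
  | smul_left a x y _ _ h => rw [map_smul, LinearMap.smul_apply, h, smul_zero]
  | smul_right a x y _ _ h => rw [map_smul, h, smul_zero]

theorem exists_pluckerIncl_eq_ιMulti {w : Fin (halfDim m) → V m}
    (hw : ∀ i j, sform (frame m) (w i) (w j) = 0) :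
    ∃ p : Plucker m, pluckerIncl m p = ExteriorAlgebra.ιMulti ℂ (halfDim m) w ∧
      Primitive.incl (halfDim m) (omega m) p ∈
        detLine (halfDim m) (Submodule.span ℂ (Set.range w)) := by
  obtain ⟨p, hp⟩ := exists_pluckerIncl_eq (ιMulti_mem_prim (frame m) w hw)
  refine ⟨p, hp, exteriorPower.ιMulti ℂ _
    (fun i => ⟨w i, Submodule.subset_span (Set.mem_range_self i)⟩), ?_⟩
  rw [exteriorPower.map_apply_ιMulti]
  apply Subtype.ext
  exact hp.symm

/-- Invariance modulo the ideal is invariance of the values on the cone, which is all that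
`ConeInvariant` asks; linearly dependent families contribute zero on both sides. -/
theorem mem_quadIdeal {Q : Quadric m}
    (hQ : ∀ g ∈ G₀ss m, pullQuadric g Q - Q ∈ quadIdeal (halfDim m) (omega m)) :
    Q ∈ quadIdeal (halfDim m) (omega m) := by
  obtain ⟨R, hR⟩ := exists_extension Q
  have hinv : ConeInvariant (frame m) R := by
    intro F hF w hw
    by_cases hli : LinearIndependent ℂ w
    · obtain ⟨p, hp, hpL⟩ := exists_pluckerIncl_eq_ιMulti hw
      obtain ⟨g, hg, c, hc, hgF⟩ := hF.exists_mem_G₀ss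
      have := hQ g hg _ (span_isLagrangian hw hli) p hpL
      rw [sub_apply, sub_eq_zero] at this
      rw [← hp, quadric_map_eq_pullQuadric hR hc hgF, this, hR]
    · rw [AlternatingMap.map_linearDependent _ _ hli, map_zero]
  intro L hL p hp
  let b := Module.finBasisOfFinrankEq ℂ L hL.1
  obtain ⟨c, hc⟩ := map_subtype_mem_span b hp
  have hc' : pluckerIncl m p = _ := hc
  rw [← hR, hc', QuadraticMap.map_smul, hinv.eq_zero (odd_halfDim m), smul_zero]
  · intro i j
    exact omega_eq_zero_iff.1 (hL.2 _ (b i).2 _ (b j).2)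
  · exact b.linearIndependent.map' L.subtype (Submodule.ker_subtype L)

theorem eq_zero_of_mem_R₂ {q : CoordRing₂ m} (hq : q ∈ R₂ m) : q = 0 := by
  obtain ⟨Q, rfl⟩ := Submodule.mkQ_surjective _ q
  rw [Submodule.mkQ_apply, Submodule.Quotient.mk_eq_zero]
  refine mem_quadIdeal fun g hg => ?_
  exact (Submodule.Quotient.eq _).1 (hq g hg)

end PluckerSpace

end TypeB

end

theorem mainTheorem6 (m : ℕ) :
    (∀ Q : TypeB.Quadric m, (∀ g ∈ TypeB.G₀ss m, TypeB.pullQuadric g Q = Q) → Q = 0) ∧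
      IsEmpty (ℙ ℂ (TypeB.R₂ m)) :=
  ⟨fun _ hQ => TypeB.quadric_eq_zero hQ,
    ⟨fun p => p.rep_nonzero (Subtype.ext (TypeB.eq_zero_of_mem_R₂ p.rep.2))⟩⟩
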